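/- **Setting.** Inner products are linear in the first argument; $[X,Y]$ is the set of linear operators between finite-dimensional Hilbert spaces, $[X]=[X,X]$, and $P_L$ is the orthogonal projector onto $L$. Let $H,\hat H$ be finite-dimensional complex Hilbert spaces, $H_0=H\oplus\hat H$, $\mathbb H=H_0\oplus H=H\oplus\hat H\oplus H$, and $J\{y_0,\hat y,y_1\}=\{-y_1,i\hat y,y_0\}$ on $\mathbb H$. Let $\mathcal I=[a,b\rangle$, $-\infty<a<b\le\infty$ (a finite endpoint $b$ may or may not belong to $\mathcal I$), and let $B,\Delta:\mathcal I\to[\mathbb H]$ be integrable on each $[a,\beta]\subset\mathcal I$ with $B(t)=B(t)^*$, $\Delta(t)\ge0$ a.e. Let $\mathcal L^2_\Delta$ be the space of Borel functions $f:\mathcal I\to\mathbb H$ with $\|f\|_\Delta^2=\int_{\mathcal I}(\Delta f,f)\,dt<\infty$, let $L^2_\Delta=\mathcal L^2_\Delta/\{f:\|f\|_\Delta=0\}$ with quotient map $\pi$, let $$\mathcal T_{\max}=\{\{y,f\}\in(\mathcal L^2_\Delta)^2:\ y \text{ is absolutely continuous on each } [a,\beta]\subset\mathcal I,\ Jy'-By=\Delta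 f\ \text{a.e. on }\mathcal I\},$$ and $T_{\max}=(\pi\oplus\pi)\mathcal T_{\max}$. Assume that the system is definite: if $\lambda\in\mathbb C$, $Jy'-By=\lambda\Delta y$ and $\Delta y=0$ a.e. on $\mathcal I$, then $y=0$. Then each $\{\tilde y,\tilde f\}\in T_{\max}$ has a unique representative $y\in\operatorname{dom}\mathcal T_{\max}$, i.e. a unique $y\in\tilde y$ with $\{y,f\}\in\mathcal T_{\max}$ for some (equivalently, every) $f\in\tilde f$. Let $U=\begin{pmatrix}u_1&u_2&u_3\\u_4&u_5&u_6\end{pmatrix}:H\oplus\hat H\oplus H\to\hat H\oplus H$ be surjective with $$iu_2u_2^*-u_1u_3^*+u_3u_1^*=iI,\quad iu_5u_2^*-u_4u_3^*+u_6u_1^*=0,\quad iu_5u_5^*+u_6u_4^*-u_4u_6^*=0,$$ let $\tilde U:\mathbb H\to H\oplus\hat H\oplus H$ be a $J$-unitary extension of $U$ (its first row is $(u_7,u_8,u_9)$, its other rows are those of $U$, and $\tilde U^*J\tilde U=J$), and write $\tilde Uy(a)=\{\Gamma_{0a}y,\hat\Gamma_ay,\Gamma_{1a}y\}$. Let $\tilde{\mathcal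 H}_b$ be a finite-dimensional Hilbert space, $\mathcal H_b\subset\tilde{\mathcal H}_b$ a subspace with orthogonal complement $\mathcal H_b^\perp$ in $\tilde{\mathcal H}_b$, and let $\Gamma_b=(\Gamma_{0b},\hat\Gamma_b,\Gamma_{1b})^\top:\operatorname{dom}\mathcal T_{\max}\to\tilde{\mathcal H}_b\oplus\hat H\oplus\mathcal H_b$ be a surjective linear map such that for all $y,z\in\operatorname{dom}\mathcal T_{\max}$ $$\lim_{t\uparrow b}(Jy(t),z(t))=(\Gamma_{0b}y,\Gamma_{1b}z)-(\Gamma_{1b}y,\Gamma_{0b}z)+i(P_{\mathcal H_b^\perp}\Gamma_{0b}y,P_{\mathcal H_b^\perp}\Gamma_{0b}z)+i(\hat\Gamma_by,\hat\Gamma_bz).$$ **The decomposing boundary triplet and its Weyl functions.** Let $\mathcal H_0=H_0\oplus\tilde{\mathcal H}_b$, $\mathcal H_1=H_0\oplus\mathcal H_b$, let $P_1,P_2$ be the orthogonal projectors of $\mathcal H_0$ onto $\mathcal H_1$ and $\mathcal H_0\ominus\mathcal H_1=\mathcal H_b^\perp$, and define $\Gamma_j:T_{\max}\to\mathcal H_j$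 by $$\Gamma_0\{\tilde y,\tilde f\}=\{-\Gamma_{1a}y+i(\hat\Gamma_a-\hat\Gamma_b)y,\ \Gamma_{0b}y\},\qquad \Gamma_1\{\tilde y,\tilde f\}=\{\Gamma_{0a}y+\tfrac12(\hat\Gamma_a+\hat\Gamma_b)y,\ -\Gamma_{1b}y\}.$$ With $\hat{\mathfrak N}_\lambda=\{\{\tilde y,\lambda\tilde y\}\in T_{\max}\}$, the Weyl functions are $$M_+(\lambda)=\Gamma_1(\Gamma_0\restriction\hat{\mathfrak N}_\lambda)^{-1}\in[\mathcal H_0,\mathcal H_1]\ (\lambda\in\mathbb C_+),\qquad M_-(\lambda)=(\Gamma_1+iP_2\Gamma_0)(P_1\Gamma_0\restriction\hat{\mathfrak N}_\lambda)^{-1}\in[\mathcal H_1,\mathcal H_0]\ (\lambda\in\mathbb C_-).$$ Write $$M_\pm(\lambda)=\begin{pmatrix}m_0(\lambda)&M_{2\pm}(\lambda)\\M_{3\pm}(\lambda)&M_{4\pm}(\lambda)\end{pmatrix}$$ with respect to $\mathcal H_0=H_0\oplus\tilde{\mathcal H}_b$ and $\mathcal H_1=H_0\oplus\mathcal H_b$;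 so $m_0$ is defined on $\mathbb C\setminus\mathbb R$. **Boundary parameters and $m$-functions.** A boundary parameter $\tau$ consists of holomorphic functions $C_0(\lambda)\in[\tilde{\mathcal H}_b]$, $C_1(\lambda)\in[\mathcal H_b,\tilde{\mathcal H}_b]$ on $\mathbb C_+$ and $D_0(\lambda)\in[\tilde{\mathcal H}_b,\mathcal H_b]$, $D_1(\lambda)\in[\mathcal H_b]$ on $\mathbb C_-$ such that, with $C_0=(C_{01},C_{02})$ and $D_0=(D_{01},D_{02})$ with respect to $\tilde{\mathcal H}_b=\mathcal H_b\oplus\mathcal H_b^\perp$: on $\mathbb C_+$, $2\operatorname{Im}(C_1C_{01}^*)+C_{02}C_{02}^*\ge0$ and $C_0-iC_1P_{\mathcal H_b}$ is invertible; on $\mathbb C_-$, $2\operatorname{Im}(D_1D_{01}^*)+D_{02}D_{02}^*\le0$ and $D_{01}+iD_1$ is invertible; and $C_1(\lambda)D_{01}^*(\bar\lambda)-C_{01}(\lambda)D_1^*(\bar\lambda)+iC_{02}(\lambda)D_{02}^*(\bar\lambda)=0$ for $\lambda\in\mathbb C_+$. Let $\tau_0$ be the boundary parameter $C_0\equiv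 I$, $C_1\equiv0$, $D_0\equiv P_{\mathcal H_b}$, $D_1\equiv0$. For $\lambda\in\mathbb C\setminus\mathbb R$ let $v_\tau(\cdot,\lambda):\mathcal I\to[H_0,\mathbb H]$ be the operator function such that, for each $h\in H_0$, $y=v_\tau(\cdot,\lambda)h\in\mathcal L^2_\Delta$ is a solution of $Jy'-By=\lambda\Delta y$ with $\Gamma_{1a}y=-P_Hh$, $i(\hat\Gamma_a-\hat\Gamma_b)y=P_{\hat H}h$, and $C_0(\lambda)\Gamma_{0b}y+C_1(\lambda)\Gamma_{1b}y=0$ if $\lambda\in\mathbb C_+$, $D_0(\lambda)\Gamma_{0b}y+D_1(\lambda)\Gamma_{1b}y=0$ if $\lambda\in\mathbb C_-$. The $m$-function of $\tau$ is $$m_\tau(\lambda)h=(\Gamma_{0a}+\hat\Gamma_a)\,v_\tau(\cdot,\lambda)h+\tfrac i2P_{\hat H}h,\qquad h\in H_0,\ \lambda\in\mathbb C\setminus\mathbb R.$$ **Theorem 5.4.** The functions above are well defined: $\Gamma_0\restriction\hat{\mathfrak N}_\lambda$ is a bijection onto $\mathcal H_0$ for $\lambda\in\mathbb C_+$, $P_1\Gamma_0\restriction\hat{\mathfrak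 N}_\lambda$ is a bijection onto $\mathcal H_1$ for $\lambda\in\mathbb C_-$, and for every boundary parameter $\tau$ and $\lambda\in\mathbb C\setminus\mathbb R$ the solution $v_\tau(\cdot,\lambda)$ exists and is unique. Moreover $m_0(\lambda)=m_{\tau_0}(\lambda)$ for all $\lambda\in\mathbb C\setminus\mathbb R$, and for every boundary parameter $\tau$ and every $\lambda\in\mathbb C_+$ the operator $C_0(\lambda)-C_1(\lambda)M_{4+}(\lambda)$ is invertible and $$m_\tau(\lambda)=m_0(\lambda)+M_{2+}(\lambda)\bigl(C_0(\lambda)-C_1(\lambda)M_{4+}(\lambda)\bigr)^{-1}C_1(\lambda)M_{3+}(\lambda).$$ -/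

import Mathlib

open MeasureTheory Filter Set
open scoped Topology ENNReal InnerProductSpace

noncomputable section

namespace SymmSys

/-! Throughout, `K` stands for the space `Ĥ`. Mathlib's inner product is linear in the second
argument, so the inner product `(x, y)`, linear in `x`, is `⟪y, x⟫_ℂ`. -/

/-- The orthogonal sum `X ⊕ Y` of two Hilbert spaces. -/
def OSum (X Y : Type*) := WithLp 2 (X × Y)

namespace OSum

variable {X Y X' Y' : Type*}
  [NormedAddCommGroup X] [InnerProductSpace ℂ X] [NormedAddCommGroup Y] [InnerProductSpace ℂ Y]
  [NormedAddCommGroup X'] [InnerProductSpace ℂ X']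
  [NormedAddCommGroup Y'] [InnerProductSpace ℂ Y']

instance : NormedAddCommGroup (OSum X Y) := inferInstanceAs (NormedAddCommGroup (WithLp 2 (X × Y)))

instance : InnerProductSpace ℂ (OSum X Y) :=
  inferInstanceAs (InnerProductSpace ℂ (WithLp 2 (X × Y)))

variable (X Y) in
/-- The identification of `X ⊕ Y` with `X × Y`. -/
def equiv : OSum X Y ≃L[ℂ] X × Y := WithLp.prodContinuousLinearEquiv 2 ℂ X Y

instance [FiniteDimensional ℂ X] [FiniteDimensional ℂ Y] : FiniteDimensional ℂ (OSum X Y) :=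
  (equiv X Y).symm.toLinearEquiv.finiteDimensional

instance [CompleteSpace X] [CompleteSpace Y] : CompleteSpace (OSum X Y) :=
  inferInstanceAs (CompleteSpace (WithLp 2 (X × Y)))

/-- The element `{x, y}` of `X ⊕ Y`. -/
def pair (x : X) (y : Y) : OSum X Y := (equiv X Y).symm (x, y)

/-- The first component. -/
def fst : OSum X Y →L[ℂ] X := ContinuousLinearMap.fst ℂ X Y ∘L (equiv X Y : OSum X Y →L[ℂ] X × Y)

/-- The second component. -/
def snd : OSum X Y →L[ℂ] Y := ContinuousLinearMap.snd ℂ X Y ∘L (equiv X Y : OSum X Y →L[ℂ] X × Y)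

/-- The embedding `x ↦ {x, 0}`. -/
def inl : X →L[ℂ] OSum X Y :=
  ((equiv X Y).symm : X × Y →L[ℂ] OSum X Y) ∘L ContinuousLinearMap.inl ℂ X Y

/-- The embedding `y ↦ {0, y}`. -/
def inr : Y →L[ℂ] OSum X Y :=
  ((equiv X Y).symm : X × Y →L[ℂ] OSum X Y) ∘L ContinuousLinearMap.inr ℂ X Y

@[simp] lemma fst_pair (x : X) (y : Y) : fst (pair x y) = x := rfl

@[simp] lemma snd_pair (x : X) (y : Y) : snd (pair x y) = y := rfl

@[simp] lemma inl_apply (x : X) : (inl x : OSum X Y) = pair x 0 := rfl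

@[simp] lemma inr_apply (y : Y) : (inr y : OSum X Y) = pair 0 y := rfl

@[ext] lemma ext {x y : OSum X Y} (h₁ : fst x = fst y) (h₂ : snd x = snd y) : x = y :=
  (equiv X Y).injective (Prod.ext h₁ h₂)

lemma inner_def (x y : OSum X Y) : ⟪x, y⟫_ℂ = ⟪fst x, fst y⟫_ℂ + ⟪snd x, snd y⟫_ℂ :=
  WithLp.prod_inner_apply (𝕜 := ℂ) (E := X) (F := Y) x y

/-- The upper left block of an operator `X ⊕ Y → X' ⊕ Y'`. -/
def block₁₁ (M : OSum X Y →L[ℂ] OSum X' Y') : X →L[ℂ] X' := fst ∘L M ∘L inl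

/-- The upper right block of an operator `X ⊕ Y → X' ⊕ Y'`. -/
def block₁₂ (M : OSum X Y →L[ℂ] OSum X' Y') : Y →L[ℂ] X' := fst ∘L M ∘L inr

/-- The lower left block of an operator `X ⊕ Y → X' ⊕ Y'`. -/
def block₂₁ (M : OSum X Y →L[ℂ] OSum X' Y') : X →L[ℂ] Y' := snd ∘L M ∘L inl

/-- The lower right block of an operator `X ⊕ Y → X' ⊕ Y'`. -/
def block₂₂ (M : OSum X Y →L[ℂ] OSum X' Y') : Y →L[ℂ] Y' := snd ∘L M ∘L inr

end OSum

open OSum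

/-- `H₀ = H ⊕ Ĥ`. -/
abbrev HZero (H K : Type*) := OSum H K

/-- `𝐇 = H₀ ⊕ H = H ⊕ Ĥ ⊕ H`. -/
abbrev HBig (H K : Type*) := OSum (HZero H K) H

section Spaces

variable {H K : Type*}
  [NormedAddCommGroup H] [InnerProductSpace ℂ H] [NormedAddCommGroup K] [InnerProductSpace ℂ K]

/-- The element `{y₀, ŷ, y₁}` of `𝐇`. -/
def mk₃ (y₀ : H) (yh : K) (y₁ : H) : HBig H K := pair (pair y₀ yh) y₁

/-- The component `y₀` of `y = {y₀, ŷ, y₁} ∈ 𝐇`. -/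
def c₀ (y : HBig H K) : H := fst (fst y)

/-- The component `ŷ` of `y = {y₀, ŷ, y₁} ∈ 𝐇`. -/
def ch (y : HBig H K) : K := snd (fst y)

/-- The component `y₁` of `y = {y₀, ŷ, y₁} ∈ 𝐇`. -/
def c₁ (y : HBig H K) : H := snd y

/-- The signature operator `J {y₀, ŷ, y₁} = {-y₁, i ŷ, y₀}`. -/
def J : HBig H K →ₗ[ℂ] HBig H K where
  toFun y := mk₃ (-c₁ y) (Complex.I • ch y) (c₀ y)
  map_add' x y := by
    refine OSum.ext (OSum.ext ?_ ?_) ?_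
    · exact (congrArg Neg.neg (map_add snd x y)).trans (neg_add _ _)
    · exact (congrArg (Complex.I • snd ·) (map_add fst x y)).trans
        ((congrArg (Complex.I • ·) (map_add snd _ _)).trans (smul_add _ _ _))
    · exact (congrArg fst (map_add fst x y)).trans (map_add fst _ _)
  map_smul' c y := by
    refine OSum.ext (OSum.ext ?_ ?_) ?_
    · exact (congrArg Neg.neg (map_smul snd c y)).trans (smul_neg _ _).symm
    · exact (congrArg (Complex.I • snd ·) (map_smul fst c y)).trans
        ((congrArg (Complex.I • ·) (map_smul snd _ _)).trans (smul_comm _ _ _))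
    · exact (congrArg fst (map_smul fst c y)).trans (map_smul fst _ _)

end Spaces

/-- A first-order symmetric system `J y' - B(t) y = Δ(t) f(t)` on `I = [a, b⟩`, where
`-∞ < a < b ≤ ∞` and the endpoint `b < ∞` may or may not belong to `I`; the coefficients are
locally integrable on `I`, `B(t) = B(t)*` and `Δ(t) ≥ 0` a.e. on `I`. -/
structure SymmetricSystem (H K : Type*)
    [NormedAddCommGroup H] [InnerProductSpace ℂ H]
    [NormedAddCommGroup K] [InnerProductSpace ℂ K] where
  a : ℝ
  I : Set ℝ
  interval : (∃ b, a < b ∧ (I = Icc a b ∨ I = Ico a b)) ∨ I = Ici a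
  B : ℝ → HBig H K →L[ℂ] HBig H K
  Δ : ℝ → HBig H K →L[ℂ] HBig H K
  integrable_B : ∀ β ∈ I, IntegrableOn B (Icc a β)
  integrable_Δ : ∀ β ∈ I, IntegrableOn Δ (Icc a β)
  symm_B : ∀ᵐ t ∂volume.restrict I, (B t : HBig H K →ₗ[ℂ] HBig H K).IsSymmetric
  pos_Δ : ∀ᵐ t ∂volume.restrict I, (Δ t : HBig H K →ₗ[ℂ] HBig H K).IsPositive

namespace SymmetricSystem

variable {H K : Type*}
  [NormedAddCommGroup H] [InnerProductSpace ℂ H] [NormedAddCommGroup K] [InnerProductSpace ℂ K]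
  (S : SymmetricSystem H K)

/-- `y` is absolutely continuous on each segment `[a, β] ⊆ I` and satisfies
`J y' - B(t) y = Δ(t) g(t)` a.e. on `I`. -/
def Solves (y g : ℝ → HBig H K) : Prop :=
  (∀ β ∈ S.I, AbsolutelyContinuousOnInterval y S.a β) ∧
    ∀ᵐ t ∂volume.restrict S.I,
      ∃ y' : HBig H K, HasDerivAt y y' t ∧ J y' - S.B t (y t) = S.Δ t (g t)

/-- The system is definite: for every `λ`, a solution of `J y' - B y = λ Δ y` such that
`Δ y = 0` a.e. on `I` vanishes on `I`. -/
def Definite : Prop :=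
  ∀ (l : ℂ) (y : ℝ → HBig H K), S.Solves y (l • y) →
    (∀ᵐ t ∂volume.restrict S.I, S.Δ t (y t) = 0) → ∀ t ∈ S.I, y t = 0

/-- The integrand `(Δ(t) f(t), f(t))`. -/
def density (f : ℝ → HBig H K) (t : ℝ) : ℝ := (⟪f t, S.Δ t (f t)⟫_ℂ).re

/-- `‖f‖_Δ² = ∫_I (Δ(t) f(t), f(t)) dt`, with values in `[0, ∞]`. -/
def normSq (f : ℝ → HBig H K) : ℝ≥0∞ :=
  ∫⁻ t in S.I, ENNReal.ofReal (S.density f t)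

lemma a_mem : S.a ∈ S.I := by
  rcases S.interval with ⟨b, hb, h | h⟩ | h <;> rw [h]
  exacts [⟨le_rfl, hb.le⟩, ⟨le_rfl, hb⟩, mem_Ici.2 le_rfl]

lemma measurableSet_I : MeasurableSet S.I := by
  rcases S.interval with ⟨b, hb, h | h⟩ | h <;> rw [h]
  exacts [measurableSet_Icc, measurableSet_Ico, measurableSet_Ici]

lemma a_le {t : ℝ} (ht : t ∈ S.I) : S.a ≤ t := by
  rcases S.interval with ⟨b, hb, h | h⟩ | h <;> rw [h] at ht
  exacts [ht.1, ht.1, ht]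

lemma aestronglyMeasurable_Δ : AEStronglyMeasurable S.Δ (volume.restrict S.I) := by
  refine LocallyIntegrableOn.aestronglyMeasurable fun x hx => ?_
  by_cases hmax : ∃ β ∈ S.I, x < β
  · obtain ⟨β, hβ, hxβ⟩ := hmax
    refine ⟨Icc S.a β, ?_, S.integrable_Δ β hβ⟩
    filter_upwards [self_mem_nhdsWithin, mem_nhdsWithin_of_mem_nhds (Iio_mem_nhds hxβ)]
      with t ht ht'
    exact ⟨S.a_le ht, le_of_lt ht'⟩
  · push Not at hmax
    refine ⟨Icc S.a x, ?_, S.integrable_Δ x hx⟩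
    filter_upwards [self_mem_nhdsWithin] with t ht
    exact ⟨S.a_le ht, hmax t ht⟩

lemma aemeasurable_density {f : ℝ → HBig H K} (hf : StronglyMeasurable f) :
    AEMeasurable (S.density f) (volume.restrict S.I) := by
  have h1 : AEStronglyMeasurable (fun t => S.Δ t (f t)) (volume.restrict S.I) :=
    isBoundedBilinearMap_apply.continuous.comp_aestronglyMeasurable
      (S.aestronglyMeasurable_Δ.prodMk hf.aestronglyMeasurable)
  exact (Complex.continuous_re.comp_aestronglyMeasurable
    (hf.aestronglyMeasurable.inner h1)).aemeasurable

lemma normSq_zero : S.normSq 0 = 0 := by simp [normSq, density]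

lemma normSq_smul (c : ℂ) (f : ℝ → HBig H K) :
    S.normSq (c • f) = ENNReal.ofReal (‖c‖ ^ 2) * S.normSq f := by
  have h : ∀ t, ENNReal.ofReal (S.density (c • f) t)
      = ENNReal.ofReal (‖c‖ ^ 2) * ENNReal.ofReal (S.density f t) := fun t => by
    rw [← ENNReal.ofReal_mul (by positivity)]
    congr 1
    simp only [density, Pi.smul_apply, map_smul, inner_smul_left, inner_smul_right, ← mul_assoc]
    rw [Complex.mul_conj', ← Complex.ofReal_pow, Complex.re_ofReal_mul]
  simp only [normSq, h]
  exact lintegral_const_mul' _ _ ENNReal.ofReal_ne_top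

lemma normSq_add_le {f g : ℝ → HBig H K} (hf : StronglyMeasurable f) :
    S.normSq (f + g) ≤ 2 * S.normSq f + 2 * S.normSq g := by
  have key : ∀ᵐ t ∂volume.restrict S.I, ENNReal.ofReal (S.density (f + g) t)
      ≤ 2 * ENNReal.ofReal (S.density f t) + 2 * ENNReal.ofReal (S.density g t) := by
    filter_upwards [S.pos_Δ] with t ht
    have h0 := ht.re_inner_nonneg_right (f t - g t)
    have hf0 := ht.re_inner_nonneg_right (f t)
    have hg0 := ht.re_inner_nonneg_right (g t)
    have hle : S.density (f + g) t ≤ 2 * S.density f t + 2 * S.density g t := by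
      simp only [density, Pi.add_apply, map_add, map_sub, inner_add_left, inner_add_right,
        inner_sub_left, inner_sub_right, Complex.add_re, RCLike.re_to_complex,
        ContinuousLinearMap.coe_coe] at h0 ⊢
      linarith
    refine (ENNReal.ofReal_le_ofReal hle).trans ?_
    have hf1 : 0 ≤ S.density f t := hf0
    have hg1 : 0 ≤ S.density g t := hg0
    rw [ENNReal.ofReal_add (mul_nonneg zero_le_two hf1) (mul_nonneg zero_le_two hg1),
      ENNReal.ofReal_mul zero_le_two, ENNReal.ofReal_mul zero_le_two]
    simp
  refine (lintegral_mono_ae key).trans ?_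
  rw [lintegral_add_left' ((S.aemeasurable_density hf).ennreal_ofReal.const_mul _),
    lintegral_const_mul' _ _ (by simp), lintegral_const_mul' _ _ (by simp)]
  rfl

/-- The space `𝓛²_Δ(I)` of Borel functions `f : I → 𝐇` with `∫_I (Δ f, f) dt < ∞`.
A function on `I` is identified with its extension by zero to `ℝ`. -/
def lTwo : Submodule ℂ (ℝ → HBig H K) where
  carrier := {f | StronglyMeasurable f ∧ (∀ t, t ∉ S.I → f t = 0) ∧ S.normSq f < ⊤}
  zero_mem' := ⟨stronglyMeasurable_zero, fun _ _ => rfl, by rw [normSq_zero]; simp⟩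
  add_mem' {f g} hf hg := by
    refine ⟨hf.1.add hg.1, fun t ht => by simp [hf.2.1 t ht, hg.2.1 t ht],
      (S.normSq_add_le hf.1).trans_lt ?_⟩
    exact ENNReal.add_lt_top.2
      ⟨ENNReal.mul_lt_top (by simp) hf.2.2, ENNReal.mul_lt_top (by simp) hg.2.2⟩
  smul_mem' c f hf := by
    refine ⟨hf.1.const_smul c, fun t ht => by simp [hf.2.1 t ht], ?_⟩
    rw [normSq_smul]
    exact ENNReal.mul_lt_top (by simp) hf.2.2

/-- The functions `f ∈ 𝓛²_Δ(I)` with `‖f‖_Δ = 0`. -/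
def nullSpace : Submodule ℂ S.lTwo where
  carrier := {f | S.normSq f = 0}
  zero_mem' := S.normSq_zero
  add_mem' {f g} hf hg := by
    have h := S.normSq_add_le (g := (g : ℝ → HBig H K)) f.2.1
    rw [show S.normSq f = 0 from hf, show S.normSq g = 0 from hg] at h
    simpa using h
  smul_mem' c f hf := by
    have h := S.normSq_smul c f
    rw [show S.normSq f = 0 from hf] at h
    simpa using h

/-- The space `L²_Δ(I)` of equivalence classes. -/
abbrev LTwo := S.lTwo ⧸ S.nullSpace

/-- The quotient map `π : 𝓛²_Δ(I) → L²_Δ(I)`. -/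
def π : S.lTwo →ₗ[ℂ] S.LTwo := S.nullSpace.mkQ

variable {S} in
lemma Solves.add {y z f g : ℝ → HBig H K} (hy : S.Solves y f) (hz : S.Solves z g) :
    S.Solves (y + z) (f + g) := by
  refine ⟨fun β hβ => (hy.1 β hβ).add (hz.1 β hβ), ?_⟩
  filter_upwards [hy.2, hz.2] with t ⟨y', hy', ey⟩ ⟨z', hz', ez⟩
  refine ⟨y' + z', hy'.add hz', ?_⟩
  simp only [Pi.add_apply, map_add, ← ey, ← ez]
  abel

variable {S} in
lemma Solves.smul (c : ℂ) {y f : ℝ → HBig H K} (hy : S.Solves y f) :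
    S.Solves (c • y) (c • f) := by
  refine ⟨fun β hβ => (hy.1 β hβ).const_smul c, ?_⟩
  filter_upwards [hy.2] with t ⟨y', hy', ey⟩
  refine ⟨c • y', hy'.const_smul c, ?_⟩
  simp only [Pi.smul_apply, map_smul, ← ey, smul_sub]

lemma solves_zero : S.Solves 0 0 :=
  ⟨fun β _ => LipschitzOnWith.absolutelyContinuousOnInterval (K := 0)
      (LipschitzOnWith.of_dist_le_mul fun x _ y _ => by simp),
   Eventually.of_forall fun t => ⟨0, hasDerivAt_const t 0, by simp⟩⟩

/-- The maximal relation `𝒯_max` in `𝓛²_Δ(I)`. -/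
def tMax : Submodule ℂ (S.lTwo × S.lTwo) where
  carrier := {p | S.Solves p.1 p.2}
  zero_mem' := S.solves_zero
  add_mem' hp hq := Solves.add hp hq
  smul_mem' c _ hp := Solves.smul c hp

/-- `dom 𝒯_max`. -/
def domMax : Submodule ℂ S.lTwo := S.tMax.map (LinearMap.fst ℂ _ _)

/-- The maximal relation `T_max` in `L²_Δ(I)`. -/
def TMax : Submodule ℂ (S.LTwo × S.LTwo) := S.tMax.map (S.π.prodMap S.π)

lemma mem_domMax (y f : S.lTwo) (h : S.Solves y f) : y ∈ S.domMax :=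
  ⟨(y, f), h, rfl⟩

lemma exists_rep (p : S.TMax) :
    ∃ y : S.domMax, ∃ f : S.lTwo, ((y : S.lTwo), f) ∈ S.tMax ∧
      (S.π y, S.π f) = (p : S.LTwo × S.LTwo) := by
  obtain ⟨⟨y, f⟩, h, e⟩ := p.2
  exact ⟨⟨y, ⟨y, f⟩, h, rfl⟩, f, h, e⟩

/-- The function `y ∈ dom 𝒯_max` associated with `{ỹ, f̃} ∈ T_max`: `y ∈ ỹ` and
`{y, f} ∈ 𝒯_max` for `f ∈ f̃`. It is unique if the system is definite (`rep_unique`). -/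
def rep (p : S.TMax) : S.domMax := (S.exists_rep p).choose

lemma Δ_eq_zero_of_mem_nullSpace {f : S.lTwo} (hf : f ∈ S.nullSpace) :
    ∀ᵐ t ∂volume.restrict S.I, S.Δ t ((f : ℝ → HBig H K) t) = 0 := by
  have h0 : S.normSq f = 0 := hf
  rw [normSq, lintegral_eq_zero_iff' (S.aemeasurable_density f.2.1).ennreal_ofReal] at h0
  filter_upwards [h0, S.pos_Δ] with t h1 hp
  have h2 : S.density f t ≤ 0 := by simpa using h1
  have h3 : S.density f t = 0 := le_antisymm h2 (hp.re_inner_nonneg_right _)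
  set x := (f : ℝ → HBig H K) t with hx
  set w := S.Δ t x with hw
  have hsym : ∀ u v, ⟪S.Δ t u, v⟫_ℂ = ⟪u, S.Δ t v⟫_ℂ := hp.isSymmetric
  have hpos : ∀ r : ℝ, 0 ≤ 2 * r * ‖w‖ ^ 2 + r ^ 2 * (⟪w, S.Δ t w⟫_ℂ).re := fun r => by
    have h4 := hp.re_inner_nonneg_right (x + (r : ℂ) • w)
    have h5 : (⟪x, S.Δ t x⟫_ℂ).re = 0 := h3
    have h6 : ⟪x, S.Δ t w⟫_ℂ = ⟪w, w⟫_ℂ := (hsym x w).symm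
    simp only [ContinuousLinearMap.coe_coe, map_add, map_smul, inner_add_left, inner_add_right,
      inner_smul_left, inner_smul_right, h6, RCLike.re_to_complex, Complex.add_re,
      Complex.re_ofReal_mul, Complex.conj_ofReal, h5] at h4
    rw [← hw, inner_self_eq_norm_sq_to_K] at h4
    have h7 : (((‖w‖ : ℝ) : ℂ) ^ 2).re = ‖w‖ ^ 2 := by
      rw [← Complex.ofReal_pow, Complex.ofReal_re]
    simp only [Complex.coe_algebraMap, h7] at h4
    nlinarith
  by_contra hne
  have hw0 : 0 < ‖w‖ ^ 2 := by positivity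
  set q := (⟪w, S.Δ t w⟫_ℂ).re with hq
  have hq0 : 0 ≤ q := hp.re_inner_nonneg_right w
  have h8 := hpos (-(‖w‖ ^ 2 / (q + 1)))
  have h9 : 2 * (-(‖w‖ ^ 2 / (q + 1))) * ‖w‖ ^ 2 + (-(‖w‖ ^ 2 / (q + 1))) ^ 2 * q
      = -(‖w‖ ^ 2) ^ 2 * (q + 2) / (q + 1) ^ 2 := by
    field_simp
    ring
  rw [h9] at h8
  have : 0 < (‖w‖ ^ 2) ^ 2 * (q + 2) / (q + 1) ^ 2 := by positivity
  have h10 : -(‖w‖ ^ 2) ^ 2 * (q + 2) / (q + 1) ^ 2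
      = -((‖w‖ ^ 2) ^ 2 * (q + 2) / (q + 1) ^ 2) := by ring
  linarith

/-- The representative `rep p` is well defined for a definite system. -/
lemma rep_unique (hS : S.Definite) (p : S.TMax) (y : S.domMax) (f : S.lTwo)
    (h : ((y : S.lTwo), f) ∈ S.tMax) (e : (S.π y, S.π f) = (p : S.LTwo × S.LTwo)) :
    y = S.rep p := by
  obtain ⟨f', h', e'⟩ := (S.exists_rep p).choose_spec
  have e2 := e.trans e'.symm
  have ey : (y : S.lTwo) - (S.rep p : S.lTwo) ∈ S.nullSpace :=
    (Submodule.Quotient.eq _).1 (Prod.ext_iff.1 e2).1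
  have ef : f - f' ∈ S.nullSpace := (Submodule.Quotient.eq _).1 (Prod.ext_iff.1 e2).2
  have hd := S.tMax.sub_mem h h'
  have hs : S.Solves (((y : S.lTwo) - (S.rep p : S.lTwo) : S.lTwo) : ℝ → HBig H K)
      ((f - f' : S.lTwo) : ℝ → HBig H K) := hd
  have h0 := hS 0 _ ⟨hs.1, by
    filter_upwards [hs.2, S.Δ_eq_zero_of_mem_nullSpace ef] with t ⟨y', hy', e3⟩ e4
    refine ⟨y', hy', ?_⟩
    rw [e3, e4]
    simp⟩ (S.Δ_eq_zero_of_mem_nullSpace ey)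
  apply Subtype.ext
  apply Subtype.ext
  funext t
  by_cases ht : t ∈ S.I
  · have := h0 t ht
    exact sub_eq_zero.1 this
  · rw [(y : S.lTwo).2.2.1 t ht, (S.rep p : S.lTwo).2.2.1 t ht]

/-- The defect subspace `𝔑̂_λ = {{ỹ, λ ỹ} ∈ T_max}`, as a set of elements of `T_max`. -/
def defect (l : ℂ) : Set S.TMax := {p | (p : S.LTwo × S.LTwo).2 = l • (p : S.LTwo × S.LTwo).1}

/-- An operator solution `Y(·, λ) ∈ 𝓛²_Δ[X, 𝐇]` of `J y' - B y = λ Δ y`: for every `h ∈ X`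
the function `Y(t, λ) h` is a solution belonging to `𝓛²_Δ(I)`. -/
structure OperatorSolution (l : ℂ) (X : Type*) [NormedAddCommGroup X] [InnerProductSpace ℂ X]
    where
  toFun : ℝ → X →L[ℂ] HBig H K
  mem_lTwo : ∀ h, (fun t => toFun t h) ∈ S.lTwo
  solves : ∀ h, S.Solves (fun t => toFun t h) (l • fun t => toFun t h)

/-- The map `Y(λ)`: to `h ∈ X` it assigns the function `t ↦ Y(t, λ) h` in `dom 𝒯_max`. -/
def OperatorSolution.app {S : SymmetricSystem H K} {l : ℂ} {X : Type*} [NormedAddCommGroup X]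
    [InnerProductSpace ℂ X] (V : S.OperatorSolution l X) (h : X) : S.domMax :=
  ⟨⟨fun t => V.toFun t h, V.mem_lTwo h⟩,
    S.mem_domMax _ (l • (⟨fun t => V.toFun t h, V.mem_lTwo h⟩ : S.lTwo)) (V.solves h)⟩

end SymmetricSystem

section Boundary

variable {H K : Type*}
  [NormedAddCommGroup H] [InnerProductSpace ℂ H] [FiniteDimensional ℂ H] [CompleteSpace H]
  [NormedAddCommGroup K] [InnerProductSpace ℂ K] [FiniteDimensional ℂ K] [CompleteSpace K]

/-- The operator `U : H ⊕ Ĥ ⊕ H → Ĥ ⊕ H` with rows `(u₁, u₂, u₃)` and `(u₄, u₅, u₆)`, which is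
surjective and satisfies the three identities
`i u₂ u₂* - u₁ u₃* + u₃ u₁* = i`, `i u₅ u₂* - u₄ u₃* + u₆ u₁* = 0`,
`i u₅ u₅* + u₆ u₄* - u₄ u₆* = 0`. -/
structure LeftOperator (H K : Type*)
    [NormedAddCommGroup H] [InnerProductSpace ℂ H] [CompleteSpace H]
    [NormedAddCommGroup K] [InnerProductSpace ℂ K] [CompleteSpace K] where
  u₁ : H →L[ℂ] K
  u₂ : K →L[ℂ] K
  u₃ : H →L[ℂ] K
  u₄ : H →L[ℂ] H
  u₅ : K →L[ℂ] H
  u₆ : H →L[ℂ] H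
  surj : ∀ (k : K) (h : H), ∃ x : HBig H K,
    u₁ (c₀ x) + u₂ (ch x) + u₃ (c₁ x) = k ∧ u₄ (c₀ x) + u₅ (ch x) + u₆ (c₁ x) = h
  id₁ : Complex.I • (u₂ ∘L u₂.adjoint) - u₁ ∘L u₃.adjoint + u₃ ∘L u₁.adjoint
    = Complex.I • ContinuousLinearMap.id ℂ K
  id₂ : Complex.I • (u₅ ∘L u₂.adjoint) - u₄ ∘L u₃.adjoint + u₆ ∘L u₁.adjoint = 0
  id₃ : Complex.I • (u₅ ∘L u₅.adjoint) + u₆ ∘L u₄.adjoint - u₄ ∘L u₆.adjoint = 0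

/-- The operator on `𝐇 = H ⊕ Ĥ ⊕ H` obtained from `U` by adding a first row `(u₇, u₈, u₉)`. -/
def LeftOperator.extend (U : LeftOperator H K) (u₇ : H →L[ℂ] H) (u₈ : K →L[ℂ] H)
    (u₉ : H →L[ℂ] H) (x : HBig H K) : HBig H K :=
  mk₃ (u₇ (c₀ x) + u₈ (ch x) + u₉ (c₁ x))
    (U.u₁ (c₀ x) + U.u₂ (ch x) + U.u₃ (c₁ x))
    (U.u₄ (c₀ x) + U.u₅ (ch x) + U.u₆ (c₁ x))

/-- A `J`-unitary extension `Ũ` of `U`, i.e. an operator with rows `(u₇, u₈, u₉)`,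
`(u₁, u₂, u₃)`, `(u₄, u₅, u₆)` such that `Ũ* J Ũ = J`. -/
structure JUnitaryExtension (U : LeftOperator H K) where
  u₇ : H →L[ℂ] H
  u₈ : K →L[ℂ] H
  u₉ : H →L[ℂ] H
  jUnitary : ∀ x y, ⟪U.extend u₇ u₈ u₉ y, J (U.extend u₇ u₈ u₉ x)⟫_ℂ = ⟪y, J x⟫_ℂ

variable {S : SymmetricSystem H K} {U : LeftOperator H K}
  {F F₂ : Type*}
  [NormedAddCommGroup F] [InnerProductSpace ℂ F] [FiniteDimensional ℂ F] [CompleteSpace F]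
  [NormedAddCommGroup F₂] [InnerProductSpace ℂ F₂] [FiniteDimensional ℂ F₂] [CompleteSpace F₂]

/-! The finite-dimensional Hilbert space `ℋ̃_b` and its subspace `ℋ_b` are given through the
decomposition `ℋ̃_b = ℋ_b ⊕ ℋ_b^⊥`: `F` stands for `ℋ_b`, `F₂` for `ℋ_b^⊥`, and `ℋ̃_b` is
`OSum F F₂`. So `inl` is the inclusion of `ℋ_b` in `ℋ̃_b`, and `fst`, `snd` are the orthogonal
projectors of `ℋ̃_b` onto `ℋ_b` and `ℋ_b^⊥`. -/

/-- A surjective linear mapping `Γ_b = (Γ_{0b}, Γ̂_b, Γ_{1b})ᵀ : dom 𝒯_max → ℋ̃_b ⊕ Ĥ ⊕ ℋ_b`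
such that `[y, z]_b = lim_{t ↑ b} (J y(t), z(t))` equals
`(Γ_{0b} y, Γ_{1b} z) - (Γ_{1b} y, Γ_{0b} z) + i (P_{ℋ_b^⊥} Γ_{0b} y, P_{ℋ_b^⊥} Γ_{0b} z)
+ i (Γ̂_b y, Γ̂_b z)` for all `y, z ∈ dom 𝒯_max`. The limit is taken along the directed set `I`;
if `b ∈ I` it is the value at `b`, which is the left limit by continuity. -/
structure EndpointMap (S : SymmetricSystem H K) (F F₂ : Type*)
    [NormedAddCommGroup F] [InnerProductSpace ℂ F]
    [NormedAddCommGroup F₂] [InnerProductSpace ℂ F₂] where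
  g₀ : S.domMax →ₗ[ℂ] OSum F F₂
  gh : S.domMax →ₗ[ℂ] K
  g₁ : S.domMax →ₗ[ℂ] F
  surj : ∀ (e : OSum F F₂) (k : K) (f : F), ∃ y, g₀ y = e ∧ gh y = k ∧ g₁ y = f
  lagrange : ∀ y z : S.domMax,
    Tendsto (fun t : S.I => ⟪((z : S.lTwo) : ℝ → HBig H K) t,
        J (((y : S.lTwo) : ℝ → HBig H K) t)⟫_ℂ) atTop
      (𝓝 (⟪inl (g₁ z), g₀ y⟫_ℂ - ⟪g₀ z, inl (g₁ y)⟫_ℂ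
        + Complex.I * ⟪snd (g₀ z), snd (g₀ y)⟫_ℂ
        + Complex.I * ⟪gh z, gh y⟫_ℂ))

/-- `Γ_a y = Ũ y(a)`. -/
def JUnitaryExtension.gammaA (W : JUnitaryExtension U) (y : S.domMax) : HBig H K :=
  U.extend W.u₇ W.u₈ W.u₉ (((y : S.lTwo) : ℝ → HBig H K) S.a)

/-- `Γ_{0a} y = u₇ y₀(a) + u₈ ŷ(a) + u₉ y₁(a)`. -/
def JUnitaryExtension.g₀ (W : JUnitaryExtension U) (y : S.domMax) : H := c₀ (W.gammaA y)

/-- `Γ̂_a y = u₁ y₀(a) + u₂ ŷ(a) + u₃ y₁(a)`. -/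
def JUnitaryExtension.gh (W : JUnitaryExtension U) (y : S.domMax) : K := ch (W.gammaA y)

/-- `Γ_{1a} y = u₄ y₀(a) + u₅ ŷ(a) + u₆ y₁(a)`. -/
def JUnitaryExtension.g₁ (W : JUnitaryExtension U) (y : S.domMax) : H := c₁ (W.gammaA y)

/-! ### The decomposing boundary triplet and its Weyl functions

The boundary spaces are `ℋ₀ = H₀ ⊕ ℋ̃_b` and `ℋ₁ = H₀ ⊕ ℋ_b ⊆ ℋ₀`, so `ℋ₂ = ℋ₀ ⊖ ℋ₁ = ℋ_b^⊥`. -/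

/-- The map `Γ₀ : T_max → H₀ ⊕ ℋ̃_b`,
`Γ₀ {ỹ, f̃} = {-Γ_{1a} y + i (Γ̂_a - Γ̂_b) y, Γ_{0b} y}`. -/
def Gamma₀ (W : JUnitaryExtension U) (G : EndpointMap S F F₂) (p : S.TMax) :
    OSum (HZero H K) (OSum F F₂) :=
  pair (pair (-W.g₁ (S.rep p)) (Complex.I • (W.gh (S.rep p) - G.gh (S.rep p)))) (G.g₀ (S.rep p))

/-- The map `Γ₁ : T_max → H₀ ⊕ ℋ_b`,
`Γ₁ {ỹ, f̃} = {Γ_{0a} y + ½ (Γ̂_a + Γ̂_b) y, -Γ_{1b} y}`. -/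
def Gamma₁ (W : JUnitaryExtension U) (G : EndpointMap S F F₂) (p : S.TMax) :
    OSum (HZero H K) F :=
  pair (pair (W.g₀ (S.rep p)) ((1 / 2 : ℂ) • (W.gh (S.rep p) + G.gh (S.rep p))))
    (-G.g₁ (S.rep p))

/-- The orthogonal projector `P₁` of `ℋ₀ = H₀ ⊕ ℋ̃_b` onto `ℋ₁ = H₀ ⊕ ℋ_b`. -/
def proj₁ (x : OSum (HZero H K) (OSum F F₂)) : OSum (HZero H K) F :=
  pair (fst x) (fst (snd x))

/-- The orthogonal projector `P₂` of `ℋ₀ = H₀ ⊕ ℋ̃_b` onto `ℋ₂ = ℋ_b^⊥`, with values in `ℋ₀`. -/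
def proj₂ (x : OSum (HZero H K) (OSum F F₂)) : OSum (HZero H K) (OSum F F₂) :=
  pair 0 (pair 0 (snd (snd x)))

/-- The inclusion of `ℋ₁ = H₀ ⊕ ℋ_b` in `ℋ₀ = H₀ ⊕ ℋ̃_b`. -/
def incl₁ (x : OSum (HZero H K) F) : OSum (HZero H K) (OSum F F₂) :=
  pair (fst x) (inl (snd x))

/-- `M = M₊(λ)` is the value at `λ ∈ ℂ₊` of the Weyl function of the decomposing boundary triplet:
`Γ₀` maps `𝔑̂_λ` bijectively onto `ℋ₀`, and `M h₀ = Γ₁ (Γ₀ ↾ 𝔑̂_λ)⁻¹ h₀`. -/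
def IsWeylPlus (W : JUnitaryExtension U) (G : EndpointMap S F F₂) (l : ℂ)
    (M : OSum (HZero H K) (OSum F F₂) →L[ℂ] OSum (HZero H K) F) : Prop :=
  BijOn (Gamma₀ W G) (S.defect l) univ ∧ ∀ p ∈ S.defect l, M (Gamma₀ W G p) = Gamma₁ W G p

/-- `M = M₋(λ)` is the value at `λ ∈ ℂ₋` of the Weyl function of the decomposing boundary triplet:
`P₁ Γ₀` maps `𝔑̂_λ` bijectively onto `ℋ₁`, and `M h₁ = (Γ₁ + i P₂ Γ₀) (P₁ Γ₀ ↾ 𝔑̂_λ)⁻¹ h₁`. -/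
def IsWeylMinus (W : JUnitaryExtension U) (G : EndpointMap S F F₂) (l : ℂ)
    (M : OSum (HZero H K) F →L[ℂ] OSum (HZero H K) (OSum F F₂)) : Prop :=
  BijOn (fun p => proj₁ (Gamma₀ W G p)) (S.defect l) univ ∧
    ∀ p ∈ S.defect l, M (proj₁ (Gamma₀ W G p))
      = incl₁ (Gamma₁ W G p) + Complex.I • proj₂ (Gamma₀ W G p)

open Classical in
/-- The Weyl function `M₊(λ)`, `λ ∈ ℂ₊`. -/
def weylPlus (W : JUnitaryExtension U) (G : EndpointMap S F F₂) (l : ℂ) :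
    OSum (HZero H K) (OSum F F₂) →L[ℂ] OSum (HZero H K) F :=
  if h : ∃ M, IsWeylPlus W G l M then h.choose else 0

open Classical in
/-- The Weyl function `M₋(λ)`, `λ ∈ ℂ₋`. -/
def weylMinus (W : JUnitaryExtension U) (G : EndpointMap S F F₂) (l : ℂ) :
    OSum (HZero H K) F →L[ℂ] OSum (HZero H K) (OSum F F₂) :=
  if h : ∃ M, IsWeylMinus W G l M then h.choose else 0

/-- The function `m₀` on `ℂ ∖ ℝ`: the upper left block of `M₊(λ)` for `λ ∈ ℂ₊`, and of `M₋(λ)`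
for `λ ∈ ℂ₋`. -/
def mZero (W : JUnitaryExtension U) (G : EndpointMap S F F₂) (l : ℂ) : HZero H K →L[ℂ] HZero H K :=
  if 0 < l.im then block₁₁ (weylPlus W G l) else block₁₁ (weylMinus W G l)

/-! ### Boundary parameters and `m`-functions -/

/-- The imaginary part `(X - X*) / (2 i)` of an operator. -/
def opIm {V : Type*} [NormedAddCommGroup V] [InnerProductSpace ℂ V] [CompleteSpace V]
    (X : V →L[ℂ] V) : V →L[ℂ] V :=
  (2 * Complex.I)⁻¹ • (X - X.adjoint)

/-- A boundary parameter `τ = {τ₊, τ₋} ∈ R̃(ℋ̃_b, ℋ_b)`: a collection of two holomorphic pairs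
`(C₀(λ), C₁(λ)) : ℋ̃_b ⊕ ℋ_b → ℋ̃_b`, `λ ∈ ℂ₊`, and `(D₀(λ), D₁(λ)) : ℋ̃_b ⊕ ℋ_b → ℋ_b`, `λ ∈ ℂ₋`,
where `C₀ = (C₀₁, C₀₂)` and `D₀ = (D₀₁, D₀₂)` with respect to `ℋ̃_b = ℋ_b ⊕ ℋ_b^⊥`, such that
`2 Im (C₁(λ) C₀₁(λ)*) + C₀₂(λ) C₀₂(λ)* ≥ 0` for `λ ∈ ℂ₊`,
`2 Im (D₁(λ) D₀₁(λ)*) + D₀₂(λ) D₀₂(λ)* ≤ 0` for `λ ∈ ℂ₋`,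
`C₁(λ) D₀₁(λ̄)* - C₀₁(λ) D₁(λ̄)* + i C₀₂(λ) D₀₂(λ̄)* = 0` for `λ ∈ ℂ₊`,
`0 ∈ ρ(C₀(λ) - i C₁(λ) P₁)` for `λ ∈ ℂ₊` and `0 ∈ ρ(D₀₁(λ) + i D₁(λ))` for `λ ∈ ℂ₋`,
`P₁` being the orthogonal projector of `ℋ̃_b` onto `ℋ_b`.
The values of the functions outside these half-planes are irrelevant. -/
structure BoundaryParameter (F F₂ : Type*)
    [NormedAddCommGroup F] [InnerProductSpace ℂ F] [CompleteSpace F]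
    [NormedAddCommGroup F₂] [InnerProductSpace ℂ F₂] [CompleteSpace F₂] where
  C₀ : ℂ → OSum F F₂ →L[ℂ] OSum F F₂
  C₁ : ℂ → F →L[ℂ] OSum F F₂
  D₀ : ℂ → OSum F F₂ →L[ℂ] F
  D₁ : ℂ → F →L[ℂ] F
  holo_C₀ : DifferentiableOn ℂ C₀ {l | 0 < l.im}
  holo_C₁ : DifferentiableOn ℂ C₁ {l | 0 < l.im}
  holo_D₀ : DifferentiableOn ℂ D₀ {l | l.im < 0}
  holo_D₁ : DifferentiableOn ℂ D₁ {l | l.im < 0}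
  pos_C : ∀ l : ℂ, 0 < l.im →
    ((2 : ℂ) • opIm (C₁ l ∘L (C₀ l ∘L inl).adjoint)
      + (C₀ l ∘L inr) ∘L (C₀ l ∘L inr).adjoint).IsPositive
  neg_D : ∀ l : ℂ, l.im < 0 →
    (-((2 : ℂ) • opIm (D₁ l ∘L (D₀ l ∘L inl).adjoint)
      + (D₀ l ∘L inr) ∘L (D₀ l ∘L inr).adjoint)).IsPositive
  compat : ∀ l : ℂ, 0 < l.im →
    C₁ l ∘L (D₀ (starRingEnd ℂ l) ∘L inl).adjoint
      - (C₀ l ∘L inl) ∘L (D₁ (starRingEnd ℂ l)).adjoint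
      + Complex.I • ((C₀ l ∘L inr) ∘L (D₀ (starRingEnd ℂ l) ∘L inr).adjoint) = 0
  unit_C : ∀ l : ℂ, 0 < l.im → IsUnit (C₀ l - Complex.I • (C₁ l ∘L (fst : OSum F F₂ →L[ℂ] F)))
  unit_D : ∀ l : ℂ, l.im < 0 → IsUnit (D₀ l ∘L (inl : F →L[ℂ] OSum F F₂) + Complex.I • D₁ l)

variable (F F₂) in
/-- The boundary parameter `τ₀` given by `C₀ ≡ I`, `C₁ ≡ 0`, `D₀ ≡ P₁`, `D₁ ≡ 0`, where `P₁` is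
the orthogonal projector of `ℋ̃_b` onto `ℋ_b`. -/
def tauZero : BoundaryParameter F F₂ where
  C₀ _ := ContinuousLinearMap.id ℂ (OSum F F₂)
  C₁ _ := 0
  D₀ _ := fst
  D₁ _ := 0
  holo_C₀ := differentiableOn_const _
  holo_C₁ := differentiableOn_const _
  holo_D₀ := differentiableOn_const _
  holo_D₁ := differentiableOn_const _
  pos_C l _ := by
    have h := ContinuousLinearMap.isPositive_self_comp_adjoint (inr : F₂ →L[ℂ] OSum F F₂)
    simpa [opIm] using h
  neg_D l _ := by
    have h : (fst : OSum F F₂ →L[ℂ] F) ∘L (inr : F₂ →L[ℂ] OSum F F₂) = 0 := rfl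
    simp [opIm, h]
  compat l _ := by
    have h : (fst : OSum F F₂ →L[ℂ] F) ∘L (inr : F₂ →L[ℂ] OSum F F₂) = 0 := rfl
    simp [h]
  unit_C l _ := by
    rw [ContinuousLinearMap.zero_comp, smul_zero, sub_zero]
    exact isUnit_one
  unit_D l _ := by
    rw [smul_zero, add_zero]
    exact isUnit_one

/-- `V = v_τ(·, λ)`: the operator solution in `𝓛²_Δ[H₀, 𝐇]` with
`Γ_{1a} v_τ(λ) = -P_H`, `i (Γ̂_a - Γ̂_b) v_τ(λ) = P_Ĥ`,
`C₀(λ) Γ_{0b} v_τ(λ) + C₁(λ) Γ_{1b} v_τ(λ) = 0` if `λ ∈ ℂ₊`, and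
`D₀(λ) Γ_{0b} v_τ(λ) + D₁(λ) Γ_{1b} v_τ(λ) = 0` if `λ ∈ ℂ₋`. -/
def IsVTau (W : JUnitaryExtension U) (G : EndpointMap S F F₂) (τ : BoundaryParameter F F₂) (l : ℂ)
    (V : S.OperatorSolution l (HZero H K)) : Prop :=
  ∀ h : HZero H K,
    W.g₁ (V.app h) = -fst h ∧
    Complex.I • (W.gh (V.app h) - G.gh (V.app h)) = snd h ∧
    (0 < l.im → τ.C₀ l (G.g₀ (V.app h)) + τ.C₁ l (G.g₁ (V.app h)) = 0) ∧
    (l.im < 0 → τ.D₀ l (G.g₀ (V.app h)) + τ.D₁ l (G.g₁ (V.app h)) = 0)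

/-- `m = m_τ(λ)` is the value at `λ ∈ ℂ ∖ ℝ` of the `m`-function: there is exactly one solution
`v_τ(·, λ)`, and `m = (Γ_{0a} + Γ̂_a) v_τ(λ) + (i / 2) P_Ĥ`. -/
def IsMFunction (W : JUnitaryExtension U) (G : EndpointMap S F F₂) (τ : BoundaryParameter F F₂) (l : ℂ)
    (m : HZero H K →L[ℂ] HZero H K) : Prop :=
  (∃! V : S.OperatorSolution l (HZero H K), IsVTau W G τ l V) ∧
    ∀ V : S.OperatorSolution l (HZero H K), IsVTau W G τ l V →
      ∀ h, m h = pair (W.g₀ (V.app h)) (W.gh (V.app h) + (Complex.I / 2) • snd h)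

open Classical in
/-- The `m`-function `m_τ` corresponding to the boundary parameter `τ`. -/
def mFunction (W : JUnitaryExtension U) (G : EndpointMap S F F₂) (τ : BoundaryParameter F F₂) (l : ℂ) :
    HZero H K →L[ℂ] HZero H K :=
  if h : ∃ m, IsMFunction W G τ l m then h.choose else 0

end Boundary

end SymmSys

end

/-! Everything takes place on the square-integrable solutions of `Jy' - By = λΔy`. For such a `y`
the Lagrange identity gives `2 Im λ ‖y‖² = 2 Im ⟪P₁Γ₀y, Γ₁y⟫ + ‖P₂Γ₀y‖²` (`energy`). When the
`H₀`-component of `Γ₀y` vanishes, the right side involves only the data of `y` at `b`. The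
inequalities defining a boundary parameter, carried over to the kernels of `(C₀, C₁)` and `(D₀, D₁)`
by a Cayley transform (`norm_sq_le_of_kernel`, `norm_sq_ge_of_kernel`), make it nonpositive on `ℂ₊`
and nonnegative on `ℂ₋`. So `‖y‖ = 0`, and `y = 0` by definiteness. This one argument gives the
injectivity of `Γ₀` and `P₁Γ₀` on the defect subspaces (take `τ₀`), the uniqueness of `v_τ`, and the
invertibility of `C₀ - C₁M₄₊`.

Existence requires enough solutions. A function of `dom 𝒯_max` with prescribed boundary values is
corrected by a solution of the inhomogeneous equation with zero boundary values. The latter is found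
weakly: the Lagrange identity bounds `w = g - λ̄x` below on a restriction of `𝒯_max`, so `w ↦ (q,
x)` is a bounded functional, which Hahn–Banach extends to `𝓛²_Δ`. Such a functional is represented
by a genuine solution (`Definite.exists_rep`); this takes the place of the Riesz theorem and of
regularity, and rests on Green's identity and on definiteness over a compact segment. Joint
surjectivity of the boundary maps (`exists_bdry_eq`) then reads off the boundary values of the weak
solution. Existence of `v_τ` follows by a dimension count.

The rest is algebra. Both `m_τ` and the blocks of `M₊` express `Γ₁y` through `Γ₀y`, and eliminating
`Γ_{0b}y` with the boundary condition yields the formula. -/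

set_option linter.unusedSectionVars false

/-! ### Absolutely continuous functions and the fundamental theorem of calculus. -/

section AbsoluteContinuity

namespace AbsolutelyContinuousOnInterval

/-- Sums of increments inherit the estimate termwise. The permanence properties below reduce to
this; `D = 0` serves when one comparison function is enough. -/
lemma of_dist_le_add {X Y Z : Type*} [PseudoMetricSpace X] [PseudoMetricSpace Y]
    [PseudoMetricSpace Z] {f : ℝ → X} {g : ℝ → Y} {h : ℝ → Z} {a b C D : ℝ}
    (hg : AbsolutelyContinuousOnInterval g a b) (hh : AbsolutelyContinuousOnInterval h a b)
    (H : ∀ x ∈ uIcc a b, ∀ y ∈ uIcc a b,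
      dist (f x) (f y) ≤ C * dist (g x) (g y) + D * dist (h x) (h y)) :
    AbsolutelyContinuousOnInterval f a b := by
  unfold AbsolutelyContinuousOnInterval at hg hh ⊢
  refine squeeze_zero' (Eventually.of_forall fun _ => Finset.sum_nonneg fun _ _ => dist_nonneg) ?_
    (by simpa using (hg.const_mul C).add (hh.const_mul D))
  rw [eventually_inf_principal]
  filter_upwards with E hE
  rw [Finset.mul_sum, Finset.mul_sum, ← Finset.sum_add_distrib]
  exact Finset.sum_le_sum fun i hi => H _ (hE.1 i hi).1 _ (hE.1 i hi).2

lemma congr {X : Type*} [PseudoMetricSpace X] {f g : ℝ → X} {a b : ℝ}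
    (hf : AbsolutelyContinuousOnInterval f a b) (h : EqOn f g (uIcc a b)) :
    AbsolutelyContinuousOnInterval g a b :=
  hf.of_dist_le_add (C := 1) (D := 0) hf fun x hx y hy => by rw [h hx, h hy]; simp

lemma clm_comp {E F : Type*} [NormedAddCommGroup E] [NormedAddCommGroup F] [NormedSpace ℂ E]
    [NormedSpace ℂ F] {f : ℝ → E} {a b : ℝ} (hf : AbsolutelyContinuousOnInterval f a b)
    (T : E →L[ℂ] F) : AbsolutelyContinuousOnInterval (fun t => T (f t)) a b :=
  hf.of_dist_le_add (C := ‖T‖) (D := 0) hf fun x _ y _ => by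
    simpa [dist_eq_norm, ← map_sub] using T.le_opNorm (f x - f y)

lemma inner {E : Type*} [NormedAddCommGroup E] [InnerProductSpace ℂ E] {f g : ℝ → E} {a b : ℝ}
    (hf : AbsolutelyContinuousOnInterval f a b) (hg : AbsolutelyContinuousOnInterval g a b) :
    AbsolutelyContinuousOnInterval (fun t => ⟪f t, g t⟫_ℂ) a b := by
  obtain ⟨C, hC⟩ := hf.exists_bound
  obtain ⟨D, hD⟩ := hg.exists_bound
  refine hf.of_dist_le_add (C := D) (D := C) hg fun x hx y hy => ?_
  have h : ⟪f x, g x⟫_ℂ - ⟪f y, g y⟫_ℂ = ⟪f x - f y, g x⟫_ℂ + ⟪f y, g x - g y⟫_ℂ := by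
    simp only [inner_sub_left, inner_sub_right]
    ring
  rw [dist_eq_norm, h, dist_eq_norm, dist_eq_norm]
  refine (norm_add_le _ _).trans (add_le_add ((norm_inner_le_norm _ _).trans ?_)
    ((norm_inner_le_norm _ _).trans ?_))
  · rw [mul_comm]
    exact mul_le_mul_of_nonneg_right (hD x hx) (norm_nonneg _)
  · exact mul_le_mul_of_nonneg_right (hC y hy) (norm_nonneg _)

lemma pow {f : ℝ → ℝ} {a b : ℝ} (hf : AbsolutelyContinuousOnInterval f a b) (n : ℕ) :
    AbsolutelyContinuousOnInterval (fun t => f t ^ (n + 1)) a b := by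
  induction n with
  | zero => simpa using hf
  | succ n ih =>
    refine (ih.mul hf).congr fun t _ => ?_
    simp [pow_succ]

variable {E : Type*} [NormedAddCommGroup E] [NormedSpace ℝ E]

/-- Increments of a vector-valued primitive are dominated by those of the real primitive of `‖f‖`,
which is absolutely continuous. -/
lemma primitive {f : ℝ → E} {a b : ℝ} (hf : IntervalIntegrable f volume a b) :
    AbsolutelyContinuousOnInterval (fun t => ∫ s in a..t, f s) a b := by
  have h := hf.norm.absolutelyContinuousOnInterval_intervalIntegral left_mem_uIcc
  refine h.of_dist_le_add (C := 1) (D := 0) h fun x hx y hy => ?_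
  have hi : ∀ x ∈ uIcc a b, IntervalIntegrable f volume a x := fun x hx =>
    hf.mono_set (uIcc_subset_uIcc left_mem_uIcc hx)
  rw [dist_eq_norm, Real.dist_eq, intervalIntegral.integral_interval_sub_left (hi x hx) (hi y hy),
    intervalIntegral.integral_interval_sub_left (hi x hx).norm (hi y hy).norm]
  simpa using intervalIntegral.norm_integral_le_abs_integral_norm

/-- Subtracting the primitive of `f'` leaves an absolutely continuous function with derivative zero
a.e., hence a constant. -/
lemma integral_eq_sub [CompleteSpace E] {f f' : ℝ → E} {a b : ℝ}
    (hf : AbsolutelyContinuousOnInterval f a b)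
    (hd : ∀ᵐ t, t ∈ uIcc a b → HasDerivAt f (f' t) t) (hi : IntervalIntegrable f' volume a b) :
    ∫ t in a..b, f' t = f b - f a := by
  obtain ⟨C, hC⟩ := (hf.sub (primitive hi)).const_of_ae_hasDerivAt_zero (by
    filter_upwards [hd, hi.ae_hasDerivAt_integral] with t h1 h2 ht
    simpa using (h1 ht).sub (h2 ht a left_mem_uIcc))
  have h1 := hC a left_mem_uIcc
  have h2 := hC b right_mem_uIcc
  simp only [Pi.sub_apply, intervalIntegral.integral_same, sub_zero] at h1 h2
  rw [h1, ← h2, sub_sub_cancel]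

end AbsolutelyContinuousOnInterval

end AbsoluteContinuity

/-! ### Linear differential equations with integrable coefficients. -/

section LinearODE

variable {E : Type*} [NormedAddCommGroup E] [NormedSpace ℂ E]

lemma MeasureTheory.IntegrableOn.clm_apply_continuousOn {F : Type*} [NormedAddCommGroup F]
    [NormedSpace ℂ F] {A : ℝ → E →L[ℂ] F} {u : ℝ → E} {a β : ℝ}
    (hA : IntegrableOn A (Icc a β)) (hu : ContinuousOn u (Icc a β)) :
    IntegrableOn (fun s => A s (u s)) (Icc a β) := by
  obtain ⟨C, hC⟩ := isCompact_Icc.exists_bound_of_continuousOn hu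
  refine Integrable.mono' (hA.norm.mul_const C) ?_ ?_
  · exact isBoundedBilinearMap_apply.continuous.comp_aestronglyMeasurable
      (hA.aestronglyMeasurable.prodMk (hu.aestronglyMeasurable measurableSet_Icc))
  · filter_upwards [ae_restrict_mem measurableSet_Icc] with s hs
    exact (A s).le_of_opNorm_le_of_le le_rfl (hC s hs)

/-- The integrand is, up to the factor `n + 1`, the a.e. derivative of the `(n + 1)`-st power of the
primitive. This is what produces the factorials in the Picard estimate. -/
lemma intervalIntegral_mul_primitive_pow {k : ℝ → ℝ} {a t : ℝ}
    (hk : IntervalIntegrable k volume a t) (n : ℕ) :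
    ∫ s in a..t, k s * (∫ r in a..s, k r) ^ n = (∫ r in a..t, k r) ^ (n + 1) / (n + 1) := by
  set α : ℝ → ℝ := fun s => ∫ r in a..s, k r with hα
  have hac : AbsolutelyContinuousOnInterval α a t :=
    AbsolutelyContinuousOnInterval.primitive hk
  have hint : IntervalIntegrable (fun s => ((n : ℝ) + 1) * (k s * α s ^ n)) volume a t :=
    (hk.mul_continuousOn (hac.continuousOn.pow n)).const_mul _
  have h := (hac.pow n).integral_eq_sub (f' := fun s => ((n : ℝ) + 1) * (k s * α s ^ n)) (by
    filter_upwards [hk.ae_hasDerivAt_integral] with s hs hst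
    refine ((hs hst a left_mem_uIcc).pow (n + 1)).congr_deriv ?_
    simp only [Nat.cast_add, Nat.cast_one, add_tsub_cancel_right, hα]
    ring) hint
  have h0 : α a = 0 := intervalIntegral.integral_same
  rw [intervalIntegral.integral_const_mul, h0] at h
  have hn : (n : ℝ) + 1 ≠ 0 := by positivity
  rw [eq_div_iff hn, mul_comm, h]
  simp [hα]

/-- The Picard iterates of `y(t) = u(t) + ∫_a^t A y ds`, taken in the form of a Neumann series. -/
noncomputable def picardTerm (A : ℝ → E →L[ℂ] E) (u : ℝ → E) (a : ℝ) : ℕ → ℝ → E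
  | 0 => u
  | n + 1 => fun t => ∫ s in a..t, A s (picardTerm A u a n s)

variable {A : ℝ → E →L[ℂ] E} {u : ℝ → E} {a β : ℝ}

lemma continuousOn_picardTerm (hA : IntegrableOn A (Icc a β)) (hu : ContinuousOn u (Icc a β))
    (n : ℕ) : ContinuousOn (picardTerm A u a n) (Icc a β) := by
  rcases lt_or_ge β a with h | h
  · simp [Icc_eq_empty (not_le.2 h)]
  induction n with
  | zero => exact hu
  | succ n ih =>
    have h1 := hA.clm_apply_continuousOn ih
    rw [← uIcc_of_le h] at h1 ⊢
    exact intervalIntegral.continuousOn_primitive_interval h1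

/-- The factorial makes the Neumann series converge on the whole segment, although `‖A‖` is merely
integrable and its integral need not be small. -/
lemma norm_picardTerm_le (hA : IntegrableOn A (Icc a β)) (hu : ContinuousOn u (Icc a β)) {C : ℝ}
    (hC : ∀ t ∈ Icc a β, ‖u t‖ ≤ C) (n : ℕ) :
    ∀ t ∈ Icc a β, ‖picardTerm A u a n t‖
      ≤ C * ((∫ s in a..t, ‖A s‖) ^ n / n.factorial) := by
  induction n with
  | zero => intro t ht; simpa [picardTerm] using hC t ht
  | succ n ih =>
    intro t ht
    have hk : IntervalIntegrable (fun s => ‖A s‖) volume a t :=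
      (intervalIntegrable_iff_integrableOn_Icc_of_le ht.1).2
        (hA.mono_set (Icc_subset_Icc_right ht.2)).norm
    have hac := AbsolutelyContinuousOnInterval.primitive hk
    have hint : IntervalIntegrable (fun s => C / n.factorial *
        (‖A s‖ * (∫ r in a..s, ‖A r‖) ^ n)) volume a t :=
      (hk.mul_continuousOn (hac.continuousOn.pow n)).const_mul _
    refine (intervalIntegral.norm_integral_le_of_norm_le ht.1 (Eventually.of_forall
      fun s hs => ?_) hint).trans (le_of_eq ?_)
    · refine ((A s).le_of_opNorm_le_of_le le_rfl
        (ih s ⟨hs.1.le, hs.2.trans ht.2⟩)).trans (le_of_eq ?_)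
      ring
    · rw [intervalIntegral.integral_const_mul, intervalIntegral_mul_primitive_pow hk,
        Nat.factorial_succ]
      have hn : (n : ℝ) + 1 ≠ 0 := by positivity
      have hf : (n.factorial : ℝ) ≠ 0 := by positivity
      push_cast
      field_simp

lemma exists_bound_picardTerm (hA : IntegrableOn A (Icc a β)) (hu : ContinuousOn u (Icc a β)) :
    ∃ b : ℕ → ℝ, Summable b ∧ ∀ n, ∀ t ∈ Icc a β, ‖picardTerm A u a n t‖ ≤ b n := by
  obtain ⟨C, hC⟩ := isCompact_Icc.exists_bound_of_continuousOn hu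
  refine ⟨fun n => C * ((∫ s in a..β, ‖A s‖) ^ n / n.factorial),
    (Real.summable_pow_div_factorial _).mul_left _, fun n t ht => ?_⟩
  have hC0 : 0 ≤ C := (norm_nonneg _).trans (hC t ht)
  refine (norm_picardTerm_le hA hu hC n t ht).trans ?_
  have h0 : 0 ≤ ∫ s in a..t, ‖A s‖ :=
    intervalIntegral.integral_nonneg ht.1 fun _ _ => norm_nonneg _
  have h1 : ∫ s in a..t, ‖A s‖ ≤ ∫ s in a..β, ‖A s‖ :=
    intervalIntegral.integral_mono_interval le_rfl ht.1 ht.2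
      (Eventually.of_forall fun _ => norm_nonneg _)
      ((intervalIntegrable_iff_integrableOn_Icc_of_le (ht.1.trans ht.2)).2 hA.norm)
  exact mul_le_mul_of_nonneg_left (div_le_div_of_nonneg_right (pow_le_pow_left₀ h0 h1 n)
    (Nat.cast_nonneg _)) hC0

variable [CompleteSpace E]

lemma continuousOn_tsum_picardTerm (hA : IntegrableOn A (Icc a β))
    (hu : ContinuousOn u (Icc a β)) :
    ContinuousOn (fun t => ∑' n, picardTerm A u a n t) (Icc a β) := by
  obtain ⟨b, hb, h⟩ := exists_bound_picardTerm hA hu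
  exact continuousOn_tsum (continuousOn_picardTerm hA hu) hb h

/-- Dominated convergence moves the sum inside the integral, which shifts the series by one term. -/
lemma tsum_picardTerm_eq (hA : IntegrableOn A (Icc a β)) (hu : ContinuousOn u (Icc a β))
    (h : a ≤ β) : ∑' n, picardTerm A u a n β
      = u β + ∫ s in a..β, A s (∑' n, picardTerm A u a n s) := by
  obtain ⟨b, hb, hle⟩ := exists_bound_picardTerm hA hu
  have hsum : ∀ t ∈ Icc a β, Summable fun n => picardTerm A u a n t := fun t ht =>
    Summable.of_norm_bounded hb fun n => hle n t ht
  have hsub : uIoc a β ⊆ Icc a β := by rw [uIoc_of_le h]; exact Ioc_subset_Icc_self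
  have hi : HasSum (fun n => ∫ s in a..β, A s (picardTerm A u a n s))
      (∫ s in a..β, A s (∑' n, picardTerm A u a n s)) := by
    refine intervalIntegral.hasSum_integral_of_dominated_convergence
      (fun n s => ‖A s‖ * b n) (fun n => ?_) (fun n => Eventually.of_forall fun s hs => ?_)
      (Eventually.of_forall fun s hs => hb.mul_left _) ?_ (Eventually.of_forall fun s hs => ?_)
    · exact ((hA.clm_apply_continuousOn
        (continuousOn_picardTerm hA hu n)).mono_set hsub).aestronglyMeasurable
    · exact (A s).le_of_opNorm_le_of_le le_rfl (hle n s (hsub hs))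
    · simp only [tsum_mul_left]
      exact ((intervalIntegrable_iff_integrableOn_Icc_of_le h).2 hA.norm).mul_const _
    · exact (A s).hasSum (hsum s (hsub hs)).hasSum
  rw [(hsum β ⟨h, le_rfl⟩).tsum_eq_zero_add]
  congr 1
  exact hi.tsum_eq

/-- Solvability of the Cauchy problem `y(t) = c + ∫_a^t (A y + r) ds` on an interval. -/
theorem exists_integral_equation_solution {I : Set ℝ} {a : ℝ} {A : ℝ → E →L[ℂ] E} {r : ℝ → E}
    (hA : ∀ β ∈ I, IntegrableOn A (Icc a β)) (hr : ∀ β ∈ I, IntegrableOn r (Icc a β))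
    (hI : ∀ β ∈ I, a ≤ β) (c : E) :
    ∃ y : ℝ → E, (∀ β ∈ I, ContinuousOn y (Icc a β)) ∧
      ∀ β ∈ I, y β = c + ∫ s in a..β, (A s (y s) + r s) := by
  set u : ℝ → E := fun t => c + ∫ s in a..t, r s with hu
  have huc : ∀ β ∈ I, ContinuousOn u (Icc a β) := fun β hβ => by
    have := hr β hβ
    rw [← uIcc_of_le (hI β hβ)] at this ⊢
    exact continuousOn_const.add (intervalIntegral.continuousOn_primitive_interval this)
  have hc := fun β hβ => continuousOn_tsum_picardTerm (hA β hβ) (huc β hβ)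
  -- The Picard terms do not depend on `β`, so one series solves the equation on all segments at
  -- once.
  refine ⟨_, hc, fun β hβ => ?_⟩
  have hle := hI β hβ
  rw [intervalIntegral.integral_add, tsum_picardTerm_eq (hA β hβ) (huc β hβ) hle]
  · rw [add_comm (∫ s in a..β, A s _), ← add_assoc]
  · exact (intervalIntegrable_iff_integrableOn_Icc_of_le hle).2
      ((hA β hβ).clm_apply_continuousOn (hc β hβ))
  · exact (intervalIntegrable_iff_integrableOn_Icc_of_le hle).2 (hr β hβ)

end LinearODE

noncomputable section

namespace SymmSys

open OSum

/-! ### The signature operator: `J² = -1` and `J* = -J`. -/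

section Signature

variable {H K : Type*}
  [NormedAddCommGroup H] [InnerProductSpace ℂ H] [NormedAddCommGroup K] [InnerProductSpace ℂ K]

@[simp] lemma c₀_J (x : HBig H K) : c₀ (J x) = -c₁ x := rfl

@[simp] lemma ch_J (x : HBig H K) : ch (J x) = Complex.I • ch x := rfl

@[simp] lemma c₁_J (x : HBig H K) : c₁ (J x) = c₀ x := rfl

lemma HBig.ext {x y : HBig H K} (h₀ : c₀ x = c₀ y) (hh : ch x = ch y) (h₁ : c₁ x = c₁ y) :
    x = y := OSum.ext (OSum.ext h₀ hh) h₁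

@[simp] lemma c₀_neg (x : HBig H K) : c₀ (-x) = -c₀ x := by simp [c₀]

@[simp] lemma ch_neg (x : HBig H K) : ch (-x) = -ch x := by simp [ch]

@[simp] lemma c₁_neg (x : HBig H K) : c₁ (-x) = -c₁ x := by simp [c₁]

lemma inner_HBig (x y : HBig H K) :
    ⟪x, y⟫_ℂ = ⟪c₀ x, c₀ y⟫_ℂ + ⟪ch x, ch y⟫_ℂ + ⟪c₁ x, c₁ y⟫_ℂ := by
  rw [inner_def, inner_def]
  rfl

lemma J_J (x : HBig H K) : J (J x) = -x := by
  refine HBig.ext ?_ ?_ ?_ <;> simp [smul_smul]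

lemma inner_J (x y : HBig H K) : ⟪x, J y⟫_ℂ = -⟪J x, y⟫_ℂ := by
  simp only [inner_HBig, c₀_J, ch_J, c₁_J, inner_neg_left, inner_neg_right, inner_smul_left,
    inner_smul_right, Complex.conj_I]
  ring

lemma J_injective : Function.Injective (J : HBig H K → HBig H K) := fun x y h => by
  rw [← neg_neg x, ← neg_neg y, ← J_J x, ← J_J y, h]

end Signature

/-- Cauchy–Schwarz for the form `⟪u, T v⟫`, which is only semidefinite since `T` may have a kernel.
-/
lemma norm_inner_sq_le_of_isPositive {E : Type*} [NormedAddCommGroup E] [InnerProductSpace ℂ E]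
    {T : E →L[ℂ] E} (hT : (T : E →ₗ[ℂ] E).IsPositive) (x y : E) :
    ‖⟪x, T y⟫_ℂ‖ ^ 2 ≤ (⟪x, T x⟫_ℂ).re * (⟪y, T y⟫_ℂ).re := by
  have hsym : ∀ u v, ⟪T u, v⟫_ℂ = ⟪u, T v⟫_ℂ := hT.isSymmetric
  let c : PreInnerProductSpace.Core ℂ E :=
    { inner := fun u v => ⟪u, T v⟫_ℂ
      conj_inner_symm := fun u v => by rw [inner_conj_symm, hsym]
      re_inner_nonneg := fun u => hT.re_inner_nonneg_right u
      add_left := fun u v w => inner_add_left _ _ _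
      smul_left := fun u v r => inner_smul_left _ _ _ }
  have h := @InnerProductSpace.Core.inner_mul_inner_self_le ℂ E _ _ _ c x y
  have h2 : ‖⟪y, T x⟫_ℂ‖ = ‖⟪x, T y⟫_ℂ‖ := by rw [← hsym, norm_inner_symm]
  have h3 : ‖⟪x, T y⟫_ℂ‖ * ‖⟪y, T x⟫_ℂ‖ ≤ (⟪x, T x⟫_ℂ).re * (⟪y, T y⟫_ℂ).re := h
  rwa [h2, ← sq] at h3

namespace SymmetricSystem

/-! ### Exhaustion of the interval, and the semi-inner product of `𝓛²_Δ`. -/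

section Basic

variable {H K : Type*}
  [NormedAddCommGroup H] [InnerProductSpace ℂ H] [NormedAddCommGroup K] [InnerProductSpace ℂ K]
  (S : SymmetricSystem H K)

lemma Icc_subset {β : ℝ} (hβ : β ∈ S.I) : Icc S.a β ⊆ S.I := by
  rintro t ⟨h1, h2⟩
  rcases S.interval with ⟨b, hb, h | h⟩ | h <;> rw [h] at hβ ⊢
  exacts [⟨h1, h2.trans hβ.2⟩, ⟨h1, h2.trans_lt hβ.2⟩, h1]

/-- Lets monotone limits and countable unions treat the closed, half-open and unbounded intervals
uniformly. -/
lemma exists_exhaustion :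
    ∃ β : ℕ → S.I, Monotone β ∧ (∀ t : S.I, ∃ N, ∀ n ≥ N, t ≤ β n) ∧ ∀ n, S.a < β n := by
  rcases S.interval with ⟨b, hb, h | h⟩ | h
  · have hm : b ∈ S.I := by rw [h]; exact ⟨hb.le, le_rfl⟩
    refine ⟨fun _ => ⟨b, hm⟩, monotone_const, fun t => ⟨0, fun _ _ => ?_⟩, fun _ => hb⟩
    have : (t : ℝ) ∈ Icc S.a b := h ▸ t.2
    exact this.2
  · have hba : 0 < b - S.a := sub_pos.2 hb
    -- The denominator `n + 2` exceeds `1` already for `n = 0`, so every point of the sequence lies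
    -- strictly to the right of `a`.
    have hd : ∀ n : ℕ, (b - S.a) / (n + 2) < b - S.a := fun n =>
      div_lt_self hba (by have := Nat.cast_nonneg (α := ℝ) n; linarith)
    have hm : ∀ n : ℕ, b - (b - S.a) / (n + 2) ∈ S.I := fun n => by
      rw [h]
      have h0 : 0 < (b - S.a) / (n + 2) := by positivity
      exact ⟨by linarith [hd n], by linarith⟩
    refine ⟨fun n => ⟨_, hm n⟩, fun m n hmn => ?_, fun t => ?_, fun n => ?_⟩
    · have : (m : ℝ) ≤ n := Nat.cast_le.2 hmn
      exact sub_le_sub_left (α := ℝ)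
        (div_le_div_of_nonneg_left hba.le (by positivity) (by linarith)) _
    · have ht : (t : ℝ) ∈ Ico S.a b := h ▸ t.2
      have hbt : 0 < b - t := sub_pos.2 ht.2
      obtain ⟨N, hN⟩ := exists_nat_gt ((b - S.a) / (b - t))
      refine ⟨N, fun n hn => ?_⟩
      have h1 : (b - S.a) / (b - t) < n + 2 := by
        have : (N : ℝ) ≤ n := Nat.cast_le.2 hn
        linarith
      rw [div_lt_comm₀ hbt (by positivity)] at h1
      refine Subtype.coe_le_coe.1 ?_
      show (t : ℝ) ≤ b - (b - S.a) / (n + 2)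
      linarith
    · show S.a < b - (b - S.a) / (n + 2)
      linarith [hd n]
  · have hm : ∀ n : ℕ, S.a + (n + 1) ∈ S.I := fun n => by
      rw [h]
      have := Nat.cast_nonneg (α := ℝ) n
      exact mem_Ici.2 (by linarith)
    refine ⟨fun n => ⟨_, hm n⟩, fun m n hmn => ?_, fun t => ?_, fun n => ?_⟩
    · have : (m : ℝ) ≤ n := Nat.cast_le.2 hmn
      exact Subtype.coe_le_coe.1 (by show S.a + (m + 1) ≤ S.a + (n + 1); linarith)
    · obtain ⟨N, hN⟩ := exists_nat_gt ((t : ℝ) - S.a)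
      refine ⟨N, fun n hn => Subtype.coe_le_coe.1 ?_⟩
      have : (N : ℝ) ≤ n := Nat.cast_le.2 hn
      show (t : ℝ) ≤ S.a + (n + 1)
      linarith
    · have := Nat.cast_nonneg (α := ℝ) n
      show S.a < S.a + (n + 1)
      linarith

/-- A sequence increasing to the right endpoint of `I`. -/
def exh : ℕ → S.I := S.exists_exhaustion.choose

lemma exh_mono : Monotone S.exh := S.exists_exhaustion.choose_spec.1

lemma exists_le_exh (t : S.I) : ∃ N, ∀ n ≥ N, t ≤ S.exh n :=
  S.exists_exhaustion.choose_spec.2.1 t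

lemma tendsto_exh : Tendsto S.exh atTop atTop :=
  tendsto_atTop.2 fun t => by
    obtain ⟨N, hN⟩ := S.exists_le_exh t
    exact eventually_atTop.2 ⟨N, hN⟩

lemma iUnion_Icc_exh : ⋃ n, Icc S.a (S.exh n : ℝ) = S.I := by
  refine Subset.antisymm (iUnion_subset fun n => S.Icc_subset (S.exh n).2) fun t ht => ?_
  obtain ⟨N, hN⟩ := S.exists_le_exh ⟨t, ht⟩
  exact mem_iUnion.2 ⟨N, S.a_le ht, hN N le_rfl⟩

lemma monotone_Icc_exh : Monotone fun n => Icc S.a (S.exh n : ℝ) := fun _ _ h =>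
  Icc_subset_Icc_right (S.exh_mono h)

lemma ae_of_ae_Icc {p : ℝ → Prop} (h : ∀ n, ∀ᵐ t ∂volume.restrict (Icc S.a (S.exh n : ℝ)), p t) :
    ∀ᵐ t ∂volume.restrict S.I, p t := by
  rw [← S.iUnion_Icc_exh]
  exact (ae_restrict_iUnion_iff _ _).2 h

lemma ae_Icc {p : ℝ → Prop} (h : ∀ᵐ t ∂volume.restrict S.I, p t) {β : ℝ} (hβ : β ∈ S.I) :
    ∀ᵐ t ∂volume.restrict (Icc S.a β), p t :=
  ae_restrict_of_ae_restrict_of_subset (S.Icc_subset hβ) h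

lemma density_nonneg (f : ℝ → HBig H K) :
    ∀ᵐ t ∂volume.restrict S.I, 0 ≤ S.density f t := by
  filter_upwards [S.pos_Δ] with t ht
  exact ht.re_inner_nonneg_right _

lemma inner_Δ_symm : ∀ᵐ t ∂volume.restrict S.I, ∀ u v,
    ⟪S.Δ t u, v⟫_ℂ = ⟪u, S.Δ t v⟫_ℂ := by
  filter_upwards [S.pos_Δ] with t ht
  exact ht.isSymmetric

lemma norm_inner_Δ_le (f g : ℝ → HBig H K) : ∀ᵐ t ∂volume.restrict S.I,
    ‖⟪f t, S.Δ t (g t)⟫_ℂ‖ ≤ S.density f t + S.density g t := by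
  filter_upwards [S.pos_Δ] with t ht
  have h := norm_inner_sq_le_of_isPositive ht (f t) (g t)
  have hf : 0 ≤ S.density f t := ht.re_inner_nonneg_right _
  have hg : 0 ≤ S.density g t := ht.re_inner_nonneg_right _
  refine abs_le_of_sq_le_sq' ?_ (add_nonneg hf hg) |>.2
  refine h.trans ?_
  change S.density f t * S.density g t ≤ _
  nlinarith

/-- Makes `Δ f` locally integrable for `f` locally in `𝓛²_Δ`, so that it can serve as an
inhomogeneity. With `w = Δ f`, Cauchy–Schwarz gives `‖w‖⁴ ≤ (Δ w, w)(Δ f, f)`, hence `‖w‖² ≤ ‖Δ‖ (Δ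
f, f)`. -/
lemma norm_Δ_le (f : ℝ → HBig H K) : ∀ᵐ t ∂volume.restrict S.I,
    ‖S.Δ t (f t)‖ ≤ ‖S.Δ t‖ + S.density f t := by
  filter_upwards [S.pos_Δ] with t ht
  set w := S.Δ t (f t) with hw
  have h := norm_inner_sq_le_of_isPositive ht w (f t)
  have hf : 0 ≤ S.density f t := ht.re_inner_nonneg_right _
  have h1 : ‖⟪w, w⟫_ℂ‖ = ‖w‖ ^ 2 := by
    rw [inner_self_eq_norm_sq_to_K]
    simp
  have h2 : (⟪w, S.Δ t w⟫_ℂ).re ≤ ‖S.Δ t‖ * ‖w‖ ^ 2 := by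
    refine (Complex.re_le_norm _).trans ((norm_inner_le_norm _ _).trans
      ((mul_le_mul_of_nonneg_left ((S.Δ t).le_opNorm w) (norm_nonneg _)).trans (le_of_eq ?_)))
    ring
  rw [← hw, h1] at h
  change _ ≤ _ * S.density f t at h
  have h3 : (‖w‖ ^ 2) ^ 2 ≤ ‖S.Δ t‖ * ‖w‖ ^ 2 * S.density f t :=
    h.trans (mul_le_mul_of_nonneg_right h2 hf)
  have hn := norm_nonneg (S.Δ t)
  rcases eq_or_ne w 0 with h0 | h0
  · rw [h0, norm_zero]
    positivity
  · have hw0 : 0 < ‖w‖ := norm_pos_iff.2 h0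
    have h4 : ‖w‖ ^ 2 ≤ ‖S.Δ t‖ * S.density f t := by
      refine le_of_mul_le_mul_left ?_ (pow_pos hw0 2)
      linarith
    refine abs_le_of_sq_le_sq' (h4.trans ?_) (add_nonneg hn hf) |>.2
    nlinarith

lemma integrable_density {f : ℝ → HBig H K} (hf : f ∈ S.lTwo) :
    IntegrableOn (S.density f) S.I :=
  (lintegral_ofReal_ne_top_iff_integrable (S.aemeasurable_density hf.1).aestronglyMeasurable
    (S.density_nonneg f)).1 hf.2.2.ne

lemma aestronglyMeasurable_Δ_apply {f : ℝ → HBig H K} (hf : StronglyMeasurable f) :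
    AEStronglyMeasurable (fun t => S.Δ t (f t)) (volume.restrict S.I) :=
  isBoundedBilinearMap_apply.continuous.comp_aestronglyMeasurable
    (S.aestronglyMeasurable_Δ.prodMk hf.aestronglyMeasurable)

lemma integrable_inner_Δ {f g : ℝ → HBig H K} (hf : f ∈ S.lTwo) (hg : g ∈ S.lTwo) :
    IntegrableOn (fun t => ⟪f t, S.Δ t (g t)⟫_ℂ) S.I :=
  Integrable.mono' ((S.integrable_density hf).add (S.integrable_density hg))
    (hf.1.aestronglyMeasurable.inner (S.aestronglyMeasurable_Δ_apply hg.1))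
    (S.norm_inner_Δ_le f g)

/-- The semi-inner product `∫_I (Δ g, f) dt` of `𝓛²_Δ(I)`, linear in `g`. -/
def ip (f g : ℝ → HBig H K) : ℂ := ∫ t in S.I, ⟪f t, S.Δ t (g t)⟫_ℂ

variable {S} in
lemma ip_congr {f g f' g' : ℝ → HBig H K}
    (h : ∀ᵐ t ∂volume.restrict S.I, ⟪f t, S.Δ t (g t)⟫_ℂ = ⟪f' t, S.Δ t (g' t)⟫_ℂ) :
    S.ip f g = S.ip f' g' := integral_congr_ae h

lemma ip_conj_symm (f g : ℝ → HBig H K) : (starRingEnd ℂ) (S.ip g f) = S.ip f g := by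
  rw [ip, ← integral_conj]
  refine integral_congr_ae ?_
  filter_upwards [S.inner_Δ_symm] with t ht
  rw [inner_conj_symm, ht]

lemma ip_self_re (f : ℝ → HBig H K) (hf : f ∈ S.lTwo) :
    (S.ip f f).re = ∫ t in S.I, S.density f t := by
  rw [ip]
  exact (integral_re (S.integrable_inner_Δ hf hf)).symm

lemma ip_self_re_nonneg (f : ℝ → HBig H K) (hf : f ∈ S.lTwo) : 0 ≤ (S.ip f f).re := by
  rw [S.ip_self_re f hf]
  exact integral_nonneg_of_ae (S.density_nonneg f)

lemma ip_add_right {f g h : ℝ → HBig H K} (hf : f ∈ S.lTwo) (hg : g ∈ S.lTwo)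
    (hh : h ∈ S.lTwo) : S.ip f (g + h) = S.ip f g + S.ip f h := by
  rw [ip, ip, ip, ← integral_add (S.integrable_inner_Δ hf hg) (S.integrable_inner_Δ hf hh)]
  simp

lemma ip_smul_right (c : ℂ) (f g : ℝ → HBig H K) : S.ip f (c • g) = c * S.ip f g := by
  rw [ip, ip, ← integral_const_mul]
  simp

lemma ip_smul_left (c : ℂ) (f g : ℝ → HBig H K) :
    S.ip (c • f) g = (starRingEnd ℂ) c * S.ip f g := by
  rw [← S.ip_conj_symm, ip_smul_right, map_mul, S.ip_conj_symm]

lemma ip_add_left {f g h : ℝ → HBig H K} (hf : f ∈ S.lTwo) (hg : g ∈ S.lTwo)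
    (hh : h ∈ S.lTwo) : S.ip (f + g) h = S.ip f h + S.ip g h := by
  rw [← S.ip_conj_symm, S.ip_add_right hh hf hg, map_add, S.ip_conj_symm, S.ip_conj_symm]

/-- The semi-inner product of `𝓛²_Δ(I)` as a pre-inner-product structure. -/
@[reducible]
def ipCore : PreInnerProductSpace.Core ℂ S.lTwo where
  inner f g := S.ip f g
  conj_inner_symm f g := S.ip_conj_symm f g
  re_inner_nonneg f := S.ip_self_re_nonneg f f.2
  add_left f g h := S.ip_add_left f.2 g.2 h.2
  smul_left f g c := S.ip_smul_left c f g

/-- The seminorm `‖·‖_Δ`. -/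
def nrm (f : S.lTwo) : ℝ := √(S.ip f f).re

lemma nrm_sq (f : S.lTwo) : S.nrm f ^ 2 = (S.ip f f).re :=
  Real.sq_sqrt (S.ip_self_re_nonneg f f.2)

lemma norm_ip_le (f g : S.lTwo) : ‖S.ip f g‖ ≤ S.nrm f * S.nrm g :=
  @InnerProductSpace.Core.norm_inner_le_norm ℂ S.lTwo _ _ _ S.ipCore f g

/-- The seminorm `‖·‖_Δ` as a bundled seminorm. -/
def seminorm : Seminorm ℂ S.lTwo :=
  letI := S.ipCore
  letI : SeminormedAddCommGroup S.lTwo := InnerProductSpace.Core.toSeminormedAddCommGroup (𝕜 := ℂ)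
  letI : NormedSpace ℂ S.lTwo := InnerProductSpace.Core.toNormedSpace
  normSeminorm ℂ S.lTwo

lemma nrm_nonneg (f : S.lTwo) : 0 ≤ S.nrm f := Real.sqrt_nonneg _

lemma normSq_eq (f : S.lTwo) : S.normSq f = ENNReal.ofReal (S.ip f f).re := by
  rw [S.ip_self_re f f.2, ofReal_integral_eq_lintegral_ofReal (S.integrable_density f.2)
    (S.density_nonneg f)]
  rfl

lemma Δ_eq_zero_of_ip_self {f : S.lTwo} (hf : (S.ip f f).re ≤ 0) :
    ∀ᵐ t ∂volume.restrict S.I, S.Δ t ((f : ℝ → HBig H K) t) = 0 :=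
  S.Δ_eq_zero_of_mem_nullSpace (f := f) (by
    show S.normSq f = 0
    rw [S.normSq_eq, ENNReal.ofReal_eq_zero.2 hf])

lemma normSq_indicator {β : ℝ} (hβ : β ∈ S.I) (f : ℝ → HBig H K) :
    S.normSq ((Icc S.a β).indicator f)
      = ∫⁻ t in Icc S.a β, ENNReal.ofReal (S.density f t) := by
  have h : ∀ t, ENNReal.ofReal (S.density ((Icc S.a β).indicator f) t)
      = (Icc S.a β).indicator (fun t => ENNReal.ofReal (S.density f t)) t := fun t => by
    by_cases ht : t ∈ Icc S.a β <;> simp [density, ht]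
  simp only [normSq, h]
  rw [lintegral_indicator measurableSet_Icc, Measure.restrict_restrict measurableSet_Icc,
    inter_eq_left.2 (S.Icc_subset hβ)]

/-- The Borel functions on `I` which belong to `𝓛²_Δ` on each segment `[a, β] ⊆ I`. -/
def lLoc : Submodule ℂ (ℝ → HBig H K) where
  carrier := {f | StronglyMeasurable f ∧ (∀ t, t ∉ S.I → f t = 0) ∧
    ∀ β ∈ S.I, (Icc S.a β).indicator f ∈ S.lTwo}
  zero_mem' := ⟨stronglyMeasurable_zero, fun _ _ => rfl, fun _ _ => by
    rw [indicator_zero']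
    exact S.lTwo.zero_mem⟩
  add_mem' {f g} hf hg := ⟨hf.1.add hg.1, fun t ht => by simp [hf.2.1 t ht, hg.2.1 t ht],
    fun β hβ => by
      rw [indicator_add']
      exact S.lTwo.add_mem (hf.2.2 β hβ) (hg.2.2 β hβ)⟩
  smul_mem' c f hf := ⟨hf.1.const_smul c, fun t ht => by simp [hf.2.1 t ht], fun β hβ => by
      have : (Icc S.a β).indicator (c • f) = c • (Icc S.a β).indicator f :=
        indicator_const_smul _ c f
      rw [this]
      exact S.lTwo.smul_mem c (hf.2.2 β hβ)⟩

lemma lTwo_le_lLoc : S.lTwo ≤ S.lLoc := fun f hf => ⟨hf.1, hf.2.1, fun β hβ =>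
  ⟨hf.1.indicator measurableSet_Icc, fun t ht => by
    rw [indicator_of_notMem fun h => ht (S.Icc_subset hβ h)], by
    rw [S.normSq_indicator hβ]
    exact (lintegral_mono_set (S.Icc_subset hβ)).trans_lt hf.2.2⟩⟩

/-- The cut-off `f ↦ 1_{[a, β]} f`. -/
def cut (β : S.I) : S.lLoc →ₗ[ℂ] S.lTwo where
  toFun f := ⟨(Icc S.a (β : ℝ)).indicator f, f.2.2.2 β β.2⟩
  map_add' f g := Subtype.ext (indicator_add' _ _ _)
  map_smul' c f := Subtype.ext (indicator_const_smul _ c (f : ℝ → HBig H K))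

lemma cut_apply_of_le {β : S.I} (f : S.lLoc) {t : ℝ} (ht : t ∈ S.I) (h : t ≤ β) :
    (S.cut β f : ℝ → HBig H K) t = (f : ℝ → HBig H K) t :=
  indicator_of_mem (show t ∈ Icc S.a (β : ℝ) from ⟨S.a_le ht, h⟩) _

lemma cut_apply_of_lt {β : S.I} (f : S.lLoc) {t : ℝ} (h : β < t) :
    (S.cut β f : ℝ → HBig H K) t = 0 :=
  indicator_of_notMem (fun ht => absurd ht.2 (not_le.2 h)) _

lemma ip_cut_left (β : S.I) (f : S.lLoc) (g : ℝ → HBig H K) :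
    S.ip (S.cut β f) g = ∫ t in Icc S.a (β : ℝ), ⟪(f : ℝ → HBig H K) t, S.Δ t (g t)⟫_ℂ := by
  have h : ∀ t, ⟪(S.cut β f : ℝ → HBig H K) t, S.Δ t (g t)⟫_ℂ = (Icc S.a (β : ℝ)).indicator
      (fun t => ⟪(f : ℝ → HBig H K) t, S.Δ t (g t)⟫_ℂ) t := fun t => by
    by_cases ht : t ∈ Icc S.a (β : ℝ) <;> simp [cut, ht]
  simp only [ip, h]
  rw [integral_indicator measurableSet_Icc, Measure.restrict_restrict measurableSet_Icc,
    inter_eq_left.2 (S.Icc_subset β.2)]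

/-- The inclusion of `𝓛²_Δ(I)` in the space of locally square-integrable functions. -/
def loc : S.lTwo →ₗ[ℂ] S.lLoc := Submodule.inclusion S.lTwo_le_lLoc

@[simp] lemma coe_loc (f : S.lTwo) : (S.loc f : ℝ → HBig H K) = f := rfl

lemma ip_cut_cut (β : S.I) (f g : S.lLoc) :
    S.ip (S.cut β f) (S.cut β g) = ∫ t in Icc S.a (β : ℝ),
      ⟪(f : ℝ → HBig H K) t, S.Δ t ((g : ℝ → HBig H K) t)⟫_ℂ := by
  rw [ip_cut_left]
  refine setIntegral_congr_fun measurableSet_Icc fun t ht => ?_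
  simp [cut, ht]

lemma ip_cut_right (β : S.I) (f : S.lLoc) (g : S.lTwo) :
    S.ip (S.cut β f) (S.cut β (S.loc g)) = S.ip (S.cut β f) g := by
  rw [ip_cut_cut, ip_cut_left, coe_loc]

lemma integrableOn_inner_Δ_Icc {β : ℝ} (hβ : β ∈ S.I) (f g : S.lLoc) :
    IntegrableOn (fun t => ⟪(f : ℝ → HBig H K) t, S.Δ t ((g : ℝ → HBig H K) t)⟫_ℂ)
      (Icc S.a β) := by
  refine ((S.integrable_inner_Δ (f.2.2.2 β hβ) (g.2.2.2 β hβ)).mono_set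
    (S.Icc_subset hβ)).congr_fun (fun t ht => ?_) measurableSet_Icc
  simp [ht]

lemma integrableOn_Δ_Icc {β : ℝ} (hβ : β ∈ S.I) (f : S.lLoc) :
    IntegrableOn (fun t => S.Δ t ((f : ℝ → HBig H K) t)) (Icc S.a β) := by
  have hd : IntegrableOn (S.density f) (Icc S.a β) := by
    refine ((S.integrable_density (f.2.2.2 β hβ)).mono_set
      (S.Icc_subset hβ)).congr_fun (fun t ht => ?_) measurableSet_Icc
    simp [density, ht]
  exact Integrable.mono' ((S.integrable_Δ β hβ).norm.add hd)
    ((S.aestronglyMeasurable_Δ_apply f.2.1).mono_measure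
      (Measure.restrict_mono (S.Icc_subset hβ) le_rfl))
    (S.ae_Icc (S.norm_Δ_le f) hβ)

lemma tendsto_ip_cut (f : S.lLoc) (g : ℝ → HBig H K)
    (h : IntegrableOn (fun t => ⟪(f : ℝ → HBig H K) t, S.Δ t (g t)⟫_ℂ) S.I) :
    Tendsto (fun n => S.ip (S.cut (S.exh n) f) g) atTop (𝓝 (S.ip f g)) := by
  simp only [ip_cut_left]
  rw [← S.iUnion_Icc_exh] at h
  have := tendsto_setIntegral_of_monotone (fun _ => measurableSet_Icc) S.monotone_Icc_exh h
  rwa [S.iUnion_Icc_exh] at this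

/-- Cutting off acts as an orthogonal projection, so the squared distance is `(f, f)` minus the
integral of the density over the segment. -/
lemma tendsto_nrm_sub_cut (f : S.lTwo) :
    Tendsto (fun n => S.nrm (f - S.cut (S.exh n) (S.loc f))) atTop (𝓝 0) := by
  have key : ∀ n, (S.ip (f - S.cut (S.exh n) (S.loc f) : S.lTwo)
      (f - S.cut (S.exh n) (S.loc f) : S.lTwo))
      = S.ip f f - S.ip (S.cut (S.exh n) (S.loc f)) f := fun n => by
    set u := S.cut (S.exh n) (S.loc f) with hu
    have h1 := @InnerProductSpace.Core.inner_sub_sub_self ℂ S.lTwo _ _ _ S.ipCore f u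
    have h2 : S.ip u u = S.ip u f := by rw [hu, ip_cut_right]
    have h3 : S.ip f u = S.ip u u := by
      rw [← S.ip_conj_symm, ← h2, S.ip_conj_symm]
    change S.ip (f - u : S.lTwo) (f - u : S.lTwo) = S.ip f f - S.ip f u - S.ip u f + S.ip u u at h1
    rw [h1, h3, h2]
    ring
  have h := ((S.tendsto_ip_cut (S.loc f) f (S.integrable_inner_Δ f.2 f.2)).const_sub
    (S.ip f f))
  rw [coe_loc, sub_self] at h
  have h' := (Real.continuous_sqrt.comp Complex.continuous_re).continuousAt.tendsto.comp h
  simp only [Function.comp_def, Complex.zero_re, Real.sqrt_zero, ← key] at h'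
  exact h'

/-- Measurability comes from the pointwise limit of the restrictions to the exhausting segments; on
each segment the density is at most `‖Δ‖` times a constant. -/
lemma mem_lLoc_of_continuousOn {y : ℝ → HBig H K} (hy : ∀ β ∈ S.I, ContinuousOn y (Icc S.a β))
    (h0 : ∀ t, t ∉ S.I → y t = 0) : y ∈ S.lLoc := by
  have hm : ∀ β ∈ S.I, StronglyMeasurable ((Icc S.a β).indicator y) := fun β hβ => by
    have hc : Continuous (IccExtend (S.a_le hβ) ((Icc S.a β).domRestrict y)) :=
      ((hy β hβ).domRestrict).Icc_extend'
    convert hc.stronglyMeasurable.indicator (measurableSet_Icc (a := S.a) (b := β)) using 1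
    refine indicator_congr fun t ht => ?_
    rw [IccExtend_of_mem _ _ ht, domRestrict_apply]
  have hlim : ∀ t, Tendsto (fun n => (Icc S.a (S.exh n : ℝ)).indicator y t) atTop (𝓝 (y t)) :=
    fun t => by
      by_cases ht : t ∈ S.I
      · obtain ⟨N, hN⟩ := S.exists_le_exh ⟨t, ht⟩
        refine tendsto_const_nhds.congr' (eventually_atTop.2 ⟨N, fun n hn => ?_⟩)
        have hm : t ∈ Icc S.a (S.exh n : ℝ) := ⟨S.a_le ht, hN n hn⟩
        exact (indicator_of_mem hm y).symm
      · refine tendsto_const_nhds.congr fun n => ?_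
        rw [indicator_apply, h0 t ht, ite_self]
  refine ⟨stronglyMeasurable_of_tendsto _ (fun n => hm _ (S.exh n).2) (tendsto_pi_nhds.2 hlim), h0,
    fun β hβ => ⟨hm β hβ, fun t ht => ?_, ?_⟩⟩
  · rw [indicator_apply, h0 t ht, ite_self]
  · rw [S.normSq_indicator hβ]
    obtain ⟨C, hC⟩ := isCompact_Icc.exists_bound_of_continuousOn (hy β hβ)
    have hi : IntegrableOn (fun t => ‖S.Δ t‖ * C ^ 2) (Icc S.a β) :=
      (S.integrable_Δ β hβ).norm.mul_const _
    refine (setLIntegral_mono_ae' measurableSet_Icc (Eventually.of_forall fun t ht =>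
      ENNReal.ofReal_le_ofReal ?_)).trans_lt hi.lintegral_lt_top
    have h1 : ‖y t‖ ≤ C := hC t ht
    have h2 : (⟪y t, S.Δ t (y t)⟫_ℂ).re ≤ ‖y t‖ * (‖S.Δ t‖ * ‖y t‖) :=
      (Complex.re_le_norm _).trans ((norm_inner_le_norm _ _).trans
        (mul_le_mul_of_nonneg_left ((S.Δ t).le_opNorm _) (norm_nonneg _)))
    refine h2.trans ?_
    have h3 : ‖y t‖ ^ 2 ≤ C ^ 2 := pow_le_pow_left₀ (norm_nonneg _) h1 2
    calc _ = ‖S.Δ t‖ * ‖y t‖ ^ 2 := by ring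
      _ ≤ _ := mul_le_mul_of_nonneg_left h3 (norm_nonneg _)

end Basic

/-! ### The Cauchy problem and Green's identity. -/

section Green

variable {H K : Type*}
  [NormedAddCommGroup H] [InnerProductSpace ℂ H] [FiniteDimensional ℂ H]
  [NormedAddCommGroup K] [InnerProductSpace ℂ K] [FiniteDimensional ℂ K]

/-- `J` as a bounded operator. -/
def JL : HBig H K →L[ℂ] HBig H K := LinearMap.toContinuousLinearMap J

@[simp] lemma JL_apply (x : HBig H K) : JL x = J x := rfl

variable (S : SymmetricSystem H K)

/-- Since `J² = -1`, multiplication by `-J` turns the system into `y' = -J(B + λΔ)y - JΔq`, an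
equation with locally integrable coefficients. -/
lemma exists_solves [CompleteSpace H] [CompleteSpace K] (l : ℂ) (c : HBig H K) (q : S.lLoc) :
    ∃ y : S.lLoc, (y : ℝ → HBig H K) S.a = c ∧ S.Solves y (l • y + q : S.lLoc) := by
  set A : ℝ → HBig H K →L[ℂ] HBig H K :=
    fun t => -((JL (H := H) (K := K)) ∘L (S.B t + l • S.Δ t)) with hA
  set r : ℝ → HBig H K := fun t => -JL (S.Δ t ((q : ℝ → HBig H K) t)) with hr
  have hAi : ∀ β ∈ S.I, IntegrableOn A (Icc S.a β) := fun β hβ =>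
    ((ContinuousLinearMap.compL ℂ (HBig H K) (HBig H K) (HBig H K) (JL (H := H) (K := K))).integrable_comp
      ((S.integrable_B β hβ).add ((S.integrable_Δ β hβ).smul l))).neg
  have hri : ∀ β ∈ S.I, IntegrableOn r (Icc S.a β) := fun β hβ =>
    (JL.integrable_comp (S.integrableOn_Δ_Icc hβ q)).neg
  obtain ⟨y, hyc, hy⟩ := exists_integral_equation_solution hAi hri (fun β hβ => S.a_le hβ) c
  have hYy : ∀ t ∈ S.I, S.I.indicator y t = y t := fun t ht => indicator_of_mem ht _
  have hY : S.I.indicator y ∈ S.lLoc := S.mem_lLoc_of_continuousOn (fun β hβ =>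
    (hyc β hβ).congr fun t ht => hYy t (S.Icc_subset hβ ht)) fun t ht => indicator_of_notMem ht _
  have hint : ∀ β ∈ S.I, IntervalIntegrable (fun s => A s (y s) + r s) volume S.a β :=
    fun β hβ => (intervalIntegrable_iff_integrableOn_Icc_of_le (S.a_le hβ)).2
      (((hAi β hβ).clm_apply_continuousOn (hyc β hβ)).add (hri β hβ))
  have heq : ∀ β ∈ S.I, EqOn (fun t => c + ∫ s in S.a..t, (A s (y s) + r s)) (S.I.indicator y)
      (Icc S.a β) := fun β hβ t ht => by
    rw [hYy t (S.Icc_subset hβ ht)]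
    exact (hy t (S.Icc_subset hβ ht)).symm
  refine ⟨⟨_, hY⟩, ?_, fun β hβ => ?_, S.ae_of_ae_Icc fun n => ?_⟩
  · rw [Subtype.coe_mk, hYy _ S.a_mem, hy _ S.a_mem]
    simp
  · have h1 := AbsolutelyContinuousOnInterval.primitive (hint β hβ)
    refine (h1.of_dist_le_add (f := fun t => c + ∫ s in S.a..t, (A s (y s) + r s)) (C := 1)
      (D := 0) h1 fun _ _ _ _ => by simp).congr ?_
    rw [uIcc_of_le (S.a_le hβ)]
    exact heq β hβ
  · have hβ := (S.exh n).2
    set β : ℝ := (S.exh n : ℝ)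
    -- The derivative is two-sided on `ℝ`, whereas the solution is extended by zero outside `I`;
    -- only interior points of the segment are usable.
    rw [← Measure.restrict_congr_set Ioo_ae_eq_Icc, ae_restrict_iff' measurableSet_Ioo]
    filter_upwards [(hint β hβ).ae_hasDerivAt_integral] with t ht htm
    have htm' := Ioo_subset_Icc_self htm
    have hd := (ht (by rwa [uIcc_of_le (S.a_le hβ)]) S.a left_mem_uIcc).const_add c
    refine ⟨_, hd.congr_of_eventuallyEq ?_, ?_⟩
    · filter_upwards [Ioo_mem_nhds htm.1 htm.2] with s hs
      exact (heq β hβ (Ioo_subset_Icc_self hs)).symm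
    · have htI := S.Icc_subset hβ htm'
      simp only [hA, hr, Submodule.coe_add, Submodule.coe_smul, Pi.add_apply, Pi.smul_apply,
        hYy t htI, map_add, map_neg, neg_apply, JL_apply,
        ContinuousLinearMap.comp_apply, add_apply,
        smul_apply, J_J, map_smul, smul_neg, neg_neg]
      abel

/-- Green's identity on a segment. -/
lemma green {y z f g : S.lLoc} (hy : S.Solves y f) (hz : S.Solves z g) (β : S.I) :
    ⟪(z : ℝ → HBig H K) β, J ((y : ℝ → HBig H K) β)⟫_ℂ
        - ⟪(z : ℝ → HBig H K) S.a, J ((y : ℝ → HBig H K) S.a)⟫_ℂ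
      = S.ip (S.cut β z) (S.cut β f) - S.ip (S.cut β g) (S.cut β y) := by
  have hβ := β.2
  have hle := S.a_le hβ
  have h1 := S.integrableOn_inner_Δ_Icc hβ z f
  have h2 := S.integrableOn_inner_Δ_Icc hβ g y
  rw [ip_cut_cut, ip_cut_cut, ← integral_sub h1 h2, integral_Icc_eq_integral_Ioc,
    ← intervalIntegral.integral_of_le hle]
  symm
  refine ((hz.1 β hβ).inner ((hy.1 β hβ).clm_comp JL)).integral_eq_sub ?_
    ((intervalIntegrable_iff_integrableOn_Icc_of_le hle).2 (h1.sub h2))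
  rw [uIcc_of_le hle, ← ae_restrict_iff' measurableSet_Icc]
  filter_upwards [S.ae_Icc hy.2 hβ, S.ae_Icc hz.2 hβ, S.ae_Icc S.symm_B hβ,
    S.ae_Icc S.inner_Δ_symm hβ] with t ⟨y', hy', ey⟩ ⟨z', hz', ez⟩ hB hΔ
  have hB' : ∀ u v, ⟪S.B t u, v⟫_ℂ = ⟪u, S.B t v⟫_ℂ := hB
  have hJy : HasDerivAt (fun t => JL ((y : ℝ → HBig H K) t)) (JL y') t :=
    ((JL (H := H) (K := K)).restrictScalars ℝ).hasFDerivAt.comp_hasDerivAt t hy'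
  refine (hz'.inner ℂ hJy).congr_deriv ?_
  -- Skewness of `J` turns `⟪z', Jy⟫` into `-⟪Jz', y⟫`; after inserting the two equations the
  -- `B`-terms cancel by symmetry.
  rw [JL_apply, JL_apply, inner_J z', ← hΔ ((g : ℝ → HBig H K) t), ← ey, ← ez]
  simp only [inner_sub_left, inner_sub_right, hB']
  ring

end Green

end SymmetricSystem

end SymmSys

end

noncomputable section

namespace SymmSys

open OSum

namespace SymmetricSystem

/-! ### Cut-offs of functions vanishing near the right endpoint. -/

section Cut

variable {H K : Type*}
  [NormedAddCommGroup H] [InnerProductSpace ℂ H] [NormedAddCommGroup K] [InnerProductSpace ℂ K]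
  (S : SymmetricSystem H K)

/-- The semi-inner product of `𝓛²_Δ(I)` as a sesquilinear map. -/
def ipS : S.lTwo →ₗ⋆[ℂ] S.lTwo →ₗ[ℂ] ℂ :=
  LinearMap.mk₂'ₛₗ (starRingEnd ℂ) (RingHom.id ℂ) (fun f g : S.lTwo => S.ip f g)
    (fun f g h => S.ip_add_left f.2 g.2 h.2) (fun c f g => S.ip_smul_left c f g)
    (fun f g h => S.ip_add_right f.2 g.2 h.2) (fun c f g => S.ip_smul_right c f g)

lemma ipS_apply (f g : S.lTwo) : S.ipS f g = S.ip f g := rfl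

/-- The evaluation `y ↦ y(t)`. -/
def evalAt (t : ℝ) : S.lLoc →ₗ[ℂ] HBig H K where
  toFun y := (y : ℝ → HBig H K) t
  map_add' _ _ := rfl
  map_smul' _ _ := rfl

variable {S}

lemma cut_eq_of_vanish {β γ : S.I} (hβγ : β ≤ γ) {w : S.lLoc}
    (hw : ∀ t ∈ S.I, (β : ℝ) < t → (w : ℝ → HBig H K) t = 0) : S.cut γ w = S.cut β w := by
  refine Subtype.ext (funext fun t => ?_)
  by_cases ht : t ∈ Icc S.a (β : ℝ)
  · have h1 := S.Icc_subset β.2 ht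
    rw [S.cut_apply_of_le w h1 ht.2, S.cut_apply_of_le w h1 (ht.2.trans hβγ)]
  · by_cases htI : t ∈ S.I
    · have hlt : (β : ℝ) < t := not_le.1 fun h => ht ⟨S.a_le htI, h⟩
      rw [S.cut_apply_of_lt w hlt]
      rcases le_or_gt t γ with h | h
      · rw [S.cut_apply_of_le w htI h, hw t htI hlt]
      · rw [S.cut_apply_of_lt w h]
    · rw [(S.cut γ w).2.2.1 t htI, (S.cut β w).2.2.1 t htI]

lemma loc_cut_of_vanish {β : S.I} {w : S.lLoc}
    (hw : ∀ t ∈ S.I, (β : ℝ) < t → (w : ℝ → HBig H K) t = 0) : S.loc (S.cut β w) = w := by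
  refine Subtype.ext (funext fun t => ?_)
  rw [coe_loc]
  by_cases htI : t ∈ S.I
  · rcases le_or_gt t β with h | h
    · rw [S.cut_apply_of_le w htI h]
    · rw [S.cut_apply_of_lt w h, hw t htI h]
  · rw [(S.cut β w).2.2.1 t htI, w.2.2.1 t htI]

lemma cut_loc_cut {β γ : S.I} (h : β ≤ γ) (w : S.lLoc) :
    S.cut γ (S.loc (S.cut β w)) = S.cut β w := by
  have h0 : ∀ t ∈ S.I, (β : ℝ) < t → (S.loc (S.cut β w) : ℝ → HBig H K) t = 0 := fun t _ ht =>
    S.cut_apply_of_lt w ht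
  rw [cut_eq_of_vanish h h0]
  refine Subtype.ext (funext fun t => ?_)
  by_cases htI : t ∈ S.I
  · rcases le_or_gt t β with h | h
    · rw [S.cut_apply_of_le _ htI h, coe_loc]
    · rw [S.cut_apply_of_lt _ h, S.cut_apply_of_lt _ h]
  · rw [(S.cut β _).2.2.1 t htI, (S.cut β w).2.2.1 t htI]

lemma ip_cut_of_le {β γ : S.I} (h : β ≤ γ) (z w : S.lLoc) :
    S.ip (S.cut γ z) (S.cut β w) = S.ip (S.cut β z) (S.cut β w) := by
  refine ip_congr (ae_restrict_of_forall_mem S.measurableSet_I fun t ht => ?_)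
  rcases le_or_gt t β with h1 | h1
  · rw [S.cut_apply_of_le z ht h1, S.cut_apply_of_le z ht (h1.trans h)]
  · rw [S.cut_apply_of_lt w h1, map_zero, inner_zero_right, inner_zero_right]

end Cut

/-! ### Solutions with given initial value, and definiteness on a segment. -/

section Solutions

variable {H K : Type*}
  [NormedAddCommGroup H] [InnerProductSpace ℂ H] [FiniteDimensional ℂ H]
  [NormedAddCommGroup K] [InnerProductSpace ℂ K] [FiniteDimensional ℂ K]
  (S : SymmetricSystem H K)

/-- The solutions of `J y' - B y = λ Δ y`. -/
def Sol (l : ℂ) : Submodule ℂ S.lLoc where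
  carrier := {y | S.Solves y (l • y : S.lLoc)}
  zero_mem' := by
    show S.Solves (0 : S.lLoc) (l • (0 : S.lLoc) : S.lLoc)
    rw [smul_zero]
    exact S.solves_zero
  add_mem' {y z} hy hz := by
    show S.Solves (y + z : S.lLoc) (l • (y + z) : S.lLoc)
    rw [smul_add]
    exact Solves.add hy hz
  smul_mem' c y hy := by
    show S.Solves (c • y : S.lLoc) (l • c • y : S.lLoc)
    rw [smul_comm]
    exact Solves.smul c hy

variable {S}

/-- In Green's identity the parameters `λ̄` for `x` and `λ` for `z` both contribute `λ̄ (x, z)`,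
because the form is conjugate-linear in `z`. These terms cancel, and only the source `w` remains. -/
lemma form_eq {l : ℂ} {x w z : S.lLoc}
    (hx : S.Solves x ((starRingEnd ℂ) l • x + w : S.lLoc)) (hz : z ∈ S.Sol l) (β : S.I) :
    ⟪(z : ℝ → HBig H K) β, J ((x : ℝ → HBig H K) β)⟫_ℂ
      = ⟪(z : ℝ → HBig H K) S.a, J ((x : ℝ → HBig H K) S.a)⟫_ℂ
        + S.ip (S.cut β z) (S.cut β w) := by
  rw [← sub_eq_iff_eq_add', S.green hx hz β, map_add, map_smul, map_smul]
  simp only [← ipS_apply, map_add, map_smul, map_smulₛₗ, LinearMap.smul_apply]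
  simp

lemma form_const {l : ℂ} {x z : S.lLoc}
    (hx : x ∈ S.Sol ((starRingEnd ℂ) l)) (hz : z ∈ S.Sol l) (β : S.I) :
    ⟪(z : ℝ → HBig H K) β, J ((x : ℝ → HBig H K) β)⟫_ℂ
      = ⟪(z : ℝ → HBig H K) S.a, J ((x : ℝ → HBig H K) S.a)⟫_ℂ := by
  have hx' : S.Solves x ((starRingEnd ℂ) l • x + 0 : S.lLoc) := by rw [add_zero]; exact hx
  rw [form_eq hx' hz β, map_zero]
  simp [ip]

variable [CompleteSpace H] [CompleteSpace K]

/-- A linear choice of solutions is enough, so uniqueness for the Cauchy problem need not be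
invoked. -/
lemma exists_sec (S : SymmetricSystem H K) (l : ℂ) :
    ∃ s : HBig H K →ₗ[ℂ] S.Sol l, ∀ h, ((s h : S.lLoc) : ℝ → HBig H K) S.a = h := by
  obtain ⟨s, hs⟩ := LinearMap.exists_rightInverse_of_surjective
    (S.evalAt S.a ∘ₗ (S.Sol l).subtype) (LinearMap.range_eq_top.2 fun c => by
      obtain ⟨y, hy, hs⟩ := S.exists_solves l c 0
      refine ⟨⟨y, ?_⟩, hy⟩
      rw [add_zero] at hs
      exact hs)
  exact ⟨s, fun h => LinearMap.congr_fun hs h⟩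

/-- The solution of `J y' - B y = λ Δ y`, `y(a) = h`. -/
def sec (S : SymmetricSystem H K) (l : ℂ) : HBig H K →ₗ[ℂ] S.lLoc :=
  (S.Sol l).subtype ∘ₗ (S.exists_sec l).choose

lemma sec_a (l : ℂ) (h : HBig H K) : (S.sec l h : ℝ → HBig H K) S.a = h :=
  (S.exists_sec l).choose_spec h

lemma sec_mem (l : ℂ) (h : HBig H K) : S.sec l h ∈ S.Sol l :=
  ((S.exists_sec l).choose h).2

/-- The form `⟪z, Jx⟫` is constant in `t` for solutions with parameters `λ` and `λ̄`. If the
solution starting at `c` vanishes at `t`, pairing it with the one starting at `Jc` gives `‖c‖ = 0`;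
injectivity yields surjectivity in finite dimension. -/
lemma exists_sec_eq (l : ℂ) (t : S.I) (h : HBig H K) :
    ∃ c, (S.sec l c : ℝ → HBig H K) t = h := by
  have hinj : Function.Injective (S.evalAt t ∘ₗ S.sec l) := by
    refine (injective_iff_map_eq_zero _).2 fun c hc => ?_
    have hc' : (S.sec l c : ℝ → HBig H K) t = 0 := hc
    have h1 := form_const (S.sec_mem ((starRingEnd ℂ) l) (J c)) (S.sec_mem l c) t
    rw [hc', inner_zero_left, sec_a, sec_a, J_J, inner_neg_right] at h1
    exact inner_self_eq_zero.1 (neg_eq_zero.1 h1.symm)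
  exact LinearMap.injective_iff_surjective.1 hinj h

/-- A solution of `J x' - B x = λ̄ Δ x + Δ w`, where `w` vanishes to the right of `β`, vanishes to
the right of `β` if the boundary terms in Green's identity do. -/
lemma vanish_of_form {l : ℂ} {x w : S.lLoc} {β : S.I}
    (hx : S.Solves x ((starRingEnd ℂ) l • x + w : S.lLoc))
    (hw : ∀ t ∈ S.I, (β : ℝ) < t → (w : ℝ → HBig H K) t = 0)
    (h : ∀ c, ⟪c, J ((x : ℝ → HBig H K) S.a)⟫_ℂ + S.ip (S.cut β (S.sec l c)) (S.cut β w) = 0)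
    (t : S.I) (ht : β ≤ t) : (x : ℝ → HBig H K) t = 0 := by
  -- The test solution is chosen to equal `Jx(t)` at `t`, so that Green's identity reads `‖Jx(t)‖² =
  -- 0`.
  obtain ⟨c, hc⟩ := exists_sec_eq l t (J ((x : ℝ → HBig H K) t))
  have h1 := form_eq hx (S.sec_mem l c) t
  rw [cut_eq_of_vanish ht hw, ip_cut_of_le ht, sec_a, h c, hc] at h1
  exact J_injective ((inner_self_eq_zero.1 h1).trans (map_zero _).symm)

/-- A definite system is definite on some segment `[a, β₀] ⊆ I`. -/
lemma Definite.exists_segment (hS : S.Definite) (l : ℂ) : ∃ β₀ : S.I, ∀ β ≥ β₀, ∀ h,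
    (S.ip (S.cut β (S.sec l h)) (S.cut β (S.sec l h))).re ≤ 0 → h = 0 := by
  -- `N n` collects the initial values whose solutions are annihilated by `Δ` on the `n`-th segment.
  -- These subspaces decrease and, by finite dimension, stabilize; a vector of the stable one gives
  -- a solution annihilated on all of `I`, which is zero.
  let N : ℕ →o (Submodule ℂ (HBig H K))ᵒᵈ :=
    { toFun := fun n => OrderDual.toDual
        { carrier := {h | ∀ᵐ t ∂volume.restrict (Icc S.a (S.exh n : ℝ)),
            S.Δ t ((S.sec l h : ℝ → HBig H K) t) = 0}
          zero_mem' := by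
            show ∀ᵐ t ∂volume.restrict (Icc S.a (S.exh n : ℝ)),
              S.Δ t ((S.sec l (0) : ℝ → HBig H K) t) = 0
            refine Eventually.of_forall fun t => ?_
            rw [map_zero]
            exact map_zero _
          add_mem' := fun {x y} hx hy => by
            show ∀ᵐ t ∂volume.restrict (Icc S.a (S.exh n : ℝ)),
              S.Δ t ((S.sec l (x + y) : ℝ → HBig H K) t) = 0
            filter_upwards [hx, hy] with t h1 h2
            rw [map_add]
            show S.Δ t ((S.sec l x : ℝ → HBig H K) t + (S.sec l y : ℝ → HBig H K) t) = 0
            rw [map_add, h1, h2, add_zero]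
          smul_mem' := fun c x hx => by
            show ∀ᵐ t ∂volume.restrict (Icc S.a (S.exh n : ℝ)),
              S.Δ t ((S.sec l (c • x) : ℝ → HBig H K) t) = 0
            filter_upwards [hx] with t h1
            rw [map_smul]
            show S.Δ t (c • (S.sec l x : ℝ → HBig H K) t) = 0
            rw [map_smul, h1, smul_zero] }
      monotone' := fun m n hmn h hh =>
        ae_restrict_of_ae_restrict_of_subset (S.monotone_Icc_exh hmn) hh }
  obtain ⟨n, hn⟩ := IsArtinian.monotone_stabilizes N
  refine ⟨S.exh n, fun β hβ h hh => ?_⟩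
  have h1 : ∀ᵐ t ∂volume.restrict (Icc S.a (S.exh n : ℝ)),
      S.Δ t ((S.sec l h : ℝ → HBig H K) t) = 0 := by
    have h2 := S.ae_Icc (S.Δ_eq_zero_of_ip_self hh) (S.exh n).2
    filter_upwards [h2, ae_restrict_mem measurableSet_Icc] with t h3 h4
    rwa [S.cut_apply_of_le _ (S.Icc_subset (S.exh n).2 h4) (h4.2.trans hβ)] at h3
  have h2 : ∀ m, h ∈ OrderDual.ofDual (N m) := fun m => by
    rcases le_total n m with hm | hm
    · rw [← hn m hm]
      exact h1
    · exact N.monotone' hm h1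
  have h3 := hS l _ (S.sec_mem l h) (S.ae_of_ae_Icc h2) S.a S.a_mem
  rwa [sec_a] at h3

/-- Every initial value is attained by a function of `dom 𝒯_max` vanishing near the right
endpoint. -/
lemma Definite.exists_compact (hS : S.Definite) (c : HBig H K) :
    ∃ y f : S.lTwo, S.Solves y f ∧ (y : ℝ → HBig H K) S.a = c ∧
      ∃ β : S.I, ∀ t : S.I, β ≤ t → (y : ℝ → HBig H K) t = 0 := by
  obtain ⟨β, hβ⟩ := hS.exists_segment 0
  let e := stdOrthonormalBasis ℂ (HBig H K)
  let Z : HBig H K →ₗ[ℂ] S.lTwo := S.cut β ∘ₗ S.sec 0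
  -- The Gram operator of the solutions at `λ = 0` on `[a, β]`; definiteness on the segment makes it
  -- injective.
  let T : HBig H K →ₗ[ℂ] HBig H K :=
    ∑ i, (S.ipS (Z (e i)) ∘ₗ Z).smulRight (e i)
  have hT : ∀ h d, ⟪h, T d⟫_ℂ = S.ip (Z h) (Z d) := fun h d => by
    have h1 : Z h = ∑ i, ⟪e i, h⟫_ℂ • Z (e i) := by
      conv_lhs => rw [← e.sum_repr' h, map_sum]
      simp only [map_smul]
    rw [h1]
    simp only [T, LinearMap.sum_apply, LinearMap.smulRight_apply, LinearMap.comp_apply,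
      inner_sum, inner_smul_right, ← ipS_apply, map_sum, map_smulₛₗ, LinearMap.smul_apply,
      inner_conj_symm, smul_eq_mul]
    exact Finset.sum_congr rfl fun i _ => mul_comm _ _
  have hinj : Function.Injective T := (injective_iff_map_eq_zero _).2 fun d hd => by
    refine hβ β le_rfl d ?_
    have h1 := hT d d
    rw [hd, inner_zero_right] at h1
    exact (congrArg Complex.re h1.symm).le
  -- The source `Z d` is tuned so that `⟪h, Jc⟫ + (Z d, Z h) = 0` for all `h`. By Green's identity
  -- the solution starting at `c` then vanishes from `β` on.
  obtain ⟨d, hd⟩ := LinearMap.injective_iff_surjective.1 hinj (-J c)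
  obtain ⟨x, hxa, hx⟩ := S.exists_solves ((starRingEnd ℂ) 0) c (S.loc (Z d))
  have hw : ∀ t ∈ S.I, (β : ℝ) < t → (S.loc (Z d) : ℝ → HBig H K) t = 0 := fun t _ ht =>
    S.cut_apply_of_lt _ ht
  have hv := vanish_of_form hx hw fun h => by
    have h1 : S.cut β (S.loc (Z d)) = Z d := cut_loc_cut le_rfl _
    have h2 : S.cut β (S.sec 0 h) = Z h := rfl
    rw [h1, h2, ← hT, hd, hxa, inner_neg_right, add_neg_cancel]
  have hx0 := loc_cut_of_vanish (β := β) (w := x) fun t ht h => hv ⟨t, ht⟩ h.le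
  refine ⟨S.cut β x, Z d, ?_, ?_, β, fun t ht => ?_⟩
  · rw [← coe_loc, hx0]
    rw [map_zero, zero_smul, zero_add] at hx
    exact hx
  · rw [← coe_loc, hx0, hxa]
  · rw [← coe_loc, hx0, hv t ht]

/-! ### Weak solutions are solutions. -/

section Representation

variable {l : ℂ} {q : S.lTwo} {ℓ : S.lTwo →ₗ[ℂ] ℂ}

/-- A functional on `𝓛²_Δ` which annihilates `w - (T - λ̄) x` in the weak sense for functions `x`
of compact support is given on each segment by a solution of the inhomogeneous equation. -/
lemma exists_rep_cut {v₀ : S.lLoc} (hv : S.Solves v₀ (l • v₀ + S.loc q : S.lLoc))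
    (hℓ : ∀ x w : S.lTwo, S.Solves x ((starRingEnd ℂ) l • x + w : S.lTwo) →
      (x : ℝ → HBig H K) S.a = 0 → (∃ β : S.I, ∀ t : S.I, β ≤ t → (x : ℝ → HBig H K) t = 0) →
      ℓ w = S.ip q x) (β : S.I) :
    ∃ c, ∀ w : S.lLoc, ℓ (S.cut β w) = S.ip (S.cut β (v₀ + S.sec l c)) (S.cut β w) := by
  let e := Module.finBasis ℂ (HBig H K)
  let C : S.lTwo →ₗ[ℂ] S.lTwo := S.cut β ∘ₗ S.loc
  let Z : HBig H K →ₗ[ℂ] S.lTwo := S.cut β ∘ₗ S.sec l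
  -- A functional vanishing on the common kernel of finitely many functionals lies in their span. It
  -- thus suffices to treat `w` orthogonal on the segment to all solutions of the homogeneous
  -- equation.
  have hmem : ℓ ∘ₗ C - S.ipS (S.cut β v₀) ∘ₗ C
      ∈ Submodule.span ℂ (range fun i => S.ipS (Z (e i)) ∘ₗ C) := by
    refine mem_span_of_iInf_ker_le_ker fun w hw => ?_
    have hw1 : ∀ i, S.ipS (Z (e i)) (C w) = 0 := fun i => by
      have := (Submodule.mem_iInf _).1 hw i
      exact this
    have hw2 : ∀ h, S.ip (Z h) (C w) = 0 := fun h => by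
      rw [← e.sum_repr h]
      simp only [← ipS_apply, map_sum, map_smul, map_smulₛₗ, LinearMap.sum_apply,
        LinearMap.smul_apply, hw1, smul_zero, Finset.sum_const_zero]
    -- For such `w` the solution with source `w` and zero initial value vanishes from `β` on, hence
    -- is an admissible test function. The hypothesis on `ℓ` and Green's identity against `v₀`
    -- evaluate `ℓ` and `(·, v₀)` at `w` to the same number.
    obtain ⟨x, hxa, hx⟩ := S.exists_solves ((starRingEnd ℂ) l) 0 (S.loc (C w))
    have hCC : S.cut β (S.loc (C w)) = C w := cut_loc_cut le_rfl _
    have hvx := vanish_of_form hx (fun t _ ht => S.cut_apply_of_lt _ ht) fun h => by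
      rw [hxa, map_zero, inner_zero_right, zero_add, hCC]
      exact hw2 h
    have hx0 := loc_cut_of_vanish (β := β) (w := x) fun t ht h => hvx ⟨t, ht⟩ h.le
    have h1 := hℓ (S.cut β x) (C w) (by
      have h2 : (((starRingEnd ℂ) l • S.cut β x + C w : S.lTwo) : ℝ → HBig H K)
          = ((starRingEnd ℂ) l • x + S.loc (C w) : S.lLoc) := by
        conv_rhs => rw [← hx0]
        rfl
      rw [h2, ← coe_loc, hx0]
      exact hx) (by rw [← coe_loc, hx0, hxa]) ⟨β, fun t ht => by rw [← coe_loc, hx0, hvx t ht]⟩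
    have h2 := S.green hx hv β
    rw [hvx β le_rfl, hxa, map_zero, inner_zero_right, inner_zero_right, sub_self, map_add,
      map_add, map_smul, map_smul, hCC] at h2
    have h3 : S.ip (S.cut β (S.loc q)) (S.cut β x) = S.ip q (S.cut β x) := by
      rw [← S.ip_conj_symm, S.ip_cut_right, S.ip_conj_symm]
    simp only [← ipS_apply, map_add, map_smul, map_smulₛₗ, LinearMap.smul_apply,
      LinearMap.add_apply] at h2
    rw [LinearMap.mem_ker, LinearMap.sub_apply]
    show ℓ (C w) - S.ipS (S.cut β v₀) (C w) = 0
    rw [h1, ← h3]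
    simp only [← ipS_apply]
    simp only [smul_eq_mul] at h2
    linear_combination h2
  obtain ⟨a, ha⟩ := (Submodule.mem_span_range_iff_exists_fun ℂ).1 hmem
  refine ⟨∑ i, (starRingEnd ℂ) (a i) • e i, fun w => ?_⟩
  have h1 := LinearMap.congr_fun ha (S.cut β w)
  have hC : C (S.cut β w) = S.cut β w := cut_loc_cut le_rfl _
  simp only [LinearMap.sum_apply, LinearMap.smul_apply, LinearMap.sub_apply,
    LinearMap.comp_apply, hC] at h1
  have hZ : ∀ i, S.cut β (S.sec l (e i)) = Z (e i) := fun _ => rfl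
  rw [← ipS_apply]
  simp only [map_add, map_sum, map_smul, map_smulₛₗ, LinearMap.add_apply, LinearMap.sum_apply,
    LinearMap.smul_apply, Complex.conj_conj, hZ]
  rw [h1]
  ring

/-- A bounded functional on `𝓛²_Δ` which annihilates `w - (T - λ̄) x` in the weak sense for
functions `x` of compact support is given by a solution of the inhomogeneous equation. -/
theorem Definite.exists_rep (hS : S.Definite) {C : ℝ} (hC0 : 0 ≤ C) (hC : ∀ w, ‖ℓ w‖ ≤ C * S.nrm w)
    (hℓ : ∀ x w : S.lTwo, S.Solves x ((starRingEnd ℂ) l • x + w : S.lTwo) →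
      (x : ℝ → HBig H K) S.a = 0 → (∃ β : S.I, ∀ t : S.I, β ≤ t → (x : ℝ → HBig H K) t = 0) →
      ℓ w = S.ip q x) :
    ∃ v : S.lTwo, S.Solves v (l • v + q : S.lTwo) ∧ ∀ w, ℓ w = S.ip v w := by
  obtain ⟨v₀, -, hv₀⟩ := S.exists_solves l 0 (S.loc q)
  choose c hc using exists_rep_cut hv₀ hℓ
  obtain ⟨β₀, hβ₀⟩ := hS.exists_segment l
  -- Both representations hold on the smaller segment. Tested on the solution with initial value `c
  -- β - c β₀`, they show that its norm over that segment is zero, and segment definiteness applies.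
  have hcc : ∀ β ≥ β₀, c β = c β₀ := fun β hβ => by
    refine sub_eq_zero.1 (hβ₀ β₀ le_rfl _ (le_of_eq ?_))
    obtain ⟨d, hd⟩ : ∃ d, d = c β - c β₀ := ⟨_, rfl⟩
    have h1 := hc β₀ (S.sec l d)
    have h2 := hc β (S.loc (S.cut β₀ (S.sec l d)))
    rw [cut_loc_cut hβ, h1, ip_cut_of_le hβ] at h2
    simp only [map_add, ← ipS_apply, LinearMap.add_apply] at h2
    have h3 : S.ipS (S.cut β₀ (S.sec l (c β - c β₀))) (S.cut β₀ (S.sec l d)) = 0 := by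
      rw [map_sub (S.sec l), map_sub (S.cut β₀), map_sub, LinearMap.sub_apply,
        sub_eq_zero.2 (add_left_cancel h2).symm]
    rw [hd] at h3
    rw [← ipS_apply, h3, Complex.zero_re]
  set v := v₀ + S.sec l (c β₀) with hv
  have hcv : ∀ β ≥ β₀, ∀ w : S.lLoc, ℓ (S.cut β w) = S.ip (S.cut β v) (S.cut β w) :=
    fun β hβ w => by rw [hc β w, hcc β hβ]
  have hsv : S.Solves v (l • v + S.loc q : S.lLoc) := by
    have h1 : S.Solves (v₀ + S.sec l (c β₀) : S.lLoc)
        ((l • v₀ + S.loc q) + l • S.sec l (c β₀) : S.lLoc) :=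
      Solves.add hv₀ (S.sec_mem l (c β₀))
    rw [add_right_comm, ← smul_add] at h1
    exact h1
  -- Testing `ℓ` on the cut-off of `v` itself gives `‖v‖² ≤ C ‖v‖` over the segment, uniformly in
  -- `β`; monotone convergence then puts `v` into `𝓛²_Δ`.
  have hbound : ∀ β ≥ β₀, S.nrm (S.cut β v) ≤ C := fun β hβ => by
    have h1 := hC (S.cut β v)
    rw [hcv β hβ v] at h1
    have h2 : S.nrm (S.cut β v) ^ 2 ≤ C * S.nrm (S.cut β v) := by
      rw [S.nrm_sq]
      exact (Complex.re_le_norm _).trans h1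
    rcases (S.nrm_nonneg (S.cut β v)).eq_or_lt with h0 | h0
    · rwa [← h0]
    · rw [sq] at h2
      exact le_of_mul_le_mul_right h2 h0
  have hvT : (v : ℝ → HBig H K) ∈ S.lTwo := by
    refine ⟨v.2.1, v.2.2.1, ?_⟩
    have h1 : S.normSq v = ⨆ n, S.normSq (S.cut (S.exh n) v) := by
      have h2 : ∀ n, S.normSq (S.cut (S.exh n) v)
          = ∫⁻ t in Icc S.a (S.exh n : ℝ), ENNReal.ofReal (S.density v t) := fun n =>
        S.normSq_indicator (S.exh n).2 v
      simp only [h2]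
      have h3 := setLIntegral_iUnion_of_directed (μ := volume)
        (fun t => ENNReal.ofReal (S.density v t)) (S.monotone_Icc_exh.directed_le)
      rwa [S.iUnion_Icc_exh] at h3
    rw [h1]
    obtain ⟨N, hN⟩ := S.exists_le_exh β₀
    refine (iSup_le fun n => ?_).trans_lt (ENNReal.ofReal_lt_top (r := C ^ 2))
    have h3 : S.normSq (S.cut (S.exh n) v) ≤ S.normSq (S.cut (S.exh (max n N)) v) := by
      show S.normSq ((Icc S.a (S.exh n : ℝ)).indicator v) ≤
        S.normSq ((Icc S.a (S.exh (max n N) : ℝ)).indicator v)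
      rw [S.normSq_indicator (S.exh _).2, S.normSq_indicator (S.exh _).2]
      exact lintegral_mono_set (S.monotone_Icc_exh (le_max_left _ _))
    refine h3.trans ?_
    rw [S.normSq_eq, ← S.nrm_sq]
    exact ENNReal.ofReal_le_ofReal (pow_le_pow_left₀ (S.nrm_nonneg _)
      (hbound _ (hN _ (le_max_right _ _))) 2)
  refine ⟨⟨v, hvT⟩, hsv, fun w => ?_⟩
  obtain ⟨N, hN⟩ := S.exists_le_exh β₀
  have hl1 : Tendsto (fun n => ℓ (S.cut (S.exh n) (S.loc w))) atTop (𝓝 (ℓ w)) := by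
    rw [tendsto_iff_norm_sub_tendsto_zero]
    refine squeeze_zero (fun _ => norm_nonneg _) (fun n => ?_)
      (by simpa using (S.tendsto_nrm_sub_cut w).const_mul C)
    rw [norm_sub_rev, ← map_sub]
    exact hC _
  have hl2 : Tendsto (fun n => ℓ (S.cut (S.exh n) (S.loc w))) atTop (𝓝 (S.ip v w)) := by
    refine (S.tendsto_ip_cut v w (S.integrable_inner_Δ hvT w.2)).congr'
      (eventually_atTop.2 ⟨N, fun n hn => ?_⟩)
    exact ((hcv _ (hN n hn) (S.loc w)).trans (S.ip_cut_right _ v w)).symm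
  exact tendsto_nhds_unique hl1 hl2

end Representation

end Solutions

end SymmetricSystem

end SymmSys

end

noncomputable section

/-- The Hahn–Banach theorem for a functional given on the range of a linear map. -/
lemma LinearMap.exists_extension_of_norm_le {V E : Type*} [AddCommGroup V] [Module ℂ V]
    [AddCommGroup E] [Module ℂ E] (R : V →ₗ[ℂ] E) (φ : V →ₗ[ℂ] ℂ) (p : Seminorm ℂ E)
    (h : ∀ v, ‖φ v‖ ≤ p (R v)) :
    ∃ ℓ : E →ₗ[ℂ] ℂ, (∀ v, ℓ (R v) = φ v) ∧ ∀ x, ‖ℓ x‖ ≤ p x := by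
  obtain ⟨s, hs⟩ := LinearMap.exists_rightInverse_of_surjective R.rangeRestrict
    R.range_rangeRestrict
  have hs' : ∀ x : LinearMap.range R, R (s x) = x := fun x =>
    congrArg Subtype.val (LinearMap.congr_fun hs x)
  obtain ⟨ℓ, hℓ, hb⟩ := Module.Dual.exists_extension_of_le_seminorm (LinearMap.range R) (φ ∘ₗ s)
    (p := p) fun x => by
      rw [LinearMap.comp_apply, ← hs' x]
      exact h _
  refine ⟨ℓ, fun v => ?_, hb⟩
  have h1 : ℓ (R v) = φ (s (R.rangeRestrict v)) := hℓ (R.rangeRestrict v)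
  -- Two preimages of one point differ by an element of the kernel of `R`, on which the bound forces
  -- `φ = 0`; so the choice of `s` is immaterial.
  rw [h1, ← sub_eq_zero, ← map_sub, ← norm_le_zero_iff]
  refine (h _).trans (le_of_eq ?_)
  rw [map_sub, hs']
  show p (R v - R v) = 0
  rw [sub_self, map_zero]

/-- The Hahn–Banach theorem for a functional given on the image of a submodule. -/
lemma LinearMap.exists_extension_of_norm_le_on {V E : Type*} [AddCommGroup V] [Module ℂ V]
    [AddCommGroup E] [Module ℂ E] (N : Submodule ℂ V) (R : V →ₗ[ℂ] E) (φ : V →ₗ[ℂ] ℂ)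
    (p : Seminorm ℂ E) (h : ∀ v ∈ N, ‖φ v‖ ≤ p (R v)) :
    ∃ ℓ : E →ₗ[ℂ] ℂ, (∀ v ∈ N, ℓ (R v) = φ v) ∧ ∀ x, ‖ℓ x‖ ≤ p x := by
  obtain ⟨ℓ, h1, h2⟩ := LinearMap.exists_extension_of_norm_le (R ∘ₗ N.subtype) (φ ∘ₗ N.subtype) p
    fun v => h v v.2
  exact ⟨ℓ, fun v hv => h1 ⟨v, hv⟩, h2⟩

namespace SymmSys

open OSum

lemma inner_self_eq_ofReal {E : Type*} [NormedAddCommGroup E] [InnerProductSpace ℂ E] (x : E) :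
    ⟪x, x⟫_ℂ = ((‖x‖ ^ 2 : ℝ) : ℂ) := by
  rw [inner_self_eq_norm_sq_to_K, Complex.ofReal_pow]
  rfl

section Components

variable {H K : Type*}
  [NormedAddCommGroup H] [InnerProductSpace ℂ H] [NormedAddCommGroup K] [InnerProductSpace ℂ K]

@[simp] lemma c₀_mk₃ (x : H) (y : K) (z : H) : c₀ (mk₃ x y z) = x := rfl

@[simp] lemma ch_mk₃ (x : H) (y : K) (z : H) : ch (mk₃ x y z) = y := rfl

@[simp] lemma c₁_mk₃ (x : H) (y : K) (z : H) : c₁ (mk₃ x y z) = z := rfl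

@[simp] lemma c₀_add (x y : HBig H K) : c₀ (x + y) = c₀ x + c₀ y := by simp [c₀]

@[simp] lemma ch_add (x y : HBig H K) : ch (x + y) = ch x + ch y := by simp [ch]

@[simp] lemma c₁_add (x y : HBig H K) : c₁ (x + y) = c₁ x + c₁ y := by simp [c₁]

@[simp] lemma c₀_smul (c : ℂ) (x : HBig H K) : c₀ (c • x) = c • c₀ x := by simp [c₀]

@[simp] lemma ch_smul (c : ℂ) (x : HBig H K) : ch (c • x) = c • ch x := by simp [ch]

@[simp] lemma c₁_smul (c : ℂ) (x : HBig H K) : c₁ (c • x) = c • c₁ x := by simp [c₁]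

end Components

variable {H K : Type*}
  [NormedAddCommGroup H] [InnerProductSpace ℂ H] [FiniteDimensional ℂ H] [CompleteSpace H]
  [NormedAddCommGroup K] [InnerProductSpace ℂ K] [FiniteDimensional ℂ K] [CompleteSpace K]
  {S : SymmetricSystem H K} {U : LeftOperator H K}
  {F F₂ : Type*}
  [NormedAddCommGroup F] [InnerProductSpace ℂ F] [FiniteDimensional ℂ F] [CompleteSpace F]
  [NormedAddCommGroup F₂] [InnerProductSpace ℂ F₂] [FiniteDimensional ℂ F₂] [CompleteSpace F₂]

/-! ### The boundary maps: surjectivity and the abstract Green identity. -/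

section BoundaryMaps

/-- The operator `Ũ` as a linear map. -/
def JUnitaryExtension.toLin (W : JUnitaryExtension U) : HBig H K →ₗ[ℂ] HBig H K where
  toFun := U.extend W.u₇ W.u₈ W.u₉
  map_add' x y := by
    refine HBig.ext ?_ ?_ ?_ <;> simp [LeftOperator.extend] <;> abel
  map_smul' c x := by
    refine HBig.ext ?_ ?_ ?_ <;> simp [LeftOperator.extend]

/-- Testing `J`-unitarity on `x` and `Jx` shows that `Ũx = 0` forces `Jx = 0`; finite dimension does
the rest. -/
lemma JUnitaryExtension.toLin_surjective (W : JUnitaryExtension U) :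
    Function.Surjective W.toLin := by
  refine LinearMap.injective_iff_surjective.1 ((injective_iff_map_eq_zero _).2 fun x hx => ?_)
  have h := W.jUnitary x (J x)
  change U.extend W.u₇ W.u₈ W.u₉ x = 0 at hx
  rw [hx, map_zero, inner_zero_right] at h
  exact J_injective ((inner_self_eq_zero.1 h.symm).trans (map_zero _).symm)

/-- `Γ_a` as a linear map. -/
def JUnitaryExtension.gammaL (W : JUnitaryExtension U) : S.domMax →ₗ[ℂ] HBig H K :=
  W.toLin ∘ₗ S.evalAt S.a ∘ₗ S.loc ∘ₗ S.domMax.subtype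

@[simp] lemma JUnitaryExtension.gammaA_add (W : JUnitaryExtension U) (y z : S.domMax) :
    W.gammaA (y + z) = W.gammaA y + W.gammaA z := map_add W.gammaL y z

@[simp] lemma JUnitaryExtension.gammaA_smul (W : JUnitaryExtension U) (c : ℂ) (y : S.domMax) :
    W.gammaA (c • y) = c • W.gammaA y := map_smul W.gammaL c y

/-- The part `P₁ Γ₀` of the boundary map `Γ₀`, on `dom 𝒯_max`. -/
def bdry₀ (W : JUnitaryExtension U) (G : EndpointMap S F F₂) :
    S.domMax →ₗ[ℂ] OSum (HZero H K) F where
  toFun y := pair (pair (-W.g₁ y) (Complex.I • (W.gh y - G.gh y))) (fst (G.g₀ y))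
  map_add' y z := by
    refine OSum.ext (OSum.ext ?_ ?_) ?_ <;>
      simp only [map_add, fst_pair, snd_pair, JUnitaryExtension.g₁, JUnitaryExtension.gh,
        JUnitaryExtension.gammaA_add, c₁_add, ch_add]
    · abel
    · module
  map_smul' c y := by
    refine OSum.ext (OSum.ext ?_ ?_) ?_ <;>
      simp only [map_smul, fst_pair, snd_pair, JUnitaryExtension.g₁, JUnitaryExtension.gh,
        JUnitaryExtension.gammaA_smul, c₁_smul, ch_smul, RingHom.id_apply]
    · module
    · module

/-- The part `P₂ Γ₀` of the boundary map `Γ₀`, on `dom 𝒯_max`. -/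
def bdry₂ (G : EndpointMap S F F₂) : S.domMax →ₗ[ℂ] F₂ := (snd : OSum F F₂ →L[ℂ] F₂) ∘ₗ G.g₀

/-- The boundary map `Γ₁`, on `dom 𝒯_max`. -/
def bdry₁ (W : JUnitaryExtension U) (G : EndpointMap S F F₂) :
    S.domMax →ₗ[ℂ] OSum (HZero H K) F where
  toFun y := pair (pair (W.g₀ y) ((1 / 2 : ℂ) • (W.gh y + G.gh y))) (-G.g₁ y)
  map_add' y z := by
    refine OSum.ext (OSum.ext ?_ ?_) ?_ <;>
      simp only [map_add, fst_pair, snd_pair, JUnitaryExtension.g₀, JUnitaryExtension.gh,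
        JUnitaryExtension.gammaA_add, c₀_add, ch_add]
    · module
    · abel
  map_smul' c y := by
    refine OSum.ext (OSum.ext ?_ ?_) ?_ <;>
      simp only [map_smul, fst_pair, snd_pair, JUnitaryExtension.g₀, JUnitaryExtension.gh,
        JUnitaryExtension.gammaA_smul, c₀_smul, ch_smul, RingHom.id_apply]
    · module
    · module

lemma bdry₂_apply (G : EndpointMap S F F₂) (y : S.domMax) : bdry₂ G y = snd (G.g₀ y) := rfl

/-- The limit form at `b` pairs `y` to zero with every `z`, and it is nondegenerate because `Γ_b` is
surjective. -/
lemma EndpointMap.eq_zero_of_vanish (G : EndpointMap S F F₂) {y : S.domMax} {β : S.I}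
    (hy : ∀ t : S.I, β ≤ t → ((y : S.lTwo) : ℝ → HBig H K) t = 0) :
    G.g₀ y = 0 ∧ G.gh y = 0 ∧ G.g₁ y = 0 := by
  have key : ∀ z : S.domMax, ⟪inl (G.g₁ z), G.g₀ y⟫_ℂ - ⟪G.g₀ z, inl (G.g₁ y)⟫_ℂ
        + Complex.I * ⟪snd (G.g₀ z), snd (G.g₀ y)⟫_ℂ
        + Complex.I * ⟪G.gh z, G.gh y⟫_ℂ = 0 := fun z => by
    refine tendsto_nhds_unique ((G.lagrange y z).comp S.tendsto_exh) ?_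
    refine tendsto_const_nhds.congr' ?_
    obtain ⟨N, hN⟩ := S.exists_le_exh β
    refine eventually_atTop.2 ⟨N, fun n hn => ?_⟩
    rw [Function.comp_apply, hy _ (hN n hn), map_zero, inner_zero_right]
  -- The boundary data of `z` are those for which the form becomes the sum of the squared norms of
  -- all components of `Γ_b y`.
  obtain ⟨z, h0, hh, h1⟩ := G.surj (pair (-G.g₁ y) (Complex.I • snd (G.g₀ y)))
    (Complex.I • G.gh y) (fst (G.g₀ y))
  have h := key z
  rw [h0, hh, h1] at h
  simp only [inl_apply, inner_def, fst_pair, snd_pair, inner_zero_left, inner_zero_right,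
    inner_neg_left, inner_smul_left, Complex.conj_I, inner_self_eq_ofReal] at h
  have h' := congrArg Complex.re h
  simp only [mul_neg, neg_mul, ← mul_assoc, Complex.I_mul_I, one_mul, neg_neg, sub_neg_eq_add,
    add_zero, Complex.add_re, Complex.ofReal_re, Complex.zero_re] at h'
  have n0 := sq_nonneg ‖fst (G.g₀ y)‖
  have n1 := sq_nonneg ‖snd (G.g₀ y)‖
  have n2 := sq_nonneg ‖G.gh y‖
  have n3 := sq_nonneg ‖G.g₁ y‖
  exact ⟨OSum.ext ((norm_eq_zero.1 (pow_eq_zero_iff two_ne_zero |>.1 (by linarith))).trans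
      (map_zero _).symm)
    ((norm_eq_zero.1 (pow_eq_zero_iff two_ne_zero |>.1 (by linarith))).trans (map_zero _).symm),
    norm_eq_zero.1 (pow_eq_zero_iff two_ne_zero |>.1 (by linarith)),
    norm_eq_zero.1 (pow_eq_zero_iff two_ne_zero |>.1 (by linarith))⟩

/-- The initial value is adjusted by a function vanishing near `b`, which leaves `Γ_b` unchanged.
Data at the two endpoints are therefore independent. -/
lemma exists_domMax_of_bdry (hS : S.Definite) (G : EndpointMap S F F₂) (c : HBig H K)
    (e : OSum F F₂) (k : K) (f : F) : ∃ y : S.domMax, ((y : S.lTwo) : ℝ → HBig H K) S.a = c ∧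
      G.g₀ y = e ∧ G.gh y = k ∧ G.g₁ y = f := by
  obtain ⟨y, h0, hh, h1⟩ := G.surj e k f
  obtain ⟨x, g, hx, hxa, β, hβ⟩ := hS.exists_compact (c - ((y : S.lTwo) : ℝ → HBig H K) S.a)
  obtain ⟨e0, e1, e2⟩ := G.eq_zero_of_vanish (y := ⟨x, S.mem_domMax x g hx⟩) hβ
  refine ⟨y + ⟨x, S.mem_domMax x g hx⟩, ?_, ?_, ?_, ?_⟩
  · show ((y : S.lTwo) : ℝ → HBig H K) S.a + (x : ℝ → HBig H K) S.a = c
    rw [hxa, add_sub_cancel]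
  · rw [map_add, e0, add_zero, h0]
  · rw [map_add, e1, add_zero, hh]
  · rw [map_add, e2, add_zero, h1]

/-- Joint surjectivity of the boundary maps. -/
lemma exists_bdry_eq (hS : S.Definite) (W : JUnitaryExtension U) (G : EndpointMap S F F₂)
    (u₀ : OSum (HZero H K) F) (u₂ : F₂) (u₁ : OSum (HZero H K) F) :
    ∃ y, bdry₀ W G y = u₀ ∧ bdry₂ G y = u₂ ∧ bdry₁ W G y = u₁ := by
  -- With `s` and `v` the prescribed values of `i(Γ̂_a - Γ̂_b)y` and `½(Γ̂_a + Γ̂_b)y`, one needs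
  -- `Γ̂_a y = v - (i/2)s` and `Γ̂_b y = v + (i/2)s`.
  obtain ⟨c, hc⟩ := W.toLin_surjective (mk₃ (fst (fst u₁))
    (snd (fst u₁) - (Complex.I / 2) • snd (fst u₀)) (-fst (fst u₀)))
  obtain ⟨y, ha, h0, hh, h1⟩ := exists_domMax_of_bdry hS G c (pair (snd u₀) u₂)
    (snd (fst u₁) + (Complex.I / 2) • snd (fst u₀)) (-snd u₁)
  have hg : W.gammaA y = _ := (congrArg W.toLin ha).trans hc
  refine ⟨y, ?_, ?_, ?_⟩
  · refine OSum.ext (OSum.ext ?_ ?_) ?_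
    · simp [bdry₀, JUnitaryExtension.g₁, hg]
    · show Complex.I • (ch (W.gammaA y) - G.gh y) = _
      have h2 : ∀ v s : K, v - (Complex.I / 2) • s - (v + (Complex.I / 2) • s)
          = (-Complex.I) • s := fun v s => by module
      rw [hg, hh, ch_mk₃, h2, smul_smul, mul_neg, Complex.I_mul_I, neg_neg, one_smul]
    · show fst (G.g₀ y) = _
      rw [h0, fst_pair]
  · rw [bdry₂_apply, h0, snd_pair]
  · refine OSum.ext (OSum.ext ?_ ?_) ?_
    · simp [bdry₁, JUnitaryExtension.g₀, hg]
    · show (1 / 2 : ℂ) • (ch (W.gammaA y) + G.gh y) = _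
      rw [hg, hh, ch_mk₃]
      module
    · show -G.g₁ y = _
      rw [h1, neg_neg]

/-- The abstract Green identity. -/
lemma bdry_green (W : JUnitaryExtension U) (G : EndpointMap S F F₂) {y z : S.domMax}
    {f g : S.lTwo} (hy : S.Solves (y : S.lTwo) f) (hz : S.Solves (z : S.lTwo) g) :
    S.ip (z : S.lTwo) f - S.ip g (y : S.lTwo) = ⟪bdry₀ W G z, bdry₁ W G y⟫_ℂ
      - ⟪bdry₁ W G z, bdry₀ W G y⟫_ℂ + Complex.I * ⟪bdry₂ G z, bdry₂ G y⟫_ℂ := by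
  have h1 := (G.lagrange y z).comp S.tendsto_exh
  have h2 : Tendsto (fun n => S.ip (S.cut (S.exh n) (S.loc z)) f
        - S.ip (S.cut (S.exh n) (S.loc g)) (y : S.lTwo)
        + ⟪((z : S.lTwo) : ℝ → HBig H K) S.a, J (((y : S.lTwo) : ℝ → HBig H K) S.a)⟫_ℂ) atTop
      (𝓝 (S.ip (z : S.lTwo) f - S.ip g (y : S.lTwo)
        + ⟪((z : S.lTwo) : ℝ → HBig H K) S.a, J (((y : S.lTwo) : ℝ → HBig H K) S.a)⟫_ℂ)) :=
    ((S.tendsto_ip_cut (S.loc z) f (S.integrable_inner_Δ (z : S.lTwo).2 f.2)).sub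
      (S.tendsto_ip_cut (S.loc g) (y : S.lTwo)
        (S.integrable_inner_Δ g.2 (y : S.lTwo).2))).add_const _
  have h3 := tendsto_nhds_unique (h2.congr fun n => ?_) h1
  -- `J`-unitarity writes the form at `a` in terms of `Γ_a`. The difference of the `Ĥ`-terms at `b`
  -- and `a` polarizes into products of `i(Γ̂_a - Γ̂_b)` with `½(Γ̂_a + Γ̂_b)`.
  · rw [← W.jUnitary] at h3
    change _ + ⟪W.gammaA z, J (W.gammaA y)⟫_ℂ = _ at h3
    rw [inner_HBig, ← eq_sub_iff_add_eq] at h3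
    rw [h3]
    simp only [c₀_J, ch_J, c₁_J, bdry₀, bdry₁, bdry₂_apply, LinearMap.coe_mk,
      AddHom.coe_mk, inl_apply, inner_def, fst_pair, snd_pair,
      JUnitaryExtension.g₀, JUnitaryExtension.gh, JUnitaryExtension.g₁, inner_neg_left,
      inner_neg_right, inner_smul_left, inner_smul_right, inner_add_left, inner_add_right,
      inner_sub_left, inner_sub_right, inner_zero_left, inner_zero_right, Complex.conj_I]
    simp only [map_div₀, map_one, map_ofNat]
    ring
  · have h4 := S.green (y := S.loc y) (z := S.loc z) (f := S.loc f) (g := S.loc g) hy hz (S.exh n)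
    rw [S.ip_cut_right, S.ip_cut_right] at h4
    rw [← h4, S.coe_loc, S.coe_loc, sub_add_cancel]
    rfl

end BoundaryMaps

/-! ### The inhomogeneous equation with zero boundary values. -/

section Solvability

/-- Coercivity and Cauchy–Schwarz give `ε ‖x‖ ≤ ‖w‖`. -/
lemma weak_bound {ε : ℝ} (hε : 0 < ε) (q x w : S.lTwo)
    (h : ε * S.nrm x ^ 2 ≤ ‖S.ip x w‖) : ‖S.ip q x‖ ≤ S.nrm q / ε * S.nrm w := by
  have h1 := h.trans (S.norm_ip_le _ _)
  have h2 : ε * S.nrm x ≤ S.nrm w := by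
    rcases (S.nrm_nonneg x).eq_or_lt with h0 | h0
    · rw [← h0, mul_zero]
      exact S.nrm_nonneg _
    · refine le_of_mul_le_mul_left ?_ h0
      linarith
  refine (S.norm_ip_le q x).trans ?_
  rw [div_mul_eq_mul_div, le_div_iff₀ hε, mul_assoc]
  refine mul_le_mul_of_nonneg_left ?_ (S.nrm_nonneg q)
  rwa [mul_comm]

/-- `N` is the domain of a restriction of `𝒯_max`, and `hN` says that `g - λ̄x` is bounded below on
it. Hence `g - λ̄x ↦ (x, q)` is well defined and bounded, and Hahn–Banach applies. By `hc` the
restriction contains the test functions needed to represent the extension by some `v`; the final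
clause says that `v` belongs to the adjoint of the restriction. -/
lemma SymmetricSystem.Definite.exists_weak_solution (hS : S.Definite) (l : ℂ)
    (N : Submodule ℂ S.domMax) {ε : ℝ} (hε : 0 < ε)
    (hN : ∀ x ∈ N, ∀ g : S.lTwo, S.Solves (x : S.lTwo) g →
      ε * S.nrm x ^ 2 ≤ ‖S.ip (x : S.lTwo) (g - (starRingEnd ℂ) l • (x : S.lTwo) : S.lTwo)‖)
    (hc : ∀ x : S.domMax, ((x : S.lTwo) : ℝ → HBig H K) S.a = 0 →
      (∃ β : S.I, ∀ t : S.I, β ≤ t → ((x : S.lTwo) : ℝ → HBig H K) t = 0) → x ∈ N)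
    (q : S.lTwo) : ∃ v : S.lTwo, S.Solves v (l • v + q : S.lTwo) ∧
      ∀ x ∈ N, ∀ g : S.lTwo, S.Solves (x : S.lTwo) g →
        S.ip v g = S.ip (l • v + q : S.lTwo) (x : S.lTwo) := by
  have hC : 0 ≤ S.nrm q / ε := div_nonneg (S.nrm_nonneg q) hε.le
  obtain ⟨C, hCε⟩ : ∃ C : NNReal, (C : ℝ) = S.nrm q / ε := ⟨⟨_, hC⟩, rfl⟩
  obtain ⟨ℓ, hℓ, hb⟩ := LinearMap.exists_extension_of_norm_le_on
    (S.tMax ⊓ (N.map S.domMax.subtype).comap (LinearMap.fst ℂ S.lTwo S.lTwo))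
    (LinearMap.snd ℂ S.lTwo S.lTwo - (starRingEnd ℂ) l • LinearMap.fst ℂ S.lTwo S.lTwo)
    (S.ipS q ∘ₗ LinearMap.fst ℂ S.lTwo S.lTwo)
    (C • S.seminorm) (by
      rintro ⟨x', g⟩ ⟨hg, x, hx, hxx⟩
      obtain rfl : (x : S.lTwo) = x' := hxx
      show ‖S.ip q x‖ ≤ C * S.nrm (g - (starRingEnd ℂ) l • (x : S.lTwo) : S.lTwo)
      rw [hCε]
      exact weak_bound hε _ _ _ (hN x hx g hg))
  have hℓ' : ∀ x ∈ N, ∀ g : S.lTwo, S.Solves (x : S.lTwo) g →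
      ℓ (g - (starRingEnd ℂ) l • (x : S.lTwo)) = S.ip q (x : S.lTwo) := fun x hx g hg =>
    hℓ ((x : S.lTwo), g) ⟨hg, x, hx, rfl⟩
  obtain ⟨v, hv, hvℓ⟩ := hS.exists_rep (q := q) (l := l) (ℓ := ℓ) C.2 hb fun x w hx hxa hxb => by
    have h1 := hℓ' ⟨x, S.mem_domMax x _ hx⟩ (hc _ hxa hxb) _ hx
    rwa [add_sub_cancel_left] at h1
  refine ⟨v, hv, fun x hx g hg => ?_⟩
  have h1 := hℓ' x hx g hg
  rw [hvℓ] at h1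
  simp only [← SymmetricSystem.ipS_apply, map_sub, map_add, map_smul, map_smulₛₗ,
    LinearMap.add_apply, LinearMap.smul_apply] at h1 ⊢
  rw [← h1, add_sub_cancel]

lemma SymmetricSystem.ip_self_im (f : S.lTwo) : (S.ip f f).im = 0 := by
  have h := congrArg Complex.im (S.ip_conj_symm f f)
  rw [Complex.conj_im] at h
  linarith

/-- The diagonal case of the abstract Green identity. It is the source of both the lower bounds and
the uniqueness statements. -/
lemma im_ip_eq (W : JUnitaryExtension U) (G : EndpointMap S F F₂) {x : S.domMax}
    {g : S.lTwo} (hx : S.Solves (x : S.lTwo) g) (l : ℂ) :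
    (S.ip (x : S.lTwo) (g - (starRingEnd ℂ) l • (x : S.lTwo) : S.lTwo)).im
      = (⟪bdry₀ W G x, bdry₁ W G x⟫_ℂ).im + ‖bdry₂ G x‖ ^ 2 / 2 + l.im * S.nrm x ^ 2 := by
  have h := bdry_green W G hx hx
  rw [← S.ip_conj_symm g, ← inner_conj_symm (bdry₁ W G x), inner_self_eq_ofReal] at h
  have h1 := congrArg Complex.im h
  rw [Complex.sub_im, Complex.conj_im, Complex.add_im, Complex.sub_im, Complex.conj_im,
    Complex.I_mul_im, Complex.ofReal_re] at h1
  have h3 : (S.ip (x : S.lTwo) (g - (starRingEnd ℂ) l • (x : S.lTwo) : S.lTwo))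
      = S.ip (x : S.lTwo) g - (starRingEnd ℂ) l * S.ip (x : S.lTwo) (x : S.lTwo) := by
    simp only [← SymmetricSystem.ipS_apply, map_sub, map_smul, smul_eq_mul]
  rw [h3, S.nrm_sq, Complex.sub_im, Complex.mul_im, S.ip_self_im, Complex.conj_im]
  linarith

lemma bdry_eq_zero_of_vanish (W : JUnitaryExtension U) (G : EndpointMap S F F₂) {x : S.domMax}
    (ha : ((x : S.lTwo) : ℝ → HBig H K) S.a = 0)
    (hb : ∃ β : S.I, ∀ t : S.I, β ≤ t → ((x : S.lTwo) : ℝ → HBig H K) t = 0) :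
    bdry₀ W G x = 0 ∧ bdry₂ G x = 0 := by
  obtain ⟨β, hβ⟩ := hb
  obtain ⟨h0, hh, h1⟩ := G.eq_zero_of_vanish hβ
  have hg : W.gammaA x = 0 := (congrArg W.toLin ha).trans (map_zero _)
  refine ⟨OSum.ext (OSum.ext ?_ ?_) ?_, ?_⟩
  · simp [bdry₀, JUnitaryExtension.g₁, hg, c₁]
  · simp [bdry₀, JUnitaryExtension.gh, hg, ch, hh]
  · simp [bdry₀, h0]
  · rw [bdry₂_apply, h0, map_zero]

variable (W : JUnitaryExtension U) (G : EndpointMap S F F₂)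

/-- For `Im λ > 0` the term `‖P₂Γ₀x‖²` has the favourable sign, so the large restriction `P₁Γ₀x = 0`
is already coercive. Its adjoint is correspondingly small, and the whole of `Γ₀v` vanishes. -/
lemma exists_solution_plus (hS : S.Definite) {l : ℂ} (hl : 0 < l.im) (q : S.lTwo) :
    ∃ v : S.domMax, S.Solves (v : S.lTwo) (l • (v : S.lTwo) + q : S.lTwo) ∧
      bdry₀ W G v = 0 ∧ bdry₂ G v = 0 := by
  obtain ⟨v, hv, h⟩ := hS.exists_weak_solution l (LinearMap.ker (bdry₀ W G)) hl
    (fun x hx g hg => by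
      refine le_trans ?_ ((le_abs_self _).trans (Complex.abs_im_le_norm _))
      rw [im_ip_eq W G hg l, LinearMap.mem_ker.1 hx, inner_zero_left, Complex.zero_im]
      have := sq_nonneg ‖bdry₂ G x‖
      linarith)
    (fun x ha hb => (bdry_eq_zero_of_vanish W G ha hb).1) q
  -- Membership in the adjoint kills the boundary form. On the kernel of `P₁Γ₀` the values of `Γ₁x`
  -- and `P₂Γ₀x` are arbitrary, so both coefficients vanish.
  have key : ∀ x, bdry₀ W G x = 0 → ⟪bdry₀ W G ⟨v, S.mem_domMax v _ hv⟩, bdry₁ W G x⟫_ℂ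
      + Complex.I * ⟪bdry₂ G ⟨v, S.mem_domMax v _ hv⟩, bdry₂ G x⟫_ℂ = 0 := fun x hx => by
    obtain ⟨⟨x', g⟩, hg, hxx⟩ := x.2
    obtain rfl : x' = (x : S.lTwo) := hxx
    have h1 := bdry_green W G (z := ⟨v, S.mem_domMax v _ hv⟩) hg hv
    rw [h x hx g hg, sub_self, hx, inner_zero_right, sub_zero] at h1
    exact h1.symm
  refine ⟨⟨v, S.mem_domMax v _ hv⟩, hv, ?_, ?_⟩
  · obtain ⟨x, h0, h2, h1⟩ := exists_bdry_eq hS W G 0 0 (bdry₀ W G ⟨v, S.mem_domMax v _ hv⟩)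
    have h3 := key x h0
    rw [h1, h2, inner_zero_right, mul_zero, add_zero] at h3
    exact inner_self_eq_zero.1 h3
  · obtain ⟨x, h0, h2, h1⟩ := exists_bdry_eq hS W G 0 (bdry₂ G ⟨v, S.mem_domMax v _ hv⟩) 0
    have h3 := key x h0
    rw [h1, h2, inner_zero_right, zero_add] at h3
    exact inner_self_eq_zero.1 ((mul_eq_zero.1 h3).resolve_left Complex.I_ne_zero)

/-- For `Im λ < 0` the term `‖P₂Γ₀x‖²` has the wrong sign, so the restriction must also require
`P₂Γ₀x = 0`. The larger adjoint leaves only `P₁Γ₀v = 0`. -/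
lemma exists_solution_minus (hS : S.Definite) {l : ℂ} (hl : l.im < 0) (q : S.lTwo) :
    ∃ v : S.domMax, S.Solves (v : S.lTwo) (l • (v : S.lTwo) + q : S.lTwo) ∧
      bdry₀ W G v = 0 := by
  obtain ⟨v, hv, h⟩ := hS.exists_weak_solution l
    (LinearMap.ker (bdry₀ W G) ⊓ LinearMap.ker (bdry₂ G)) (neg_pos.2 hl)
    (fun x hx g hg => by
      refine le_trans ?_ ((neg_le_abs _).trans (Complex.abs_im_le_norm _))
      rw [im_ip_eq W G hg l, LinearMap.mem_ker.1 hx.1, LinearMap.mem_ker.1 hx.2, inner_zero_left,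
        Complex.zero_im, norm_zero]
      linarith)
    (fun x ha hb => bdry_eq_zero_of_vanish W G ha hb) q
  refine ⟨⟨v, S.mem_domMax v _ hv⟩, hv, ?_⟩
  obtain ⟨x, h0, h2, h1⟩ := exists_bdry_eq hS W G 0 0 (bdry₀ W G ⟨v, S.mem_domMax v _ hv⟩)
  obtain ⟨⟨x', g⟩, hg, hxx⟩ := x.2
  obtain rfl : x' = (x : S.lTwo) := hxx
  have h3 := bdry_green W G (z := ⟨v, S.mem_domMax v _ hv⟩) hg hv
  rw [h x ⟨h0, h2⟩ g hg, sub_self, h0, h1, h2, inner_zero_right, inner_zero_right, mul_zero,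
    add_zero, sub_zero] at h3
  exact inner_self_eq_zero.1 h3.symm

/-- The functions of `dom 𝒯_max` which solve `J y' - B y = λ Δ y`. -/
def defectDom (S : SymmetricSystem H K) (l : ℂ) : Submodule ℂ S.domMax :=
  (S.Sol l).comap (S.loc ∘ₗ S.domMax.subtype)

lemma mem_defectDom {l : ℂ} {y : S.domMax} :
    y ∈ defectDom S l ↔ S.Solves (y : S.lTwo) (l • (y : S.lTwo) : S.lTwo) := Iff.rfl

lemma energy {l : ℂ} {y : S.domMax} (hy : y ∈ defectDom S l) :
    2 * l.im * S.nrm y ^ 2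
      = 2 * (⟪bdry₀ W G y, bdry₁ W G y⟫_ℂ).im + ‖bdry₂ G y‖ ^ 2 := by
  have h := im_ip_eq W G (mem_defectDom.1 hy) l
  have h1 : S.ip (y : S.lTwo) (l • (y : S.lTwo) - (starRingEnd ℂ) l • (y : S.lTwo) : S.lTwo)
      = (l - (starRingEnd ℂ) l) * S.ip (y : S.lTwo) (y : S.lTwo) := by
    simp only [← SymmetricSystem.ipS_apply, map_sub, map_smul, smul_eq_mul]
    ring
  rw [h1, Complex.mul_im, S.ip_self_im, ← S.nrm_sq, Complex.sub_im, Complex.conj_im] at h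
  linarith

lemma eq_zero_of_nrm_eq_zero (hS : S.Definite) {l : ℂ} {y : S.domMax} (hy : y ∈ defectDom S l)
    (h : S.nrm y ^ 2 ≤ 0) : y = 0 := by
  rw [S.nrm_sq] at h
  have h1 := hS l _ hy (S.Δ_eq_zero_of_ip_self h)
  refine Subtype.ext (Subtype.ext (funext fun t => ?_))
  by_cases ht : t ∈ S.I
  · exact h1 t ht
  · exact (y : S.lTwo).2.2.1 t ht

lemma sub_mem_defectDom {l : ℂ} {u v : S.domMax} {f : S.lTwo} (hu : S.Solves (u : S.lTwo) f)
    (hv : S.Solves (v : S.lTwo) (l • (v : S.lTwo) + (f - l • (u : S.lTwo)) : S.lTwo)) :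
    u - v ∈ defectDom S l := by
  have h1 : ((u : S.lTwo), f) - ((v : S.lTwo), l • (v : S.lTwo) + (f - l • (u : S.lTwo)))
    ∈ S.tMax := S.tMax.sub_mem hu hv
  have h2 : f - (l • (v : S.lTwo) + (f - l • (u : S.lTwo)))
      = l • ((u : S.lTwo) - (v : S.lTwo)) := by
    rw [smul_sub]
    abel
  rw [Prod.mk_sub_mk, h2] at h1
  exact h1

/-- A pair `{u, f}` with the prescribed boundary values is corrected by the solution with source `f
- λu` and zero boundary values. -/
lemma exists_defect_plus (hS : S.Definite) {l : ℂ} (hl : 0 < l.im) (u₀ : OSum (HZero H K) F)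
    (u₂ : F₂) : ∃ y ∈ defectDom S l, bdry₀ W G y = u₀ ∧ bdry₂ G y = u₂ := by
  obtain ⟨u, h0, h2, -⟩ := exists_bdry_eq hS W G u₀ u₂ 0
  obtain ⟨⟨u', f⟩, hf, hu⟩ := u.2
  obtain rfl : u' = (u : S.lTwo) := hu
  obtain ⟨v, hv, hv0, hv2⟩ := exists_solution_plus W G hS hl (f - l • (u : S.lTwo))
  refine ⟨u - v, sub_mem_defectDom hf hv, ?_, ?_⟩
  · exact (map_sub (bdry₀ W G) u v).trans (by rw [h0, hv0, sub_zero])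
  · exact (map_sub (bdry₂ G) u v).trans (by rw [h2, hv2, sub_zero])

lemma exists_defect_minus (hS : S.Definite) {l : ℂ} (hl : l.im < 0) (u₀ : OSum (HZero H K) F) :
    ∃ y ∈ defectDom S l, bdry₀ W G y = u₀ := by
  obtain ⟨u, h0, -, -⟩ := exists_bdry_eq hS W G u₀ 0 0
  obtain ⟨⟨u', f⟩, hf, hu⟩ := u.2
  obtain rfl : u' = (u : S.lTwo) := hu
  obtain ⟨v, hv, hv0⟩ := exists_solution_minus W G hS hl (f - l • (u : S.lTwo))
  exact ⟨u - v, sub_mem_defectDom hf hv, (map_sub (bdry₀ W G) u v).trans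
    (by rw [h0, hv0, sub_zero])⟩

end Solvability

end SymmSys

end

noncomputable section

namespace SymmSys

open OSum

/-! ### The kernel of a boundary parameter is a semidefinite relation. -/

section Dissipative

variable {F F₂ : Type*}
  [NormedAddCommGroup F] [InnerProductSpace ℂ F] [NormedAddCommGroup F₂] [InnerProductSpace ℂ F₂]

/-- In the Cayley coordinates `e = a + b`, `f = -i(a - b)` the form `Im ⟪e, f⟫` is diagonal. -/
lemma im_inner_cayley (a b : F) :
    (⟪a + b, -Complex.I • (a - b)⟫_ℂ).im = ‖b‖ ^ 2 - ‖a‖ ^ 2 := by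
  have h := congrArg Complex.re (inner_conj_symm b a)
  rw [Complex.conj_re] at h
  rw [inner_smul_right, inner_add_left, inner_sub_right, inner_sub_right, inner_self_eq_ofReal,
    inner_self_eq_ofReal]
  simp only [neg_mul, Complex.neg_im, Complex.I_mul_im, Complex.add_re, Complex.sub_re,
    Complex.ofReal_re]
  linarith

lemma norm_add_I_smul_sq (p q : F) :
    ‖p + Complex.I • q‖ ^ 2 = ‖p - Complex.I • q‖ ^ 2 + 4 * (⟪q, p⟫_ℂ).im := by
  have h := congrArg Complex.im (inner_conj_symm q p)
  rw [Complex.conj_im] at h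
  rw [@norm_add_sq ℂ, @norm_sub_sq ℂ, inner_smul_right, RCLike.re_to_complex, Complex.I_mul_re]
  linarith

lemma re_inner_le_quarter (u v : F) : (⟪u, v⟫_ℂ).re ≤ ‖u‖ ^ 2 / 4 + ‖v‖ ^ 2 := by
  have h := (Complex.re_le_norm _).trans (norm_inner_le_norm (𝕜 := ℂ) u v)
  nlinarith [sq_nonneg (‖u‖ - 2 * ‖v‖)]

lemma re_inner_le_half (u v : F) : (⟪u, v⟫_ℂ).re ≤ ‖u‖ ^ 2 / 2 + ‖v‖ ^ 2 / 2 := by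
  have h := (Complex.re_le_norm _).trans (norm_inner_le_norm (𝕜 := ℂ) u v)
  nlinarith [sq_nonneg (‖u‖ - ‖v‖)]

lemma inner_cayley (p q a b : F) : ⟪p, a + b⟫_ℂ + ⟪q, -Complex.I • (a - b)⟫_ℂ
    = ⟪p + Complex.I • q, a⟫_ℂ + ⟪p - Complex.I • q, b⟫_ℂ := by
  simp only [inner_add_right, inner_sub_right, inner_smul_right, inner_add_left, inner_sub_left,
    inner_smul_left, Complex.conj_I]
  ring

/-- Here `p`, `q`, `r` stand for `C₀₁*x`, `C₁*x`, `C₀₂*x`. The relation becomes `2‖a‖² + ‖c‖² = -Re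
⟪p - iq, b⟫`, and positivity gives `‖p - iq‖² ≤ 4‖a‖² + 2‖c‖²`; the weight `1/4` in
`re_inner_le_quarter` absorbs exactly half of the left side. -/
lemma two_mul_norm_sq_le (p q a b : F) (r c : F₂)
    (h : ⟪p, a + b⟫_ℂ + ⟪q, -Complex.I • (a - b)⟫_ℂ + ⟪r, c⟫_ℂ = 0)
    (ha : p + Complex.I • q = (2 : ℂ) • a) (hr : r = c)
    (hpos : 0 ≤ 2 * (⟪q, p⟫_ℂ).im + ‖r‖ ^ 2) : 2 * ‖a‖ ^ 2 + ‖c‖ ^ 2 ≤ 2 * ‖b‖ ^ 2 := by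
  subst hr
  have h1 := norm_add_I_smul_sq p q
  rw [inner_cayley, ha, inner_smul_left, inner_self_eq_ofReal, inner_self_eq_ofReal] at h
  have h2 := congrArg Complex.re h
  simp only [map_ofNat, Complex.add_re, Complex.mul_re, Complex.re_ofNat,
    Complex.im_ofNat, zero_mul, sub_zero, Complex.ofReal_re,
    Complex.zero_re] at h2
  have h3 := re_inner_le_quarter (-(p - Complex.I • q)) b
  rw [inner_neg_left, Complex.neg_re, norm_neg] at h3
  rw [ha, norm_smul, mul_pow, Complex.norm_ofNat] at h1
  linarith

/-- Mirror image, with `D` in place of `C`. As `r` is not tied to `c` here, a second estimate with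
weights `1/2` is needed, and its `‖r‖²` cancels against that of the hypothesis. -/
lemma two_mul_norm_sq_ge (p q a b : F) (r c : F₂)
    (h : ⟪p, a + b⟫_ℂ + ⟪q, -Complex.I • (a - b)⟫_ℂ + ⟪r, c⟫_ℂ = 0)
    (hb : p - Complex.I • q = (-2 : ℂ) • b)
    (hneg : 2 * (⟪q, p⟫_ℂ).im + ‖r‖ ^ 2 ≤ 0) : 2 * ‖b‖ ^ 2 ≤ 2 * ‖a‖ ^ 2 + ‖c‖ ^ 2 := by
  have h1 := norm_add_I_smul_sq p q
  rw [inner_cayley, hb, inner_smul_left, inner_self_eq_ofReal] at h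
  have h2 := congrArg Complex.re h
  simp only [map_neg, map_ofNat, neg_mul, Complex.neg_re, Complex.add_re, Complex.mul_re, Complex.re_ofNat,
    Complex.im_ofNat, zero_mul, sub_zero,
    Complex.ofReal_re, Complex.zero_re] at h2
  have h3 := re_inner_le_quarter (p + Complex.I • q) a
  have h4 := re_inner_le_half r c
  rw [hb, norm_smul, mul_pow, norm_neg, Complex.norm_ofNat] at h1
  linarith

lemma exists_cayley (e f : F) : ∃ a b : F, e = a + b ∧ f = -Complex.I • (a - b) := by
  refine ⟨(1 / 2 : ℂ) • (e + Complex.I • f), (1 / 2 : ℂ) • (e - Complex.I • f), by module, ?_⟩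
  have h : (1 / 2 : ℂ) • (e + Complex.I • f) - (1 / 2 : ℂ) • (e - Complex.I • f)
      = Complex.I • f := by module
  rw [h, smul_smul, neg_mul, Complex.I_mul_I, neg_neg, one_smul]

variable [CompleteSpace F] [CompleteSpace F₂]

lemma inner_two_smul_opIm {V : Type*} [NormedAddCommGroup V] [InnerProductSpace ℂ V]
    [CompleteSpace V] (A B : F →L[ℂ] V) (R : F₂ →L[ℂ] V) (x : V) :
    (⟪x, ((2 : ℂ) • opIm (A ∘L B.adjoint) + R ∘L R.adjoint) x⟫_ℂ).re
      = 2 * (⟪A.adjoint x, B.adjoint x⟫_ℂ).im + ‖R.adjoint x‖ ^ 2 := by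
  have h1 : ⟪x, A (B.adjoint x)⟫_ℂ = ⟪A.adjoint x, B.adjoint x⟫_ℂ :=
    (ContinuousLinearMap.adjoint_inner_left _ _ _).symm
  have h2 : ⟪x, R (R.adjoint x)⟫_ℂ = ((‖R.adjoint x‖ ^ 2 : ℝ) : ℂ) := by
    rw [← ContinuousLinearMap.adjoint_inner_left, inner_self_eq_ofReal]
  have h3 : ⟪x, B (A.adjoint x)⟫_ℂ = (starRingEnd ℂ) ⟪A.adjoint x, B.adjoint x⟫_ℂ := by
    rw [← ContinuousLinearMap.adjoint_inner_left, inner_conj_symm]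
  have h4 : ((2 : ℂ) • opIm (A ∘L B.adjoint) + R ∘L R.adjoint) x
      = (-Complex.I) • (A (B.adjoint x) - B (A.adjoint x)) + R (R.adjoint x) := by
    rw [opIm, smul_smul, ContinuousLinearMap.adjoint_comp, ContinuousLinearMap.adjoint_adjoint]
    have : (2 : ℂ) * (2 * Complex.I)⁻¹ = -Complex.I := by
      rw [mul_inv, Complex.inv_I, mul_inv_cancel_left₀ two_ne_zero]
    rw [this]
    rfl
  rw [h4, inner_add_right, inner_smul_right, inner_sub_right, h1, h2, h3]
  simp only [neg_mul, Complex.add_re, Complex.neg_re, Complex.I_mul_re, Complex.sub_im,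
    Complex.conj_im, Complex.ofReal_re]
  ring

lemma exists_adjoint_eq {V : Type*} [NormedAddCommGroup V] [InnerProductSpace ℂ V]
    [CompleteSpace V] {P : V →L[ℂ] V} (hP : IsUnit P) (w : V) : ∃ x, P.adjoint x = w := by
  obtain ⟨Q, hQ⟩ := (IsUnit.star hP).exists_right_inv
  exact ⟨Q w, DFunLike.congr_fun hQ w⟩

lemma inner_eq_zero_of_pair {V : Type*} [NormedAddCommGroup V] [InnerProductSpace ℂ V]
    [CompleteSpace V] (A : OSum F F₂ →L[ℂ] V) (B : F →L[ℂ] V) (x : V) (e : OSum F F₂) (f : F)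
    (h : A e + B f = 0) : ⟪(A ∘L inl).adjoint x, fst e⟫_ℂ + ⟪B.adjoint x, f⟫_ℂ
      + ⟪(A ∘L inr).adjoint x, snd e⟫_ℂ = 0 := by
  have he : A e = A (inl (fst e)) + A (inr (snd e)) := by
    rw [← map_add]
    refine congrArg A (OSum.ext ?_ ?_) <;> simp
  rw [ContinuousLinearMap.adjoint_inner_left, ContinuousLinearMap.adjoint_inner_left,
    ContinuousLinearMap.adjoint_inner_left, ← inner_zero_right x, ← h, inner_add_right, he,
    inner_add_right]
  simp only [ContinuousLinearMap.comp_apply]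
  ring

namespace BoundaryParameter

variable (τ : BoundaryParameter F F₂) {l : ℂ} {e : OSum F F₂} {f : F}

lemma norm_sq_le_of_kernel (hl : 0 < l.im) (h : τ.C₀ l e + τ.C₁ l f = 0) :
    ‖snd e‖ ^ 2 ≤ 2 * (⟪fst e, f⟫_ℂ).im := by
  obtain ⟨a, b, ha, hb⟩ := exists_cayley (fst e) f
  -- The adjoint of `C₀ - iC₁P₁` sends `x` to `{C₀₁*x + iC₁*x, C₀₂*x}`; its surjectivity permits
  -- prescribing the value `{2a, snd e}`.
  obtain ⟨x, hx⟩ := exists_adjoint_eq (τ.unit_C l hl) (pair ((2 : ℂ) • a) (snd e))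
  have hx' : ∀ w, ⟪pair ((2 : ℂ) • a) (snd e), w⟫_ℂ
      = ⟪x, τ.C₀ l w⟫_ℂ - Complex.I * ⟪x, τ.C₁ l (fst w)⟫_ℂ := fun w => by
    rw [← hx, ContinuousLinearMap.adjoint_inner_left, ← inner_smul_right, ← inner_sub_right]
    rfl
  have h1 := inner_eq_zero_of_pair _ _ x e f h
  rw [ha, hb] at h1
  rw [ha, hb, im_inner_cayley]
  have h2 := ((τ.pos_C l hl).re_inner_nonneg_right x).trans_eq (inner_two_smul_opIm _ _ _ x)
  have h3 := two_mul_norm_sq_le _ _ a b _ (snd e) h1 ?_ ?_ h2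
  · linarith
  · refine ext_inner_right ℂ fun v => ?_
    have := hx' (inl v)
    simp only [inl_apply, inner_def, fst_pair, snd_pair, inner_zero_right, add_zero] at this
    rw [this, inner_add_left, inner_smul_left, ContinuousLinearMap.adjoint_inner_left,
      ContinuousLinearMap.adjoint_inner_left, Complex.conj_I, neg_mul, ← sub_eq_add_neg]
    rfl
  · refine ext_inner_right ℂ fun v => ?_
    have := hx' (inr v)
    simp only [inr_apply, inner_def, fst_pair, snd_pair, inner_zero_right, zero_add, map_zero,
      mul_zero, sub_zero] at this
    rw [this, ContinuousLinearMap.adjoint_inner_left]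
    rfl

lemma norm_sq_ge_of_kernel (hl : l.im < 0) (h : τ.D₀ l e + τ.D₁ l f = 0) :
    2 * (⟪fst e, f⟫_ℂ).im ≤ ‖snd e‖ ^ 2 := by
  obtain ⟨a, b, ha, hb⟩ := exists_cayley (fst e) f
  -- The adjoint of `D₀₁ + iD₁` sends `x` to `D₀₁*x - iD₁*x`.
  obtain ⟨x, hx⟩ := exists_adjoint_eq (τ.unit_D l hl) ((-2 : ℂ) • b)
  have h1 := inner_eq_zero_of_pair _ _ x e f h
  rw [ha, hb] at h1
  rw [ha, hb, im_inner_cayley]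
  have h2 := ((τ.neg_D l hl).re_inner_nonneg_right x).trans_eq
    ((congrArg Complex.re (inner_neg_right _ _)).trans ((Complex.neg_re _).trans
      (congrArg Neg.neg (inner_two_smul_opIm (τ.D₁ l) (τ.D₀ l ∘L inl) (τ.D₀ l ∘L inr) x))))
  have h3 := two_mul_norm_sq_ge _ _ a b _ (snd e) h1 ?_ (by linarith)
  · linarith
  · refine ext_inner_right ℂ fun v => ?_
    rw [← hx, ContinuousLinearMap.adjoint_inner_left, inner_sub_left, inner_smul_left,
      ContinuousLinearMap.adjoint_inner_left, ContinuousLinearMap.adjoint_inner_left,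
      Complex.conj_I, neg_mul, sub_neg_eq_add, ← inner_smul_right, ← inner_add_right]
    rfl

end BoundaryParameter

end Dissipative

end SymmSys

end

noncomputable section

/-- If some linear map `V → W` is bijective and `W` is finite-dimensional, then every injective
linear map `V → W` is bijective. -/
lemma LinearMap.bijective_of_injective_of_bijective {V W : Type*} [AddCommMonoid V] [Module ℂ V]
    [AddCommGroup W] [Module ℂ W] [FiniteDimensional ℂ W] {A T : V →ₗ[ℂ] W}
    (hA : Function.Bijective A) (hT : Function.Injective T) : Function.Bijective T := by
  refine ⟨hT, fun w => ?_⟩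
  obtain ⟨x, hx⟩ := LinearMap.injective_iff_surjective
    (f := T ∘ₗ (LinearEquiv.ofBijective A hA).symm.toLinearMap) |>.1
    (hT.comp (LinearEquiv.injective _)) w
  exact ⟨_, hx⟩

namespace SymmSys

open OSum

variable {H K : Type*}
  [NormedAddCommGroup H] [InnerProductSpace ℂ H] [FiniteDimensional ℂ H] [CompleteSpace H]
  [NormedAddCommGroup K] [InnerProductSpace ℂ K] [FiniteDimensional ℂ K] [CompleteSpace K]
  {S : SymmetricSystem H K} {U : LeftOperator H K}
  {F F₂ : Type*}
  [NormedAddCommGroup F] [InnerProductSpace ℂ F] [FiniteDimensional ℂ F] [CompleteSpace F]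
  [NormedAddCommGroup F₂] [InnerProductSpace ℂ F₂] [FiniteDimensional ℂ F₂] [CompleteSpace F₂]

/-! ### Defect subspaces and spaces of solutions. -/

section Defect

lemma sub_mem_of_mem {N : Submodule ℂ S.domMax} {y z : S.domMax} (hy : y ∈ N) (hz : z ∈ N) :
    y - z ∈ N := by
  have h : y - z = y + (-1 : ℂ) • z := Subtype.ext (Subtype.ext (funext fun t => by
    show ((y : S.lTwo) : ℝ → HBig H K) t - ((z : S.lTwo) : ℝ → HBig H K) t
      = ((y : S.lTwo) : ℝ → HBig H K) t + (-1 : ℂ) • ((z : S.lTwo) : ℝ → HBig H K) t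
    rw [neg_one_smul, sub_eq_add_neg]))
  rw [h]
  exact N.add_mem hy (N.smul_mem _ hz)

lemma injective_comp_subtype {N : Submodule ℂ S.domMax} {X : Type*} [AddCommGroup X] [Module ℂ X]
    (A : S.domMax →ₗ[ℂ] X) (hA : ∀ y ∈ N, A y = 0 → y = 0) :
    Function.Injective (A ∘ₗ N.subtype) := fun y z h =>
  Subtype.ext (sub_eq_zero.1 (hA _ (sub_mem_of_mem y.2 z.2)
    ((map_sub A _ _).trans (sub_eq_zero.2 h))))

/-- In the quotient `f` and `λy` agree only modulo null functions. `Δ` annihilates those a.e., and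
the equation sees `f` only through `Δf`. -/
lemma rep_mem_defectDom {l : ℂ} {p : S.TMax} (hp : p ∈ S.defect l) :
    S.rep p ∈ defectDom S l := by
  obtain ⟨f, h, e⟩ := (S.exists_rep p).choose_spec
  have h1 : S.π (S.rep p) = (p : S.LTwo × S.LTwo).1 := congrArg Prod.fst e
  have h2 : S.π f = (p : S.LTwo × S.LTwo).2 := congrArg Prod.snd e
  have h3 : (p : S.LTwo × S.LTwo).2 = l • (p : S.LTwo × S.LTwo).1 := hp
  have h4 : f - l • (S.rep p : S.lTwo) ∈ S.nullSpace := by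
    refine (Submodule.Quotient.eq _).1 ?_
    change S.π f = S.π (l • (S.rep p : S.lTwo))
    rw [map_smul, h1, h2, h3]
  refine ⟨h.1, ?_⟩
  filter_upwards [h.2, S.Δ_eq_zero_of_mem_nullSpace h4] with t ⟨y', hy', e1⟩ e2
  refine ⟨y', hy', e1.trans (sub_eq_zero.1 ?_)⟩
  rw [← map_sub]
  exact e2

lemma exists_mem_defect (hS : S.Definite) {l : ℂ} {y : S.domMax} (hy : y ∈ defectDom S l) :
    ∃ p ∈ S.defect l, S.rep p = y := by
  have hy' : ((y : S.lTwo), l • (y : S.lTwo)) ∈ S.tMax := hy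
  let p : S.TMax := ⟨(S.π y, S.π (l • (y : S.lTwo))), _, hy', rfl⟩
  refine ⟨p, map_smul S.π l (y : S.lTwo), ?_⟩
  exact (S.rep_unique hS p y _ hy' rfl).symm

lemma rep_injOn_defect (l : ℂ) : InjOn S.rep (S.defect l) := by
  intro p hp q hq h
  have h1 : ∀ p : S.TMax, S.π (S.rep p) = (p : S.LTwo × S.LTwo).1 := fun p => by
    obtain ⟨f, -, e⟩ := (S.exists_rep p).choose_spec
    exact congrArg Prod.fst e
  have h2 : (p : S.LTwo × S.LTwo).1 = (q : S.LTwo × S.LTwo).1 := by rw [← h1, ← h1, h]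
  refine Subtype.ext (Prod.ext h2 ?_)
  rw [show (p : S.LTwo × S.LTwo).2 = _ from hp, show (q : S.LTwo × S.LTwo).2 = _ from hq, h2]

/-- A linear map on `dom 𝒯_max` which is injective on the solutions and takes all values on them
induces a bijection on the defect subspace. -/
lemma bijOn_defect (hS : S.Definite) {l : ℂ} {X : Type*} [AddCommGroup X] [Module ℂ X]
    (A : S.domMax →ₗ[ℂ] X) (hA : ∀ y ∈ defectDom S l, A y = 0 → y = 0)
    (hs : ∀ x, ∃ y ∈ defectDom S l, A y = x) :
    BijOn (fun p => A (S.rep p)) (S.defect l) univ := by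
  refine ⟨fun _ _ => mem_univ _, fun p hp q hq h => ?_, fun x _ => ?_⟩
  · refine rep_injOn_defect l hp hq (sub_eq_zero.1 (hA _ ?_ ?_))
    · exact sub_mem_of_mem (rep_mem_defectDom hp) (rep_mem_defectDom hq)
    · exact (map_sub A _ _).trans (sub_eq_zero.2 h)
  · obtain ⟨y, hy, rfl⟩ := hs x
    obtain ⟨p, hp, rfl⟩ := exists_mem_defect hS hy
    exact ⟨p, hp, rfl⟩

lemma bijective_domRestrict_defect {l : ℂ} {X : Type*} [AddCommGroup X] [Module ℂ X]
    (A : S.domMax →ₗ[ℂ] X) (hA : ∀ y ∈ defectDom S l, A y = 0 → y = 0)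
    (hs : ∀ x, ∃ y ∈ defectDom S l, A y = x) :
    Function.Bijective (A ∘ₗ (defectDom S l).subtype) := by
  refine ⟨injective_comp_subtype A hA, fun x => ?_⟩
  obtain ⟨y, hy, h⟩ := hs x
  exact ⟨⟨y, hy⟩, h⟩

/-- On the solutions, a linear map factors through every bijective one. -/
lemma exists_factor_defect {l : ℂ} {X Y : Type*} [NormedAddCommGroup X] [NormedSpace ℂ X]
    [FiniteDimensional ℂ X] [NormedAddCommGroup Y] [NormedSpace ℂ Y]
    (A : S.domMax →ₗ[ℂ] X) (hA : ∀ y ∈ defectDom S l, A y = 0 → y = 0)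
    (hs : ∀ x, ∃ y ∈ defectDom S l, A y = x) (B : S.domMax →ₗ[ℂ] Y) :
    ∃ M : X →L[ℂ] Y, ∀ y ∈ defectDom S l, M (A y) = B y := by
  let e := LinearEquiv.ofBijective _ (bijective_domRestrict_defect A hA hs)
  refine ⟨LinearMap.toContinuousLinearMap (B ∘ₗ (defectDom S l).subtype ∘ₗ e.symm.toLinearMap),
    fun y hy => ?_⟩
  have h : e.symm (A y) = ⟨y, hy⟩ := e.symm_apply_apply ⟨y, hy⟩
  show B (e.symm (A y) : S.domMax) = B y
  rw [h]

end Defect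

/-! ### Weyl functions, boundary conditions and the formula for `m_τ`. -/

section BoundaryConditions

variable (W : JUnitaryExtension U) (G : EndpointMap S F F₂)

lemma energy_eq {l : ℂ} {y : S.domMax} (hy : y ∈ defectDom S l) (h : fst (bdry₀ W G y) = 0) :
    2 * l.im * S.nrm y ^ 2
      = ‖snd (G.g₀ y)‖ ^ 2 - 2 * (⟪fst (G.g₀ y), G.g₁ y⟫_ℂ).im := by
  have h1 : snd (bdry₁ W G y) = -G.g₁ y := rfl
  rw [energy W G hy, inner_def, h, inner_zero_left, zero_add, h1, inner_neg_right, Complex.neg_im,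
    bdry₂_apply]
  have h2 : snd (bdry₀ W G y) = fst (G.g₀ y) := rfl
  rw [h2]
  ring

variable {W G}

/-- In `energy_eq` the left side is nonnegative, while the boundary condition makes the right side
nonpositive. -/
lemma eq_zero_of_condition_plus (hS : S.Definite) (τ : BoundaryParameter F F₂) {l : ℂ}
    (hl : 0 < l.im) {y : S.domMax} (hy : y ∈ defectDom S l) (h : fst (bdry₀ W G y) = 0)
    (hτ : τ.C₀ l (G.g₀ y) + τ.C₁ l (G.g₁ y) = 0) : y = 0 := by
  refine eq_zero_of_nrm_eq_zero hS hy ?_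
  have h1 := energy_eq W G hy h
  have h2 := τ.norm_sq_le_of_kernel hl hτ
  nlinarith

lemma eq_zero_of_condition_minus (hS : S.Definite) (τ : BoundaryParameter F F₂) {l : ℂ}
    (hl : l.im < 0) {y : S.domMax} (hy : y ∈ defectDom S l) (h : fst (bdry₀ W G y) = 0)
    (hτ : τ.D₀ l (G.g₀ y) + τ.D₁ l (G.g₁ y) = 0) : y = 0 := by
  refine eq_zero_of_nrm_eq_zero hS hy ?_
  have h1 := energy_eq W G hy h
  have h2 := τ.norm_sq_ge_of_kernel hl hτ
  nlinarith

variable (W G)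

/-- The boundary map `Γ₀` on `dom 𝒯_max`. -/
def gammaZero : S.domMax →ₗ[ℂ] OSum (HZero H K) (OSum F F₂) :=
  (inl : HZero H K →L[ℂ] OSum (HZero H K) (OSum F F₂)).toLinearMap ∘ₗ
    (fst : OSum (HZero H K) F →L[ℂ] HZero H K).toLinearMap ∘ₗ bdry₀ W G
  + (inr : OSum F F₂ →L[ℂ] OSum (HZero H K) (OSum F F₂)).toLinearMap ∘ₗ G.g₀

lemma gammaZero_apply (y : S.domMax) : gammaZero W G y = pair (fst (bdry₀ W G y)) (G.g₀ y) := by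
  refine OSum.ext ?_ ?_
  · show fst (pair (fst (bdry₀ W G y)) (0 : OSum F F₂) + pair 0 (G.g₀ y)) = _
    simp
  · show snd (pair (fst (bdry₀ W G y)) (0 : OSum F F₂) + pair 0 (G.g₀ y)) = _
    simp

lemma gammaZero_injective (hS : S.Definite) {l : ℂ} (hl : 0 < l.im) {y : S.domMax}
    (hy : y ∈ defectDom S l) (h : gammaZero W G y = 0) : y = 0 := by
  rw [gammaZero_apply] at h
  have h1 : fst (bdry₀ W G y) = 0 := (congrArg fst h).trans (map_zero _)
  have h2 : G.g₀ y = 0 := (congrArg snd h).trans (map_zero _)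
  -- On `ℂ₊` the boundary condition of `τ₀` is `Γ_{0b}y = 0`.
  refine eq_zero_of_condition_plus hS (tauZero F F₂) hl hy h1 ?_
  rw [h2, map_zero, zero_add]
  rfl

lemma exists_gammaZero_eq (hS : S.Definite) {l : ℂ} (hl : 0 < l.im)
    (x : OSum (HZero H K) (OSum F F₂)) : ∃ y ∈ defectDom S l, gammaZero W G y = x := by
  obtain ⟨y, hy, h0, h2⟩ := exists_defect_plus W G hS hl (pair (fst x) (fst (snd x)))
    (snd (snd x))
  refine ⟨y, hy, ?_⟩
  rw [gammaZero_apply, h0]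
  exact OSum.ext rfl (OSum.ext (congrArg snd h0) h2)

lemma bdry₀_injective (hS : S.Definite) {l : ℂ} (hl : l.im < 0) {y : S.domMax}
    (hy : y ∈ defectDom S l) (h : bdry₀ W G y = 0) : y = 0 := by
  have h2 : fst (G.g₀ y) = 0 := (congrArg snd h).trans (map_zero _)
  refine eq_zero_of_condition_minus (W := W) (G := G) hS (tauZero F F₂) hl hy (by rw [h, map_zero])
    ?_
  exact (add_zero _).trans h2

lemma exists_isWeylPlus (hS : S.Definite) {l : ℂ} (hl : 0 < l.im) : ∃ M, IsWeylPlus W G l M := by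
  have hA : ∀ y ∈ defectDom S l, gammaZero W G y = 0 → y = 0 :=
    fun y hy => gammaZero_injective W G hS hl hy
  have hs := exists_gammaZero_eq W G hS hl
  obtain ⟨M, hM⟩ := exists_factor_defect _ hA hs (bdry₁ W G)
  have h : ∀ p, Gamma₀ W G p = gammaZero W G (S.rep p) := fun p => (gammaZero_apply W G _).symm
  refine ⟨M, (bijOn_defect hS _ hA hs).congr fun p _ => (h p).symm, fun p hp => ?_⟩
  rw [h]
  exact hM _ (rep_mem_defectDom hp)

/-- The map `Γ₁ + i P₂ Γ₀` on `dom 𝒯_max`. -/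
def gammaOne : S.domMax →ₗ[ℂ] OSum (HZero H K) (OSum F F₂) :=
  (inl : HZero H K →L[ℂ] OSum (HZero H K) (OSum F F₂)).toLinearMap ∘ₗ
    (fst : OSum (HZero H K) F →L[ℂ] HZero H K).toLinearMap ∘ₗ bdry₁ W G
  + (inr : OSum F F₂ →L[ℂ] OSum (HZero H K) (OSum F F₂)).toLinearMap ∘ₗ
    ((inl : F →L[ℂ] OSum F F₂).toLinearMap ∘ₗ
      (snd : OSum (HZero H K) F →L[ℂ] F).toLinearMap ∘ₗ bdry₁ W G
    + Complex.I • (inr : F₂ →L[ℂ] OSum F F₂).toLinearMap ∘ₗ bdry₂ G)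

lemma gammaOne_apply (p : S.TMax) : gammaOne W G (S.rep p)
    = incl₁ (Gamma₁ W G p) + Complex.I • proj₂ (Gamma₀ W G p) := by
  have h : gammaOne W G (S.rep p) = pair (fst (Gamma₁ W G p)) 0
      + pair 0 (pair (snd (Gamma₁ W G p)) 0 + Complex.I • pair 0 (snd (snd (Gamma₀ W G p)))) := rfl
  rw [h]
  refine OSum.ext ?_ (OSum.ext ?_ ?_) <;> simp [incl₁, proj₂]

lemma exists_isWeylMinus (hS : S.Definite) {l : ℂ} (hl : l.im < 0) :
    ∃ M, IsWeylMinus W G l M := by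
  have hA : ∀ y ∈ defectDom S l, bdry₀ W G y = 0 → y = 0 :=
    fun y hy => bdry₀_injective W G hS hl hy
  have hs := exists_defect_minus W G hS hl
  obtain ⟨M, hM⟩ := exists_factor_defect _ hA hs (gammaOne W G)
  refine ⟨M, bijOn_defect hS _ hA hs, fun p hp => ?_⟩
  rw [← gammaOne_apply]
  exact hM _ (rep_mem_defectDom hp)

lemma isWeylPlus_weylPlus (hS : S.Definite) {l : ℂ} (hl : 0 < l.im) :
    IsWeylPlus W G l (weylPlus W G l) := by
  have h := exists_isWeylPlus W G hS hl
  rw [weylPlus, dif_pos h]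
  exact h.choose_spec

lemma isWeylMinus_weylMinus (hS : S.Definite) {l : ℂ} (hl : l.im < 0) :
    IsWeylMinus W G l (weylMinus W G l) := by
  have h := exists_isWeylMinus W G hS hl
  rw [weylMinus, dif_pos h]
  exact h.choose_spec

lemma weylPlus_apply (hS : S.Definite) {l : ℂ} (hl : 0 < l.im) {y : S.domMax}
    (hy : y ∈ defectDom S l) :
    weylPlus W G l (pair (fst (bdry₀ W G y)) (G.g₀ y)) = bdry₁ W G y := by
  obtain ⟨p, hp, rfl⟩ := exists_mem_defect hS hy
  exact (isWeylPlus_weylPlus W G hS hl).2 p hp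

lemma fst_weylMinus_apply (hS : S.Definite) {l : ℂ} (hl : l.im < 0) {y : S.domMax}
    (hy : y ∈ defectDom S l) :
    fst (weylMinus W G l (bdry₀ W G y)) = fst (bdry₁ W G y) := by
  obtain ⟨p, hp, rfl⟩ := exists_mem_defect hS hy
  have h := congrArg fst ((isWeylMinus_weylMinus W G hS hl).2 p hp)
  refine h.trans ?_
  rw [map_add, map_smul]
  show fst (Gamma₁ W G p) + Complex.I • (0 : HZero H K) = fst (Gamma₁ W G p)
  rw [smul_zero, add_zero]

/-- The functions of `dom 𝒯_max` which solve `J y' - B y = λ Δ y` and satisfy the boundary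
condition given by `τ`. -/
def conditionDom (G : EndpointMap S F F₂) (τ : BoundaryParameter F F₂) (l : ℂ) :
    Submodule ℂ S.domMax where
  carrier := {y | y ∈ defectDom S l ∧
    (0 < l.im → τ.C₀ l (G.g₀ y) + τ.C₁ l (G.g₁ y) = 0) ∧
    (l.im < 0 → τ.D₀ l (G.g₀ y) + τ.D₁ l (G.g₁ y) = 0)}
  zero_mem' := ⟨zero_mem _, fun _ => by simp, fun _ => by simp⟩
  add_mem' {y z} hy hz := by
    refine ⟨add_mem hy.1 hz.1, fun h => ?_, fun h => ?_⟩
    · have := congrArg₂ (· + ·) (hy.2.1 h) (hz.2.1 h)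
      simp only [map_add]
      simpa [add_add_add_comm] using this
    · have := congrArg₂ (· + ·) (hy.2.2 h) (hz.2.2 h)
      simp only [map_add]
      simpa [add_add_add_comm] using this
  smul_mem' c y hy := by
    refine ⟨Submodule.smul_mem _ c hy.1, fun h => ?_, fun h => ?_⟩
    · simp only [map_smul, ← smul_add, hy.2.1 h, smul_zero]
    · simp only [map_smul, ← smul_add, hy.2.2 h, smul_zero]

variable (τ : BoundaryParameter F F₂)

lemma eq_zero_of_mem_conditionDom (hS : S.Definite) {l : ℂ} (hl : l.im ≠ 0) {y : S.domMax}
    (hy : y ∈ conditionDom G τ l) (h : fst (bdry₀ W G y) = 0) : y = 0 := by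
  rcases hl.lt_or_gt with hl | hl
  · exact eq_zero_of_condition_minus hS τ hl hy.1 h (hy.2.2 hl)
  · exact eq_zero_of_condition_plus hS τ hl hy.1 h (hy.2.1 hl)

/-- The known bijection `A` shows that the solution space has the dimension of the target. The map
`T`, built from the boundary condition of `τ`, is injective by uniqueness, hence surjective. -/
lemma exists_mem_conditionDom (hS : S.Definite) {l : ℂ} (hl : l.im ≠ 0) (h : HZero H K) :
    ∃ y ∈ conditionDom G τ l, fst (bdry₀ W G y) = h := by
  let P : S.domMax →ₗ[ℂ] HZero H K :=
    (fst : OSum (HZero H K) F →L[ℂ] HZero H K).toLinearMap ∘ₗ bdry₀ W G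
  rcases hl.lt_or_gt with hl | hl
  · let A : S.domMax →ₗ[ℂ] HZero H K × F :=
      P.prod ((snd : OSum (HZero H K) F →L[ℂ] F).toLinearMap ∘ₗ bdry₀ W G)
    let T : S.domMax →ₗ[ℂ] HZero H K × F :=
      P.prod ((τ.D₀ l).toLinearMap ∘ₗ G.g₀ + (τ.D₁ l).toLinearMap ∘ₗ G.g₁)
    have hA : Function.Bijective (A ∘ₗ (defectDom S l).subtype) :=
      bijective_domRestrict_defect A (fun y hy h0 => bdry₀_injective W G hS hl hy
        (OSum.ext ((congrArg Prod.fst h0).trans (map_zero _).symm)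
          ((congrArg Prod.snd h0).trans (map_zero _).symm))) fun x => by
        obtain ⟨y, hy, h0⟩ := exists_defect_minus W G hS hl (pair x.1 x.2)
        exact ⟨y, hy, Prod.ext (congrArg fst h0) (congrArg snd h0)⟩
    have hT : Function.Injective (T ∘ₗ (defectDom S l).subtype) :=
      injective_comp_subtype T fun y hy h0 =>
        eq_zero_of_condition_minus hS τ hl hy (congrArg Prod.fst h0) (congrArg Prod.snd h0)
    obtain ⟨y, hy⟩ := (LinearMap.bijective_of_injective_of_bijective hA hT).2 (h, 0)
    exact ⟨y, ⟨y.2, fun h => (lt_asymm h hl).elim, fun _ => congrArg Prod.snd hy⟩,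
      congrArg Prod.fst hy⟩
  · let A : S.domMax →ₗ[ℂ] HZero H K × OSum F F₂ := P.prod G.g₀
    let T : S.domMax →ₗ[ℂ] HZero H K × OSum F F₂ :=
      P.prod ((τ.C₀ l).toLinearMap ∘ₗ G.g₀ + (τ.C₁ l).toLinearMap ∘ₗ G.g₁)
    have hA : Function.Bijective (A ∘ₗ (defectDom S l).subtype) :=
      bijective_domRestrict_defect A (fun y hy h0 => gammaZero_injective W G hS hl hy
        ((gammaZero_apply W G y).trans
          (OSum.ext ((congrArg Prod.fst h0).trans (map_zero _).symm)
          ((congrArg Prod.snd h0).trans (map_zero _).symm)))) fun x => by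
        obtain ⟨y, hy, h0⟩ := exists_gammaZero_eq W G hS hl (pair x.1 x.2)
        rw [gammaZero_apply] at h0
        have h1 : fst (bdry₀ W G y) = x.1 := (congrArg fst h0 :)
        have h2 : G.g₀ y = x.2 := (congrArg snd h0 :)
        exact ⟨y, hy, Prod.ext h1 h2⟩
    have hT : Function.Injective (T ∘ₗ (defectDom S l).subtype) :=
      injective_comp_subtype T fun y hy h0 =>
        eq_zero_of_condition_plus hS τ hl hy (congrArg Prod.fst h0) (congrArg Prod.snd h0)
    obtain ⟨y, hy⟩ := (LinearMap.bijective_of_injective_of_bijective hA hT).2 (h, 0)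
    exact ⟨y, ⟨y.2, fun _ => congrArg Prod.snd hy, fun h => (lt_asymm h hl).elim⟩,
      congrArg Prod.fst hy⟩

/-- The solutions subject to the boundary condition depend linearly on `h ∈ H₀`. -/
lemma exists_linear_conditionDom (hS : S.Definite) {l : ℂ} (hl : l.im ≠ 0) :
    ∃ s : HZero H K →ₗ[ℂ] S.domMax, ∀ h, s h ∈ conditionDom G τ l ∧
      fst (bdry₀ W G (s h)) = h := by
  obtain ⟨s, hs⟩ := LinearMap.exists_rightInverse_of_surjective
    ((fst : OSum (HZero H K) F →L[ℂ] HZero H K).toLinearMap ∘ₗ bdry₀ W G ∘ₗ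
      (conditionDom G τ l).subtype) (LinearMap.range_eq_top.2 fun h => by
      obtain ⟨y, hy, h0⟩ := exists_mem_conditionDom W G τ hS hl h
      exact ⟨⟨y, hy⟩, h0⟩)
  exact ⟨(conditionDom G τ l).subtype ∘ₗ s, fun h => ⟨(s h).2, LinearMap.congr_fun hs h⟩⟩

variable {W G τ}

lemma isVTau_iff {l : ℂ} {V : S.OperatorSolution l (HZero H K)} : IsVTau W G τ l V ↔
    ∀ h, V.app h ∈ conditionDom G τ l ∧ fst (bdry₀ W G (V.app h)) = h := by
  refine forall_congr' fun h => ⟨fun ⟨h1, h2, h3, h4⟩ => ⟨⟨V.solves h, h3, h4⟩, ?_⟩,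
    fun ⟨h1, h2⟩ => ⟨?_, ?_, h1.2.1, h1.2.2⟩⟩
  · refine OSum.ext ?_ h2
    show -W.g₁ (V.app h) = _
    rw [h1, neg_neg]
  · have h3 : -W.g₁ (V.app h) = fst h := congrArg fst h2
    rw [← h3, neg_neg]
  · exact congrArg snd h2

/-- The term `(i/2)P_Ĥ` in the definition of `m_τ` turns `Γ̂_a y` into the mean of `Γ̂_a y` and
`Γ̂_b y`. So `m_τ` is a map between components of `Γ₀y` and `Γ₁y`, just like the blocks of the Weyl
functions. -/
lemma pair_eq_fst_bdry₁ {y : S.domMax} {h : HZero H K} (hy : fst (bdry₀ W G y) = h) :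
    pair (W.g₀ y) (W.gh y + (Complex.I / 2) • snd h) = fst (bdry₁ W G y) := by
  have h1 : Complex.I • (W.gh y - G.gh y) = snd h := congrArg snd hy
  refine OSum.ext rfl ?_
  show W.gh y + (Complex.I / 2) • snd h = (1 / 2 : ℂ) • (W.gh y + G.gh y)
  rw [← h1, smul_smul, div_mul_eq_mul_div, Complex.I_mul_I]
  module

lemma exists_isMFunction (hS : S.Definite) {l : ℂ} (hl : l.im ≠ 0) :
    ∃ m, IsMFunction W G τ l m := by
  obtain ⟨s, hs⟩ := exists_linear_conditionDom W G τ hS hl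
  have huniq : ∀ V : S.OperatorSolution l (HZero H K), IsVTau W G τ l V → ∀ h, V.app h = s h :=
    fun V hV h => sub_eq_zero.1 (eq_zero_of_mem_conditionDom W G τ hS hl
      (sub_mem_of_mem (isVTau_iff.1 hV h).1 (hs h).1) (by
        rw [map_sub (bdry₀ W G) (V.app h) (s h), map_sub, (isVTau_iff.1 hV h).2, (hs h).2,
          sub_self]))
  refine ⟨LinearMap.toContinuousLinearMap
    ((fst : OSum (HZero H K) F →L[ℂ] HZero H K).toLinearMap ∘ₗ bdry₁ W G ∘ₗ s),
    -- Evaluating the linear family `s` at `t` gives the operator `v_τ(t, λ)`, bounded because `H₀`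
    -- is finite-dimensional.
    ⟨⟨fun t => LinearMap.toContinuousLinearMap
      (LinearMap.proj t ∘ₗ S.lTwo.subtype ∘ₗ S.domMax.subtype ∘ₗ s),
      fun h => (s h : S.lTwo).2, fun h => (hs h).1.1⟩, isVTau_iff.2 hs, fun V hV => ?_⟩,
    fun V hV h => ?_⟩
  · have h : ∀ t, V.toFun t = LinearMap.toContinuousLinearMap
        (LinearMap.proj t ∘ₗ S.lTwo.subtype ∘ₗ S.domMax.subtype ∘ₗ s) := fun t =>
      ContinuousLinearMap.ext fun h =>
        congrFun (congrArg (fun y : S.domMax => ((y : S.lTwo) : ℝ → HBig H K)) (huniq V hV h)) t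
    cases V
    congr 1
    exact funext h
  · rw [pair_eq_fst_bdry₁ (isVTau_iff.1 hV h).2, huniq V hV h]
    rfl

lemma isMFunction_mFunction (hS : S.Definite) {l : ℂ} (hl : l.im ≠ 0) :
    IsMFunction W G τ l (mFunction W G τ l) := by
  have h := exists_isMFunction (W := W) (G := G) (τ := τ) hS hl
  rw [mFunction, dif_pos h]
  exact h.choose_spec

lemma mFunction_apply (hS : S.Definite) {l : ℂ} (hl : l.im ≠ 0) {y : S.domMax}
    (hy : y ∈ conditionDom G τ l) :
    mFunction W G τ l (fst (bdry₀ W G y)) = fst (bdry₁ W G y) := by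
  obtain ⟨⟨V, hV, -⟩, hm⟩ := isMFunction_mFunction (W := W) (G := G) (τ := τ) hS hl
  have h := isVTau_iff.1 hV (fst (bdry₀ W G y))
  rw [hm V hV, pair_eq_fst_bdry₁ h.2]
  have h1 : V.app (fst (bdry₀ W G y)) = y :=
    sub_eq_zero.1 (eq_zero_of_mem_conditionDom W G τ hS hl (sub_mem_of_mem h.1 hy) (by
      rw [map_sub (bdry₀ W G), map_sub, h.2, sub_self]))
  rw [h1]

/-- The boundary condition of `τ₀` annihilates exactly the component of `Γ₀y`, respectively `P₁Γ₀y`,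
outside `H₀`. On such solutions only the upper left block contributes to the `H₀`-component of
`Γ₁y`. -/
lemma mZero_eq_mFunction (hS : S.Definite) {l : ℂ} (hl : l.im ≠ 0) :
    mZero W G l = mFunction W G (tauZero F F₂) l := by
  refine ContinuousLinearMap.ext fun h => ?_
  obtain ⟨y, hy, rfl⟩ := exists_mem_conditionDom W G (tauZero F F₂) hS hl h
  rw [mFunction_apply hS hl hy]
  rcases hl.lt_or_gt with hl | hl
  · rw [mZero, if_neg hl.not_gt, ← fst_weylMinus_apply W G hS hl hy.1]
    have h1 : fst (G.g₀ y) = 0 := (add_zero _).symm.trans (hy.2.2 hl)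
    have h2 : bdry₀ W G y = pair (fst (bdry₀ W G y)) 0 := OSum.ext rfl h1
    rw [h2]
    rfl
  · rw [mZero, if_pos hl, ← weylPlus_apply W G hS hl hy.1]
    have h1 : G.g₀ y = 0 := (add_zero _).symm.trans (hy.2.1 hl)
    rw [h1]
    rfl

/-- A vector `e` of the kernel is `Γ_{0b}y` for a solution with zero `H₀`-component of `Γ₀y`. As
`Γ_{1b}y = -M₄₊e`, this solution satisfies the boundary condition of `τ`, so it vanishes. -/
lemma isUnit_sub_comp_block (hS : S.Definite) {l : ℂ} (hl : 0 < l.im) :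
    IsUnit (τ.C₀ l - τ.C₁ l ∘L block₂₂ (weylPlus W G l)) := by
  rw [ContinuousLinearMap.isUnit_iff_isUnit_toLinearMap, LinearMap.isUnit_iff_ker_eq_bot,
    LinearMap.ker_eq_bot']
  intro e he
  obtain ⟨y, hy, h0⟩ := exists_gammaZero_eq W G hS hl (pair 0 e)
  rw [gammaZero_apply] at h0
  have h1 : fst (bdry₀ W G y) = 0 := congrArg fst h0
  have h2 : G.g₀ y = e := congrArg snd h0
  have h3 : block₂₂ (weylPlus W G l) e = -G.g₁ y := by
    have h4 := congrArg snd (weylPlus_apply W G hS hl hy)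
    rw [h1, h2] at h4
    exact h4
  have h5 : τ.C₀ l e - τ.C₁ l (block₂₂ (weylPlus W G l) e) = 0 := he
  rw [h3, map_neg, sub_neg_eq_add, ← h2] at h5
  rw [← h2, eq_zero_of_condition_plus hS τ hl hy h1 h5, map_zero]

lemma mFunction_eq (hS : S.Definite) {l : ℂ} (hl : 0 < l.im) :
    mFunction W G τ l = mZero W G l + block₁₂ (weylPlus W G l) ∘L
      Ring.inverse (τ.C₀ l - τ.C₁ l ∘L block₂₂ (weylPlus W G l)) ∘L τ.C₁ l ∘L
      block₂₁ (weylPlus W G l) := by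
  refine ContinuousLinearMap.ext fun h => ?_
  obtain ⟨y, hy, rfl⟩ := exists_mem_conditionDom W G τ hS hl.ne' h
  rw [mFunction_apply hS hl.ne' hy, mZero, if_pos hl]
  have hM := weylPlus_apply W G hS hl hy.1
  set M := weylPlus W G l
  set h := fst (bdry₀ W G y)
  set e := G.g₀ y with he
  have hsum : pair h e = inl h + inr e := by
    refine OSum.ext ?_ ?_ <;> simp
  rw [hsum, map_add] at hM
  have h1 : fst (bdry₁ W G y) = block₁₁ M h + block₁₂ M e := by
    rw [← hM, map_add]
    rfl
  have h2 : -G.g₁ y = block₂₁ M h + block₂₂ M e := by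
    have : snd (bdry₁ W G y) = block₂₁ M h + block₂₂ M e := by
      rw [← hM, map_add]
      rfl
    exact this
  -- The boundary condition with `-Γ_{1b}y = M₃₊h + M₄₊e` substituted: a linear equation determining
  -- `e = Γ_{0b}y` from `h`.
  have h3 : (τ.C₀ l - τ.C₁ l ∘L block₂₂ M) e = τ.C₁ l (block₂₁ M h) := by
    show τ.C₀ l e - τ.C₁ l (block₂₂ M e) = _
    have h4 := hy.2.1 hl
    rw [← neg_neg (G.g₁ y), h2, map_neg, ← sub_eq_add_neg, map_add, sub_eq_zero] at h4
    rw [he, h4, add_sub_cancel_right]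
  have h5 : Ring.inverse (τ.C₀ l - τ.C₁ l ∘L block₂₂ M) (τ.C₁ l (block₂₁ M h)) = e := by
    rw [← h3]
    exact DFunLike.congr_fun (Ring.inverse_mul_cancel _ (isUnit_sub_comp_block hS hl)) e
  rw [h1]
  show _ = block₁₁ M h + block₁₂ M (Ring.inverse (τ.C₀ l - τ.C₁ l ∘L block₂₂ M)
    (τ.C₁ l (block₂₁ M h)))
  rw [h5]

end BoundaryConditions

end SymmSys

end

theorem theorem5p4
    {H K F F₂ : Type*}
    [NormedAddCommGroup H] [InnerProductSpace ℂ H] [FiniteDimensional ℂ H] [CompleteSpace H]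
    [NormedAddCommGroup K] [InnerProductSpace ℂ K] [FiniteDimensional ℂ K] [CompleteSpace K]
    [NormedAddCommGroup F] [InnerProductSpace ℂ F] [FiniteDimensional ℂ F] [CompleteSpace F]
    [NormedAddCommGroup F₂] [InnerProductSpace ℂ F₂] [FiniteDimensional ℂ F₂] [CompleteSpace F₂]
    (S : SymmSys.SymmetricSystem H K) (hS : S.Definite)
    (U : SymmSys.LeftOperator H K) (W : SymmSys.JUnitaryExtension U)
    (G : SymmSys.EndpointMap S F F₂) :
    -- the Weyl functions of the decomposing boundary triplet are well defined
    (∀ l : ℂ, 0 < l.im → SymmSys.IsWeylPlus W G l (SymmSys.weylPlus W G l)) ∧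
    (∀ l : ℂ, l.im < 0 → SymmSys.IsWeylMinus W G l (SymmSys.weylMinus W G l)) ∧
    -- the `m`-functions are well defined
    (∀ (τ : SymmSys.BoundaryParameter F F₂) (l : ℂ), l.im ≠ 0 →
      SymmSys.IsMFunction W G τ l (SymmSys.mFunction W G τ l)) ∧
    -- `m₀ = m_{τ₀}` on `ℂ ∖ ℝ`
    (∀ l : ℂ, l.im ≠ 0 →
      SymmSys.mZero W G l = SymmSys.mFunction W G (SymmSys.tauZero F F₂) l) ∧
    -- the formula for `m_τ` on `ℂ₊`
    ∀ (τ : SymmSys.BoundaryParameter F F₂) (l : ℂ), 0 < l.im →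
      IsUnit (τ.C₀ l - τ.C₁ l ∘L SymmSys.OSum.block₂₂ (SymmSys.weylPlus W G l)) ∧
      SymmSys.mFunction W G τ l = SymmSys.mZero W G l
        + SymmSys.OSum.block₁₂ (SymmSys.weylPlus W G l) ∘L
          Ring.inverse (τ.C₀ l - τ.C₁ l ∘L SymmSys.OSum.block₂₂ (SymmSys.weylPlus W G l)) ∘L
          τ.C₁ l ∘L SymmSys.OSum.block₂₁ (SymmSys.weylPlus W G l) :=
  ⟨fun _ hl => SymmSys.isWeylPlus_weylPlus W G hS hl,
    fun _ hl => SymmSys.isWeylMinus_weylMinus W G hS hl,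
    fun _ _ hl => SymmSys.isMFunction_mFunction hS hl,
    fun _ hl => SymmSys.mZero_eq_mFunction hS hl,
    fun _ _ hl => ⟨SymmSys.isUnit_sub_comp_block hS hl, SymmSys.mFunction_eq hS hl⟩⟩
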